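/- Let $H$ be a real separable Hilbert space and $V$ a reflexive real Banach space, continuously and densely embedded in $H$, so that $V\subset H\cong H^*\subset V^*$ is a Gelfand triple. Let $Q$ be a positive trace class operator on $H$, and let $H_0=Q^{1/2}H$ with the inner product $\langle u,w\rangle_{H_0}=\langle Q^{-1/2}u,Q^{-1/2}w\rangle_H$ ($Q^{-1/2}$ being the inverse of $Q^{1/2}$ on the orthogonal complement of its kernel). For $M>0$ let $S_M=\{v\in L^2(\mathbb R;H_0):\int_{-\infty}^{\infty}\|v(s)\|_{H_0}^2\,ds\le M\}$. Let $A:V\to V^*$ be a bounded linear operator, let $F:V\to H$ and $B:V\to L(H)$ be maps, and let $(S_A(t))_{t\ge0}$ be the strongly continuous semigroup on $H$ associated with $A$, i.e. the one generated by the part of $A$ in $H$, the operator $u\mapsto Au$ with domain $\{u\in V:Au\in H\}$. Assume: (i) there are $\lambda,C_0>0$ such that for all $u,w\in V$ $${}_{V^*}\langle Au-Aw+F(u)-F(w),u-w\rangle_V\le-\lambda\|u-w\|_V^2+C_0\|u-w\|_H^2\|u\|_V^2,$$ $${}_{V^*}\langle Au+F(u),u\rangle_V\le-\lambda\|u\|_V^2,\qquad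 {}_{V^*}\langle Au,u\rangle_V\le-\lambda\|u\|_V^2;$$ (ii) for all $N\in\mathbb N$ and $\rho>0$ there are $C>0$ and $\alpha\in(-1,0)$ such that for all $0\le t_0<t\le N$ and all $u,w\in V$ with $\|u\|_H,\|w\|_H\le\rho$ $$\Big\|\int_{t_0}^{t}S_A(s)\big(F(u)-F(w)\big)\,ds\Big\|_H^2\le C\int_{t_0}^{t}s^{\alpha}\|u-w\|_H^2\,ds;$$ (iii) there are $\beta_0,D_0>0$ such that $|B(u)-B(w)|_{L(H)}\le\beta_0\|u-w\|_H$ and $|B(u)|_{L(H)}\le D_0$ for all $u,w\in V$. Then for every $M>0$ and every $v\in S_M$ there is a unique continuous $X^*_v:\mathbb R\to H$, with $X^*_v(r)\in V$ for almost every $r$, such that for every $t\in\mathbb R$ $$X^*_v(t)=\int_{-\infty}^{t}S_A(t-r)F(X^*_v(r))\,dr+\int_{-\infty}^{t}S_A(t-r)B(X^*_v(r))v(r)\,dr$$ (both integrals being convergent Bochner integrals in $H$) and $\sup_{t\in\mathbb R}\|X^*_v(t)\|_H^2<\infty$. Moreover, for every $n\in\mathbb N$ the skeleton equation $\dot X=AX+F(X)+B(X)v$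 has a unique mild solution on $[-n,\infty)$ with $X(-n)=0$, that is, a unique continuous $X^n_v:[-n,\infty)\to H$, with values in $V$ almost everywhere, such that $X^n_v(t)=\int_{-n}^{t}S_A(t-r)F(X^n_v(r))\,dr+\int_{-n}^{t}S_A(t-r)B(X^n_v(r))v(r)\,dr$ (Bochner integrals in $H$) for all $t\ge-n$; and if $X^n_v$ is extended by $0$ to $(-\infty,-n]$, then $\lim_{n\to\infty}\sup_{t\in[-N,N]}\|X^n_v(t)-X^*_v(t)\|_H=0$ for every $N\in\mathbb N$. -/

import Mathlib

open MeasureTheory Set Filter Topology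
open scoped RealInnerProductSpace

noncomputable section

namespace Skeleton

section CameronMartin

variable {H : Type*} [NormedAddCommGroup H] [InnerProductSpace ℝ H] [CompleteSpace H]

/-- A trace class covariance operator: a positive (self-adjoint) bounded operator with
`∑ₖ ⟪Q aₖ, aₖ⟫ < ∞` for an orthonormal basis `(aₖ)`. -/
def IsTraceClassCovariance (Q : H →L[ℝ] H) : Prop :=
  Q.IsPositive ∧
    ∃ (s : Set H) (b : HilbertBasis s ℝ H), Summable fun k : s => ⟪Q (b k), b k⟫

/-- `R` is the positive square root `Q^{1/2}` of `Q`. -/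
def IsPosSqrt (R Q : H →L[ℝ] H) : Prop :=
  R.IsPositive ∧ R.comp R = Q

/-- The space `H₀ = R H` (for `R = Q^{1/2}`), as a vector space. It carries the norm defined
below, not the norm of `H`. -/
def H0 (R : H →L[ℝ] H) : Type _ :=
  LinearMap.range (R : H →ₗ[ℝ] H)

instance (R : H →L[ℝ] H) : AddCommGroup (H0 R) :=
  inferInstanceAs (AddCommGroup (LinearMap.range (R : H →ₗ[ℝ] H)))

instance (R : H →L[ℝ] H) : Module ℝ (H0 R) :=
  inferInstanceAs (Module ℝ (LinearMap.range (R : H →ₗ[ℝ] H)))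

/-- The inclusion of `H₀` in `H`. -/
def H0.toH (R : H →L[ℝ] H) : H0 R →ₗ[ℝ] H :=
  (LinearMap.range (R : H →ₗ[ℝ] H)).subtype

theorem isCompl_ker (R : H →L[ℝ] H) :
    IsCompl (LinearMap.ker (R : H →ₗ[ℝ] H)) (LinearMap.ker (R : H →ₗ[ℝ] H))ᗮ := by
  have : CompleteSpace (LinearMap.ker (R : H →ₗ[ℝ] H)) :=
    (ContinuousLinearMap.isClosed_ker R).completeSpace_coe
  exact Submodule.isCompl_orthogonal _

/-- The (pseudo-)inverse `R⁻¹ : R H → (ker R)ᗮ ⊆ H`. -/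
def H0.pinv (R : H →L[ℝ] H) : H0 R →ₗ[ℝ] H :=
  (LinearMap.ker (R : H →ₗ[ℝ] H))ᗮ.subtype ∘ₗ
    ((Submodule.quotientEquivOfIsCompl _ _ (isCompl_ker R)).toLinearMap ∘ₗ
      ((R : H →ₗ[ℝ] H).quotKerEquivRange.symm).toLinearMap)

/-- `R⁻¹ u` is orthogonal to the kernel of `R`. -/
theorem H0.pinv_mem (R : H →L[ℝ] H) (u : H0 R) :
    H0.pinv R u ∈ (LinearMap.ker (R : H →ₗ[ℝ] H))ᗮ :=
  Subtype.property _

/-- `R (R⁻¹ u) = u`. -/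
theorem H0.apply_pinv (R : H →L[ℝ] H) (u : H0 R) : R (H0.pinv R u) = H0.toH R u := by
  have key : ∀ q : H ⧸ LinearMap.ker (R : H →ₗ[ℝ] H),
      R (Submodule.quotientEquivOfIsCompl _ _ (isCompl_ker R) q : H) =
        ((R : H →ₗ[ℝ] H).quotKerEquivRange q : H) := by
    intro q
    obtain ⟨c, rfl⟩ := (Submodule.quotientEquivOfIsCompl _ _ (isCompl_ker R)).symm.surjective q
    rw [LinearEquiv.apply_symm_apply, Submodule.quotientEquivOfIsCompl_symm_apply]
    rfl
  refine (key ((R : H →ₗ[ℝ] H).quotKerEquivRange.symm u)).trans ?_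
  exact congrArg Subtype.val (LinearEquiv.apply_symm_apply _ _)

theorem H0.pinv_injective (R : H →L[ℝ] H) : Function.Injective (H0.pinv R) := by
  intro u w h
  have h2 : H0.toH R u = H0.toH R w := by rw [← H0.apply_pinv, ← H0.apply_pinv, h]
  exact Subtype.ext h2

/-- The norm `‖u‖_{H₀} = ‖R⁻¹ u‖_H`. -/
instance (R : H →L[ℝ] H) : NormedAddCommGroup (H0 R) :=
  NormedAddCommGroup.induced (H0 R) H (H0.pinv R) (H0.pinv_injective R)

/-- The inner product `⟪u, w⟫_{H₀} = ⟪R⁻¹ u, R⁻¹ w⟫_H`. -/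
instance (R : H →L[ℝ] H) : InnerProductSpace ℝ (H0 R) :=
  InnerProductSpace.induced (H0.pinv R)

/-- The set `S_M` of all `v ∈ L²(ℝ; H₀)` with `∫ ‖v(s)‖²_{H₀} ds ≤ M`. -/
def controls (R : H →L[ℝ] H) (M : ℝ) : Set (Lp (H0 R) 2 (volume : Measure ℝ)) :=
  {v | ∫ s, ‖v s‖ ^ 2 ≤ M}

end CameronMartin

section Equation

variable {V H : Type*} [NormedAddCommGroup V] [NormedSpace ℝ V]
  [NormedAddCommGroup H] [InnerProductSpace ℝ H]

/-- `(V, H, V*)` is a Gelfand triple with embedding `i : V → H`: the Banach space `V` is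
reflexive and `i` is a continuous injection with dense range. -/
structure IsGelfandTriple (i : V →L[ℝ] H) : Prop where
  reflexive : Function.Surjective (NormedSpace.inclusionInDoubleDual ℝ V)
  injective : Function.Injective i
  dense : DenseRange i

/-- `S` is the strongly continuous semigroup on `H` associated with `A : V → V*`: its
infinitesimal generator is the part of `A` in `H`, i.e. the operator with domain
`{u ∈ V : A u ∈ H}`, where `y ∈ H` is identified with the functional `w ↦ ⟪y, i w⟫` on `V`. -/
structure IsSemigroupOf (i : V →L[ℝ] H) (A : V →L[ℝ] StrongDual ℝ V)
    (S : ℝ → H →L[ℝ] H) : Prop where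
  zero : S 0 = ContinuousLinearMap.id ℝ H
  add : ∀ s t : ℝ, 0 ≤ s → 0 ≤ t → S (s + t) = (S s).comp (S t)
  continuousOn : ∀ x : H, ContinuousOn (fun t => S t x) (Ici 0)
  generator : ∀ x y : H,
    Tendsto (fun h : ℝ => h⁻¹ • (S h x - x)) (𝓝[>] 0) (𝓝 y) ↔
      ∃ u : V, i u = x ∧ ∀ w : V, A u w = ⟪y, i w⟫

/-- The hypotheses on the coefficients `A : V → V*`, `F : V → H`, `B : V → L(H)` and on the
semigroup `S` associated with `A`. Elements `y` of `H` act on `V` by `w ↦ ⟪y, i w⟫`. -/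
structure Hypotheses (i : V →L[ℝ] H) (A : V →L[ℝ] StrongDual ℝ V) (F : V → H)
    (B : V → H →L[ℝ] H) (S : ℝ → H →L[ℝ] H) : Prop where
  /-- local monotonicity and coercivity of `A + F`, coercivity of `A` -/
  monotone_coercive : ∃ lam C₀ : ℝ, 0 < lam ∧ 0 < C₀ ∧
    (∀ u v : V, (A u - A v) (u - v) + ⟪F u - F v, i (u - v)⟫ ≤
      -lam * ‖u - v‖ ^ 2 + C₀ * ‖i (u - v)‖ ^ 2 * ‖u‖ ^ 2) ∧
    (∀ u : V, A u u + ⟪F u, i u⟫ ≤ -lam * ‖u‖ ^ 2) ∧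
    (∀ u : V, A u u ≤ -lam * ‖u‖ ^ 2)
  /-- smoothing of `F` by the semigroup, locally uniformly in time and on bounded sets of `H` -/
  smoothing : ∀ (N : ℕ) (ρ : ℝ), ∃ C α : ℝ, 0 < C ∧ -1 < α ∧ α < 0 ∧
    ∀ t₀ t : ℝ, 0 ≤ t₀ → t₀ < t → t ≤ N → ∀ u v : V, ‖i u‖ ≤ ρ → ‖i v‖ ≤ ρ →
      ‖∫ s in t₀..t, S s (F u - F v)‖ ^ 2 ≤ C * ∫ s in t₀..t, s ^ α * ‖i (u - v)‖ ^ 2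
  /-- `B` is Lipschitz with respect to the norm of `H`, and bounded -/
  lipschitz_bounded : ∃ β₀ D₀ : ℝ, 0 < β₀ ∧ 0 < D₀ ∧
    (∀ u v : V, ‖B u - B v‖ ≤ β₀ * ‖i (u - v)‖) ∧ ∀ u : V, ‖B u‖ ≤ D₀

/-- `X` is a (continuous) mild solution on `[t₀, ∞)` of the skeleton equation
`dX/dt = A X + F(X) + B(X) v` with `X(t₀) = x`. Since `F` and `B` are defined on `V`, the path `X`
has to take values in `V` for almost every time; `Y` is `X` seen as a path in `V`. -/
def IsMildSolution (i : V →L[ℝ] H) (F : V → H) (B : V → H →L[ℝ] H) (S : ℝ → H →L[ℝ] H)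
    (v : ℝ → H) (t₀ : ℝ) (x : H) (X : ℝ → H) : Prop :=
  ContinuousOn X (Ici t₀) ∧
    ∃ Y : ℝ → V, (∀ᵐ r ∂(volume.restrict (Ici t₀)), i (Y r) = X r) ∧
      ∀ t : ℝ, t₀ ≤ t →
        IntegrableOn (fun r => S (t - r) (F (Y r))) (Ioc t₀ t) ∧
        IntegrableOn (fun r => S (t - r) (B (Y r) (v r))) (Ioc t₀ t) ∧
        X t = S (t - t₀) x + (∫ r in Ioc t₀ t, S (t - r) (F (Y r))) +
          ∫ r in Ioc t₀ t, S (t - r) (B (Y r) (v r))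

/-- `X` is a (continuous) solution of the backward infinite horizon integral equation
`X(t) = ∫_{-∞}^t S(t-r) F(X(r)) dr + ∫_{-∞}^t S(t-r) B(X(r)) v(r) dr`, `t ∈ ℝ`; again `Y` is `X`
seen as a path in `V`. -/
def IsBackwardSolution (i : V →L[ℝ] H) (F : V → H) (B : V → H →L[ℝ] H) (S : ℝ → H →L[ℝ] H)
    (v : ℝ → H) (X : ℝ → H) : Prop :=
  Continuous X ∧
    ∃ Y : ℝ → V, (∀ᵐ r, i (Y r) = X r) ∧
      ∀ t : ℝ,
        IntegrableOn (fun r => S (t - r) (F (Y r))) (Iic t) ∧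
        IntegrableOn (fun r => S (t - r) (B (Y r) (v r))) (Iic t) ∧
        X t = (∫ r in Iic t, S (t - r) (F (Y r))) + ∫ r in Iic t, S (t - r) (B (Y r) (v r))

/-- `X` vanishes up to time `-n` and solves the skeleton equation started from `0` at `-n`. -/
def IsStartedAt (i : V →L[ℝ] H) (F : V → H) (B : V → H →L[ℝ] H) (S : ℝ → H →L[ℝ] H)
    (v : ℝ → H) (n : ℕ) (X : ℝ → H) : Prop :=
  IsMildSolution i F B S v (-n) 0 X ∧ ∀ t : ℝ, t ≤ -n → X t = 0

end Equation

end Skeleton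

end

/-! Since `F` is defined only on `V` and need not be continuous for the norm of `H`, the equation is
first moved to `H`. Let κ z be the Lax–Milgram solution of A(κ z) = -z and K = i κ. Then K is
accretive and injective with dense range, and the generator of `S` is -K⁻¹. Coercivity makes `S`
analytic, so E(t) = S(t)K⁻¹ is bounded with norm at most Γ/t for t > 0, and S(t)F(u) = E(t)φ(i u)
with φ(i u) = K F(u). Because ∫₀^τ S(s) ds = K - S(τ)K, the smoothing hypothesis with t₀ = 0 is a
Hölder bound at time 0 on the orbits of differences of φ. It lets φ extend to `H`
(`exists_framework`), and by interpolation it improves Γ/t to t^(θ-1) on such differences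
(`norm_apply_le_of_holder`). The mild equation is now a Volterra equation in `H` with kernel
C((t-r)^(θ-1) + 1) + C‖w(r)‖. Once φ is composed with a radial truncation, a contraction in an
exponentially weighted norm solves it, and a singular Gronwall lemma gives uniqueness and stability
(`VolterraData`).

Mild solutions cannot be differentiated directly, so the energy estimates are proved for equations
with bounded generators G = -(K + ε)⁻¹P. The correction P is chosen so that, with R = (K(K + ε)⁻¹)*
and its lift p : H → V, the form of the approximate drift is A(p x)(p x) + ⟪F(p x), i p x⟫ minus a
nonnegative form, up to truncation. Monotonicity and coercivity, which are statements on `V`,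
therefore survive uniformly in ε (`inner_approxGen`, `inner_approxDrift_le`,
`inner_approxDrift_sub_le`). A Trotter–Kato argument (`tendsto_expSemigroup`) and the stability
theorem (`tendsto_solution`) let ε tend to 0.

The limit inherits a bound on ‖X‖ that depends neither on the elapsed time nor on the truncation
radius, so the truncation can be removed. The bound on ∫‖p X‖² gives values in `V` almost
everywhere, by Fatou and reflexivity. Two solutions satisfy ‖X - Z‖² ≤ ‖x - z‖² exp(a - c(t - s)):
the terms C₀∫‖p X‖² and ∫‖w‖² are bounded uniformly in time and enter only the constant a
(`exists_contraction`).

With this contraction the solutions started from 0 at time -n converge exponentially fast, locally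
uniformly in t. The limit X is bounded and solves the equation from every initial time s; letting s
→ -∞, the term S(t-s)X(s) vanishes and the backward equation remains. Conversely a bounded backward
solution is a forward solution from every s, so contraction from arbitrarily early times forces
uniqueness. -/

open MeasureTheory Set Filter Topology
open scoped RealInnerProductSpace

namespace Skeleton

/-! ### Lax–Milgram and weak compactness in a Gelfand triple. -/

section Reflexive

variable {V H : Type*} [NormedAddCommGroup V] [NormedSpace ℝ V]
  [NormedAddCommGroup H] [InnerProductSpace ℝ H]

/-- **Lax–Milgram theorem** on a reflexive Banach space. -/
theorem surjective_of_coercive [CompleteSpace V]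
    (hrefl : Function.Surjective (NormedSpace.inclusionInDoubleDual ℝ V))
    (a : V →L[ℝ] StrongDual ℝ V) {lam : ℝ} (hlam : 0 < lam)
    (ha : ∀ u, a u u ≤ -lam * ‖u‖ ^ 2) : Function.Surjective a := by
  have hbelow : ∀ u, ‖u‖ ≤ lam⁻¹ * ‖a u‖ := by
    intro u
    rcases (norm_nonneg u).eq_or_lt with h0 | h0
    · rw [← h0]; positivity
    · have h1 : lam * ‖u‖ ^ 2 ≤ ‖a u‖ * ‖u‖ := by
        have := (a u).le_opNorm u
        have h2 := neg_le_abs (a u u)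
        rw [Real.norm_eq_abs] at this
        linarith [ha u]
      have h2 : lam * ‖u‖ ≤ ‖a u‖ := by
        by_contra hcon
        push Not at hcon
        nlinarith
      rw [inv_mul_eq_div, le_div_iff₀ hlam]
      linarith
  have hanti : AntilipschitzWith (Real.toNNReal lam⁻¹) a :=
    a.antilipschitz_of_bound (fun x => by
      rw [Real.coe_toNNReal _ (inv_nonneg.2 hlam.le)]; exact hbelow x)
  have hclosed : IsClosed (range a) := hanti.isClosed_range a.uniformContinuous
  intro ξ
  by_contra hξ
  have hξ' : ξ ∉ ((LinearMap.range (a : V →ₗ[ℝ] StrongDual ℝ V) : Submodule ℝ (StrongDual ℝ V)) :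
      Set (StrongDual ℝ V)) := by
    rintro ⟨u, hu⟩
    exact hξ ⟨u, hu⟩
  obtain ⟨f, c, hf, hc⟩ := geometric_hahn_banach_closed_point
    (LinearMap.range (a : V →ₗ[ℝ] StrongDual ℝ V)).convex hclosed hξ'
  have hc0 : 0 < c := by simpa using hf 0 (Submodule.zero_mem _)
  have hzero : ∀ u, f (a u) = 0 := by
    intro u
    by_contra hne
    -- On the rescaled vector `f` takes the value c + 1, above the bound c that it obeys on the
    -- range.
    have := hf (a (((c + 1) / f (a u)) • u)) ⟨_, rfl⟩
    rw [map_smul, map_smul, smul_eq_mul, div_mul_cancel₀ _ hne] at this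
    linarith
  obtain ⟨p, hp⟩ := hrefl f
  have hpp : a p p = 0 := by
    have := hzero p
    rw [← hp] at this
    simpa using this
  have hp0 : p = 0 := by
    have := ha p
    rw [hpp] at this
    have h3 : ‖p‖ ^ 2 ≤ 0 := by nlinarith
    have h4 : ‖p‖ = 0 := by nlinarith [norm_nonneg p]
    exact norm_eq_zero.1 h4
  rw [hp0, map_zero] at hp
  rw [← hp] at hc
  simp at hc
  linarith

/-- The functional `w ↦ ⟪y, i w⟫` on `V` given by an element `y` of `H`. -/
noncomputable def toDualOf (i : V →L[ℝ] H) : H →L[ℝ] StrongDual ℝ V :=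
  (ContinuousLinearMap.compL ℝ V H ℝ).flip i ∘L (innerSL ℝ : H →L[ℝ] H →L[ℝ] ℝ)

@[simp] theorem toDualOf_apply (i : V →L[ℝ] H) (y : H) (w : V) :
    toDualOf i y w = ⟪y, i w⟫ := rfl

/-- In a Gelfand triple, an `H`-limit of a sequence that is bounded in `V` infinitely often
belongs to `V`. -/
theorem mem_range_of_frequently_bounded {i : V →L[ℝ] H} (hi : IsGelfandTriple i)
    {u : ℕ → V} {x : H} (hu : Tendsto (fun n => i (u n)) atTop (𝓝 x)) {b : ℝ}
    (hb : ∃ᶠ n in atTop, ‖u n‖ ≤ b) : x ∈ range i := by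
  have hinj : Function.Injective (toDualOf i) := by
    rw [injective_iff_map_eq_zero]
    intro y hy
    refine hi.dense.eq_zero_of_inner_left ℝ fun w => ?_
    have := congrArg (fun ξ : StrongDual ℝ V => ξ w) hy
    simpa using this
  -- This bound says that y ↦ ⟪x, y⟫ is continuous for the norm of V*. Hahn–Banach extends it to V*,
  -- and reflexivity represents the extension by a vector of `V`, which replaces the extraction of a
  -- weakly convergent subsequence.
  have hbound : ∀ y : H, |⟪x, y⟫| ≤ b * ‖toDualOf i y‖ := by
    intro y
    have h1 : Tendsto (fun n => |⟪i (u n), y⟫|) atTop (𝓝 |⟪x, y⟫|) :=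
      (hu.inner tendsto_const_nhds).abs
    refine le_of_tendsto_of_frequently h1 (hb.mono fun n hn => ?_)
    have := (toDualOf i y).le_opNorm (u n)
    rw [toDualOf_apply, Real.norm_eq_abs, real_inner_comm] at this
    refine this.trans ?_
    rw [mul_comm]
    exact mul_le_mul_of_nonneg_right hn (norm_nonneg _)
  let e := LinearEquiv.ofInjective (toDualOf i : H →ₗ[ℝ] StrongDual ℝ V) hinj
  let f₀ : LinearMap.range (toDualOf i : H →ₗ[ℝ] StrongDual ℝ V) →ₗ[ℝ] ℝ :=
    (innerSL ℝ x : H →ₗ[ℝ] ℝ) ∘ₗ e.symm.toLinearMap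
  have hf₀ : ∀ ξ, ‖f₀ ξ‖ ≤ b * ‖ξ‖ := by
    intro ξ
    obtain ⟨y, rfl⟩ := e.surjective ξ
    have h2 : f₀ (e y) = ⟪x, y⟫ := by simp [f₀]
    rw [h2, Real.norm_eq_abs]
    exact hbound y
  obtain ⟨g, hg, -⟩ := exists_extension_norm_eq (𝕜 := ℝ)
    (LinearMap.range (toDualOf i : H →ₗ[ℝ] StrongDual ℝ V)) (f₀.mkContinuous b hf₀)
  obtain ⟨p, hp⟩ := hi.reflexive g
  refine ⟨p, ?_⟩
  refine ext_inner_left ℝ fun y => ?_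
  have h3 : g (toDualOf i y) = ⟪x, y⟫ := by
    have := hg (e y)
    have h2 : f₀ (e y) = ⟪x, y⟫ := by simp [f₀]
    rw [LinearMap.mkContinuous_apply, h2] at this
    exact this
  rw [← hp] at h3
  rw [real_inner_comm x y, ← h3]
  simp

end Reflexive

/-! ### Extension by density, and radial truncation. -/

section Extension

variable {V H G : Type*} [NormedAddCommGroup V] [NormedSpace ℝ V]
  [NormedAddCommGroup H] [InnerProductSpace ℝ H]
  [NormedAddCommGroup G] [CompleteSpace G]

/-- A map on `V` which is Lipschitz for the norm of `H` on bounded sets of `H` extends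
continuously to `H`. -/
theorem exists_extension_of_locally_lipschitz {i : V →L[ℝ] H} (hi : DenseRange i)
    {f : V → G}
    (hf : ∀ ρ : ℝ, ∃ C, ∀ u w, ‖i u‖ ≤ ρ → ‖i w‖ ≤ ρ → ‖f u - f w‖ ≤ C * ‖i u - i w‖) :
    ∃ g : H → G, Continuous g ∧ ∀ u, g (i u) = f u := by
  have hd : Dense (range i) := hi
  choose j hj using fun x : range i => x.2
  -- The value of `f` depends only on `i u`, so the choice of preimages is harmless and `i` need not
  -- be injective here.
  have hfj : ∀ u, f (j ⟨i u, u, rfl⟩) = f u := by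
    intro u
    obtain ⟨C, hC⟩ := hf ‖i u‖
    have h1 := hC (j ⟨i u, u, rfl⟩) u (by rw [hj]) le_rfl
    rw [hj, sub_self, norm_zero, mul_zero] at h1
    exact sub_eq_zero.1 (norm_le_zero_iff.1 h1)
  have hlim : ∀ x : H, ∃ y, Tendsto (fun z => f (j z)) (comap ((↑) : range i → H) (𝓝 x))
      (𝓝 y) := by
    intro x
    have hne : (comap ((↑) : range i → H) (𝓝 x)).NeBot := hd.comap_val_nhds_neBot x
    obtain ⟨C, hC⟩ := hf (‖x‖ + 1)
    have hC' : ∀ u w, ‖i u‖ ≤ ‖x‖ + 1 → ‖i w‖ ≤ ‖x‖ + 1 →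
        ‖f u - f w‖ ≤ (|C| + 1) * ‖i u - i w‖ := fun u w hu hw =>
      (hC u w hu hw).trans (mul_le_mul_of_nonneg_right (by linarith [le_abs_self C])
        (norm_nonneg _))
    refine cauchy_map_iff_exists_tendsto.1 ?_
    rw [Metric.cauchy_iff]
    refine ⟨hne.map _, fun ε hε => ?_⟩
    have hpos : 0 < |C| + 1 := by positivity
    refine ⟨(fun z => f (j z)) '' ((↑) ⁻¹' Metric.ball x (min 1 (ε / (2 * (|C| + 1))))),
      ?_, ?_⟩
    · refine image_mem_map (preimage_mem_comap (Metric.ball_mem_nhds _ (by positivity)))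
    · rintro _ ⟨u, hu, rfl⟩ _ ⟨w, hw, rfl⟩
      simp only [mem_preimage, Metric.mem_ball, lt_min_iff, dist_eq_norm] at hu hw
      have hnb : ∀ z : H, ‖z - x‖ < 1 → ‖z‖ ≤ ‖x‖ + 1 := fun z hz => by
        have := norm_add_le (z - x) x
        rw [sub_add_cancel] at this
        linarith
      rw [dist_eq_norm]
      refine (hC' _ _ (by rw [hj]; exact hnb _ hu.1) (by rw [hj]; exact hnb _ hw.1)).trans_lt ?_
      rw [hj, hj]
      have h1 : ‖(u : H) - w‖ < ε / (|C| + 1) := by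
        have h2 : (u : H) - w = (u - x) - (w - x) := by abel
        rw [h2]
        refine (norm_sub_le _ _).trans_lt ?_
        have h3 : ε / (|C| + 1) = ε / (2 * (|C| + 1)) + ε / (2 * (|C| + 1)) := by
          field_simp; ring
        rw [h3]
        exact add_lt_add hu.2 hw.2
      rwa [lt_div_iff₀ hpos, mul_comm] at h1
  refine ⟨hd.extend fun z => f (j z), hd.continuous_extend hlim, fun u => ?_⟩
  have := hd.isDenseInducing_val.extend_eq' hlim ⟨i u, u, rfl⟩
  exact this.trans (hfj u)

/-- The radial retraction onto the closed ball of radius `ρ`. -/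
noncomputable def trunc (ρ : ℝ) (x : H) : H := (ρ / max ρ ‖x‖) • x

theorem trunc_of_norm_le {ρ : ℝ} (hρ : 0 < ρ) {x : H} (hx : ‖x‖ ≤ ρ) : trunc ρ x = x := by
  rw [trunc, max_eq_left hx, div_self hρ.ne', one_smul]

theorem div_max_pos {ρ : ℝ} (hρ : 0 < ρ) (a : ℝ) : 0 < ρ / max ρ a :=
  div_pos hρ (lt_max_of_lt_left hρ)

theorem div_max_le_one {ρ : ℝ} (hρ : 0 < ρ) (a : ℝ) : ρ / max ρ a ≤ 1 :=
  div_le_one_of_le₀ (le_max_left _ _) (hρ.le.trans (le_max_left _ _))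

theorem norm_trunc_le {ρ : ℝ} (hρ : 0 < ρ) (x : H) : ‖trunc ρ x‖ ≤ ρ := by
  have hm : 0 < max ρ ‖x‖ := lt_max_of_lt_left hρ
  rw [trunc, norm_smul, Real.norm_of_nonneg (by positivity), div_mul_eq_mul_div,
    div_le_iff₀ hm]
  exact mul_le_mul_of_nonneg_left (le_max_right _ _) hρ.le

/-- Changing first the vector and then the scaling factor costs ‖x - y‖ each time, the second
because max ρ ‖·‖ is 1-Lipschitz. Any Lipschitz constant serves, so 2 is enough. -/
theorem norm_trunc_sub_le {ρ : ℝ} (hρ : 0 < ρ) (x y : H) :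
    ‖trunc ρ x - trunc ρ y‖ ≤ 2 * ‖x - y‖ := by
  have hx : 0 < max ρ ‖x‖ := lt_max_of_lt_left hρ
  have hy : 0 < max ρ ‖y‖ := lt_max_of_lt_left hρ
  have h1 : trunc ρ x - trunc ρ y =
      (ρ / max ρ ‖x‖) • (x - y) + (ρ / max ρ ‖x‖ - ρ / max ρ ‖y‖) • y := by
    simp only [trunc]; module
  have h2 : ‖(ρ / max ρ ‖x‖) • (x - y)‖ ≤ ‖x - y‖ := by
    rw [norm_smul, Real.norm_of_nonneg (by positivity)]
    exact mul_le_of_le_one_left (norm_nonneg _) (div_max_le_one hρ ‖x‖)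
  have h3 : ‖(ρ / max ρ ‖x‖ - ρ / max ρ ‖y‖) • y‖ ≤ ‖x - y‖ := by
    have h4 : ρ / max ρ ‖x‖ - ρ / max ρ ‖y‖ =
        (ρ / max ρ ‖x‖) * ((max ρ ‖y‖ - max ρ ‖x‖) / max ρ ‖y‖) := by
      field_simp
    have h5 : |max ρ ‖y‖ - max ρ ‖x‖| ≤ ‖x - y‖ := by
      refine (abs_max_sub_max_le_max _ _ _ _).trans ?_
      rw [sub_self, abs_zero, max_eq_right (abs_nonneg _), norm_sub_rev]
      exact abs_norm_sub_norm_le _ _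
    rw [norm_smul, h4, norm_mul, Real.norm_of_nonneg (by positivity : 0 ≤ ρ / max ρ ‖x‖),
      norm_div, Real.norm_of_nonneg hy.le, Real.norm_eq_abs, mul_assoc, div_mul_eq_mul_div _ _ ‖y‖]
    refine (mul_le_of_le_one_left (by positivity) (div_max_le_one hρ ‖x‖)).trans ?_
    rw [div_le_iff₀ hy]
    exact mul_le_mul h5 (le_max_right _ _) (norm_nonneg _) (norm_nonneg _)
  rw [h1]
  refine (norm_add_le _ _).trans ?_
  linarith

end Extension

end Skeleton

namespace Skeleton

/-! ### Resolvent regularisation of an accretive bounded operator. -/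

section Accretive

variable {H : Type*} [NormedAddCommGroup H] [InnerProductSpace ℝ H] [CompleteSpace H]

open ContinuousLinearMap (adjoint)

/-- A bounded operator with coercive quadratic form is invertible. -/
theorem isUnit_of_coercive (T : H →L[ℝ] H) {c : ℝ} (hc : 0 < c)
    (hT : ∀ x, c * ‖x‖ ^ 2 ≤ ⟪T x, x⟫) : IsUnit T :=
  ContinuousLinearMap.isUnit_of_forall_le_norm_inner_map T (c := ⟨c, hc.le⟩) hc fun x => by
    rw [Real.norm_eq_abs, mul_comm]
    exact (hT x).trans (le_abs_self _)

-- Applied to x = K z + ε z, whose summands have nonnegative inner product by accretivity. This and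
-- the next lemma are the source of all contraction bounds for resolvents.
omit [CompleteSpace H] in
theorem norm_sq_le_of_inner_nonneg {a b x : H} (h : a + b = x) (hab : 0 ≤ ⟪a, b⟫) :
    ‖a‖ ^ 2 ≤ ⟪a, x⟫ := by
  rw [← h, inner_add_right, real_inner_self_eq_norm_sq]
  linarith

omit [CompleteSpace H] in
theorem norm_le_of_inner_nonneg {a b x : H} (h : a + b = x) (hab : 0 ≤ ⟪a, b⟫) :
    ‖a‖ ≤ ‖x‖ := by
  have h1 := norm_sq_le_of_inner_nonneg h hab
  have h2 := real_inner_le_norm a x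
  by_contra hcon
  push Not at hcon
  nlinarith [norm_nonneg x, norm_nonneg a]

/-- The Yosida approximation `(K + ε)⁻¹` of the inverse of `K`. -/
noncomputable def yosida (K : H →L[ℝ] H) (ε : ℝ) : H →L[ℝ] H :=
  Ring.inverse (K + ε • (1 : H →L[ℝ] H))

/-- The regularisation `(K (K + ε)⁻¹)*`. -/
noncomputable def regularize (K : H →L[ℝ] H) (ε : ℝ) : H →L[ℝ] H :=
  adjoint (K * yosida K ε)

/-- The correction `P` for which `-(K + ε)⁻¹ P` has a good quadratic form. -/
noncomputable def correction (K : H →L[ℝ] H) (ε : ℝ) : H →L[ℝ] H :=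
  regularize K ε + (1 - K * yosida K ε) * (1 - regularize K ε)

/-- The bounded operators approximating `-K⁻¹`. -/
noncomputable def approxGen (K : H →L[ℝ] H) (ε : ℝ) : H →L[ℝ] H :=
  -(yosida K ε * correction K ε)

variable {K : H →L[ℝ] H} (hK : ∀ x, 0 ≤ ⟪K x, x⟫) {ε : ℝ} (hε : 0 < ε)

include hK hε

theorem isUnit_add_smul : IsUnit (K + ε • (1 : H →L[ℝ] H)) :=
  isUnit_of_coercive _ hε fun x => by
    simp only [add_apply, smul_apply,
      one_apply_eq_self, inner_add_left, real_inner_smul_left,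
      real_inner_self_eq_norm_sq]
    linarith [hK x]

theorem yosida_mul : yosida K ε * (K + ε • 1) = 1 :=
  Ring.inverse_mul_cancel _ (isUnit_add_smul hK hε)

theorem mul_yosida : (K + ε • 1) * yosida K ε = 1 :=
  Ring.mul_inverse_cancel _ (isUnit_add_smul hK hε)

theorem mul_yosida_eq : K * yosida K ε = 1 - ε • yosida K ε := by
  have := mul_yosida hK hε
  rw [add_mul, smul_mul_assoc, one_mul] at this
  exact eq_sub_of_add_eq this

theorem yosida_mul_eq : yosida K ε * K = 1 - ε • yosida K ε := by
  have := yosida_mul hK hε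
  rw [mul_add, mul_smul_comm, mul_one] at this
  exact eq_sub_of_add_eq this

theorem yosida_spec (x : H) : K (yosida K ε x) + ε • yosida K ε x = x := by
  have := congrArg (fun T : H →L[ℝ] H => T x) (mul_yosida hK hε)
  simpa using this

theorem norm_mul_yosida_apply_le (x : H) : ‖K (yosida K ε x)‖ ≤ ‖x‖ := by
  refine norm_le_of_inner_nonneg (yosida_spec hK hε x) ?_
  rw [real_inner_smul_right]
  exact mul_nonneg hε.le (hK _)

theorem norm_smul_yosida_apply_le (x : H) : ‖ε • yosida K ε x‖ ≤ ‖x‖ := by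
  refine norm_le_of_inner_nonneg ((add_comm _ _).trans (yosida_spec hK hε x)) ?_
  rw [real_inner_smul_left, real_inner_comm]
  exact mul_nonneg hε.le (hK _)

theorem norm_yosida_apply_of_range_le (x : H) : ‖yosida K ε (K x)‖ ≤ ‖x‖ := by
  have h : yosida K ε (K x) = K (yosida K ε x) := by
    have := (yosida_mul_eq hK hε).trans (mul_yosida_eq hK hε).symm
    exact congrArg (fun T : H →L[ℝ] H => T x) this
  rw [h]
  exact norm_mul_yosida_apply_le hK hε x

theorem norm_regularize_apply_le (x : H) : ‖regularize K ε x‖ ≤ ‖x‖ := by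
  have h1 : ‖regularize K ε‖ ≤ 1 := by
    rw [regularize, LinearIsometryEquiv.norm_map]
    refine ContinuousLinearMap.opNorm_le_bound _ zero_le_one fun x => ?_
    rw [one_mul]
    exact norm_mul_yosida_apply_le hK hε x
  simpa using (regularize K ε).le_of_opNorm_le h1 x

omit hε in
theorem inner_adjoint_nonneg (x : H) : 0 ≤ ⟪adjoint K x, x⟫ := by
  rw [ContinuousLinearMap.adjoint_inner_left, real_inner_comm]
  exact hK x

theorem adjoint_yosida : adjoint (yosida K ε) = yosida (adjoint K) ε := by
  have h1 : adjoint (yosida K ε) * (adjoint K + ε • 1) = 1 := by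
    have := congrArg adjoint (mul_yosida hK hε)
    rw [ContinuousLinearMap.mul_def, ContinuousLinearMap.adjoint_comp, map_add, map_smulₛₗ] at this
    simpa [ContinuousLinearMap.mul_def, ContinuousLinearMap.one_def,
      ContinuousLinearMap.adjoint_id] using this
  have h2 := mul_yosida (inner_adjoint_nonneg hK) hε
  exact left_inv_eq_right_inv h1 h2

/-- K commutes with its resolvent, so the regularisation is the same construction for K*. The
resolvent estimates apply to it, and its range lies in that of K*. -/
theorem regularize_eq : regularize K ε = adjoint K * yosida (adjoint K) ε := by
  have h : K * yosida K ε = yosida K ε * K :=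
    (mul_yosida_eq hK hε).trans (yosida_mul_eq hK hε).symm
  rw [regularize, h, ContinuousLinearMap.mul_def, ContinuousLinearMap.adjoint_comp,
    adjoint_yosida hK hε, ContinuousLinearMap.mul_def]

/-- Write R for the regularisation. The factor 1 - K(K + ε)⁻¹ is the adjoint of 1 - R, so the form
equals ⟪R x, x⟫ + ‖x - R x‖². Also ⟪R x, x⟫ ≥ ‖R x‖² since R is a resolvent expression in K*. Two
vectors with sum x have squared norms adding up to at least ‖x‖²/2. -/
theorem inner_correction_ge (x : H) : (1 / 2) * ‖x‖ ^ 2 ≤ ⟪correction K ε x, x⟫ := by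
  have h1 : ⟪correction K ε x, x⟫ = ⟪regularize K ε x, x⟫ + ‖x - regularize K ε x‖ ^ 2 := by
    have h2 : ⟪(1 - K * yosida K ε) (x - regularize K ε x), x⟫ =
        ⟪x - regularize K ε x, x - regularize K ε x⟫ := by
      simp only [sub_apply, one_apply_eq_self, inner_sub_left]
      simp only [inner_sub_right, regularize, ContinuousLinearMap.adjoint_inner_right]
      simp only [map_sub, inner_sub_left,
        ContinuousLinearMap.adjoint_inner_left]
      ring
    rw [← real_inner_self_eq_norm_sq, ← h2, ← inner_add_left]
    rfl
  have h3 : ‖regularize K ε x‖ ^ 2 ≤ ⟪regularize K ε x, x⟫ := by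
    have hK' := inner_adjoint_nonneg hK
    have h5 : regularize K ε x = adjoint K (yosida (adjoint K) ε x) := by
      rw [regularize_eq hK hε]; rfl
    rw [h5]
    refine norm_sq_le_of_inner_nonneg (yosida_spec hK' hε x) ?_
    rw [real_inner_smul_right]
    exact mul_nonneg hε.le (hK' _)
  have h6 : ‖x‖ ≤ ‖x - regularize K ε x‖ + ‖regularize K ε x‖ := by
    simpa using norm_add_le (x - regularize K ε x) (regularize K ε x)
  rw [h1]
  nlinarith [norm_nonneg x, norm_nonneg (x - regularize K ε x), norm_nonneg (regularize K ε x),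
    sq_nonneg (‖x - regularize K ε x‖ - ‖regularize K ε x‖)]

theorem isUnit_correction : IsUnit (correction K ε) :=
  isUnit_of_coercive _ (by norm_num) (inner_correction_ge hK hε)

theorem norm_inverse_correction_apply_le (x : H) :
    ‖Ring.inverse (correction K ε) x‖ ≤ 2 * ‖x‖ := by
  set y := Ring.inverse (correction K ε) x with hy
  have h1 : correction K ε y = x := by
    have := congrArg (fun T : H →L[ℝ] H => T x)
      (Ring.mul_inverse_cancel _ (isUnit_correction hK hε))
    simpa using this
  have h2 := inner_correction_ge hK hε y
  rw [h1] at h2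
  have h3 := real_inner_le_norm x y
  by_contra hcon
  push Not at hcon
  nlinarith [norm_nonneg x, norm_nonneg y]

/-- The approximants of `K`: `-(approxGen K ε)⁻¹`. -/
theorem yosida_eq_neg_approxGen :
    yosida K ε = -(approxGen K ε * Ring.inverse (correction K ε)) := by
  rw [approxGen, neg_mul, neg_neg, mul_assoc,
    Ring.mul_inverse_cancel _ (isUnit_correction hK hε), mul_one]

/-- With P the correction, this identifies P⁻¹(K + ε) as minus the inverse of the approximate
generator. The Trotter–Kato argument compares these operators with K. -/
theorem approxGen_mul_inverse :
    approxGen K ε * (Ring.inverse (correction K ε) * (K + ε • 1)) = -1 := by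
  rw [← mul_assoc, ← neg_neg (approxGen K ε * _), ← yosida_eq_neg_approxGen hK hε, neg_mul,
    yosida_mul hK hε]

omit hε

/-- On x = K y the norm is at most ε‖y‖, and ε(K + ε)⁻¹ is a contraction, so density of the range
suffices. -/
theorem tendsto_smul_yosida (hd : DenseRange K) (x : H) :
    Tendsto (fun ε => ε • yosida K ε x) (𝓝[>] 0) (𝓝 0) := by
  rw [Metric.tendsto_nhds]
  intro δ hδ
  obtain ⟨y, hy⟩ := hd.exists_dist_lt x (half_pos hδ)
  have h1 : Tendsto (fun ε : ℝ => ε * ‖y‖) (𝓝[>] 0) (𝓝 0) := by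
    have : Tendsto (fun ε : ℝ => ε * ‖y‖) (𝓝 0) (𝓝 (0 * ‖y‖)) := tendsto_id.mul_const _
    rw [zero_mul] at this
    exact this.mono_left nhdsWithin_le_nhds
  filter_upwards [h1.eventually (gt_mem_nhds (half_pos hδ)), self_mem_nhdsWithin] with ε h2 hε
  have hε : 0 < ε := hε
  rw [dist_zero_right]
  have h3 : ε • yosida K ε x = ε • yosida K ε (x - K y) + ε • yosida K ε (K y) := by
    rw [map_sub]; module
  rw [h3]
  refine (norm_add_le _ _).trans_lt ?_
  have h4 := norm_smul_yosida_apply_le hK hε (x - K y)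
  have h5 : ‖ε • yosida K ε (K y)‖ ≤ ε * ‖y‖ := by
    rw [norm_smul, Real.norm_of_nonneg hε.le]
    exact mul_le_mul_of_nonneg_left (norm_yosida_apply_of_range_le hK hε y) hε.le
  rw [dist_eq_norm] at hy
  linarith

theorem tendsto_mul_yosida (hd : DenseRange K) (x : H) :
    Tendsto (fun ε => K (yosida K ε x)) (𝓝[>] 0) (𝓝 x) := by
  have h := (tendsto_const_nhds (x := x)).sub (tendsto_smul_yosida hK hd x)
  rw [sub_zero] at h
  refine h.congr' ?_
  filter_upwards [self_mem_nhdsWithin] with ε hε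
  exact sub_eq_of_eq_add (yosida_spec hK hε x).symm

theorem tendsto_regularize (hd : DenseRange (adjoint K)) (x : H) :
    Tendsto (fun ε => regularize K ε x) (𝓝[>] 0) (𝓝 x) := by
  refine (tendsto_mul_yosida (inner_adjoint_nonneg hK) hd x).congr' ?_
  filter_upwards [self_mem_nhdsWithin] with ε hε
  rw [regularize_eq hK hε]; rfl

theorem tendsto_correction (hd : DenseRange (adjoint K)) (x : H) :
    Tendsto (fun ε => correction K ε x) (𝓝[>] 0) (𝓝 x) := by
  have h1 := tendsto_regularize hK hd x
  have h2 : Tendsto (fun ε => (1 - K * yosida K ε) (x - regularize K ε x)) (𝓝[>] 0) (𝓝 0) := by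
    have h3 : Tendsto (fun ε => 2 * ‖x - regularize K ε x‖) (𝓝[>] 0) (𝓝 0) := by
      have := ((tendsto_const_nhds (x := x)).sub h1).norm.const_mul 2
      simpa using this
    refine squeeze_zero_norm' ?_ h3
    filter_upwards [self_mem_nhdsWithin] with ε hε
    rw [sub_apply, one_apply_eq_self]
    refine (norm_sub_le _ _).trans ?_
    have : ‖(K * yosida K ε) (x - regularize K ε x)‖ ≤ ‖x - regularize K ε x‖ :=
      norm_mul_yosida_apply_le hK hε _
    linarith
  have := h1.add h2
  rw [add_zero] at this
  exact this

/-- P⁻¹x - x = P⁻¹(x - P x), and P⁻¹ is bounded by 2 uniformly in ε. -/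
theorem tendsto_inverse_correction (hd : DenseRange (adjoint K)) (x : H) :
    Tendsto (fun ε => Ring.inverse (correction K ε) x) (𝓝[>] 0) (𝓝 x) := by
  have h1 : Tendsto (fun ε => 2 * ‖x - correction K ε x‖) (𝓝[>] 0) (𝓝 0) := by
    have := ((tendsto_const_nhds (x := x)).sub (tendsto_correction hK hd x)).norm.const_mul 2
    simpa using this
  rw [tendsto_iff_norm_sub_tendsto_zero]
  refine squeeze_zero' (Eventually.of_forall fun _ => norm_nonneg _) ?_ h1
  filter_upwards [self_mem_nhdsWithin] with ε hε
  have h2 : Ring.inverse (correction K ε) (correction K ε x) = x := by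
    have := congrArg (fun T : H →L[ℝ] H => T x)
      (Ring.inverse_mul_cancel _ (isUnit_correction hK hε))
    simpa using this
  have h3 := norm_inverse_correction_apply_le hK hε (x - correction K ε x)
  rwa [map_sub, h2] at h3

theorem tendsto_neg_inverse_approxGen (hd : DenseRange (adjoint K)) (x : H) :
    Tendsto (fun ε => Ring.inverse (correction K ε) (K x + ε • x)) (𝓝[>] 0) (𝓝 (K x)) := by
  have h1 := tendsto_inverse_correction hK hd (K x)
  have h2 : Tendsto (fun ε => Ring.inverse (correction K ε) (ε • x)) (𝓝[>] 0) (𝓝 0) := by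
    have h3 : Tendsto (fun ε : ℝ => 2 * ‖ε • x‖) (𝓝[>] 0) (𝓝 0) := by
      have : Tendsto (fun ε : ℝ => 2 * ‖ε • x‖) (𝓝 0) (𝓝 (2 * ‖(0 : ℝ) • x‖)) :=
        ((tendsto_id.smul_const x).norm).const_mul 2
      rw [zero_smul, norm_zero, mul_zero] at this
      exact this.mono_left nhdsWithin_le_nhds
    refine squeeze_zero_norm' ?_ h3
    filter_upwards [self_mem_nhdsWithin] with ε hε
    exact norm_inverse_correction_apply_le hK hε _
  have := h1.add h2
  rw [add_zero] at this
  refine this.congr fun ε => ?_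
  rw [map_add]

end Accretive

end Skeleton

namespace Skeleton

/-! ### Exponentials of bounded operators: decay and analyticity. -/

section ExpBounded

variable {H : Type*} [NormedAddCommGroup H] [InnerProductSpace ℝ H] [CompleteSpace H]

/-- The norm-continuous semigroup `e^{tG}`. -/
noncomputable def expSemigroup (G : H →L[ℝ] H) (t : ℝ) : H →L[ℝ] H :=
  NormedSpace.exp (t • G)

variable (G : H →L[ℝ] H)

omit [CompleteSpace H] in
@[simp] theorem expSemigroup_zero : expSemigroup G 0 = 1 := by
  rw [expSemigroup, zero_smul, NormedSpace.exp_zero]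

theorem expSemigroup_add (s t : ℝ) :
    expSemigroup G (s + t) = expSemigroup G s * expSemigroup G t := by
  rw [expSemigroup, add_smul]
  let _ : NormedAlgebra ℚ (H →L[ℝ] H) := NormedAlgebra.restrictScalars ℚ ℝ _
  exact NormedSpace.exp_add_of_commute
    (((Commute.refl G).smul_left s).smul_right t)

theorem hasDerivAt_expSemigroup (t : ℝ) :
    HasDerivAt (expSemigroup G) (expSemigroup G t * G) t :=
  hasDerivAt_exp_smul_const G t

theorem hasDerivAt_expSemigroup' (t : ℝ) :
    HasDerivAt (expSemigroup G) (G * expSemigroup G t) t :=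
  hasDerivAt_exp_smul_const' G t

theorem expSemigroup_comm (t : ℝ) : G * expSemigroup G t = expSemigroup G t * G :=
  (hasDerivAt_expSemigroup' G t).unique (hasDerivAt_expSemigroup G t)

theorem continuous_expSemigroup : Continuous (expSemigroup G) :=
  continuous_iff_continuousAt.2 fun t => (hasDerivAt_expSemigroup G t).continuousAt

theorem hasDerivAt_expSemigroup_apply (x : H) (t : ℝ) :
    HasDerivAt (fun t => expSemigroup G t x) (G (expSemigroup G t x)) t := by
  have := (hasDerivAt_expSemigroup' G t).clm_apply (hasDerivAt_const t x)
  simpa using this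

variable {G}

/-- The function exp(2ct)‖u(t)‖² is nonincreasing along the orbit. -/
theorem norm_expSemigroup_apply_le {c : ℝ} (hG : ∀ x, ⟪G x, x⟫ ≤ -c * ‖x‖ ^ 2) {t : ℝ}
    (ht : 0 ≤ t) (x : H) : ‖expSemigroup G t x‖ ≤ Real.exp (-c * t) * ‖x‖ := by
  let f : ℝ → ℝ := fun t => Real.exp (2 * c * t) * ‖expSemigroup G t x‖ ^ 2
  have hf : ∀ t, HasDerivAt f (Real.exp (2 * c * t) * (2 * c) * ‖expSemigroup G t x‖ ^ 2 +
      Real.exp (2 * c * t) *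
        (2 * ⟪expSemigroup G t x, G (expSemigroup G t x)⟫)) t := by
    intro t
    have h1 : HasDerivAt (fun t => Real.exp (2 * c * t)) (Real.exp (2 * c * t) * (2 * c)) t := by
      simpa using ((hasDerivAt_id t).const_mul (2 * c)).exp
    exact h1.mul (hasDerivAt_expSemigroup_apply G x t).norm_sq
  have hanti : Antitone f := by
    refine antitone_of_deriv_nonpos (fun t => (hf t).differentiableAt) fun t => ?_
    rw [(hf t).deriv]
    have h2 := hG (expSemigroup G t x)
    rw [real_inner_comm] at h2
    have h3 := Real.exp_pos (2 * c * t)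
    nlinarith
  have h4 := hanti ht
  simp only [f, mul_zero, Real.exp_zero, one_mul, expSemigroup_zero, one_apply_eq_self] at h4
  refine abs_le_of_sq_le_sq' ?_ (by positivity) |>.2
  rw [mul_pow, ← Real.exp_nat_mul]
  have h5 : Real.exp ((2 : ℕ) * (-c * t)) * Real.exp (2 * c * t) = 1 := by
    rw [← Real.exp_add, ← Real.exp_zero]; congr 1; push_cast; ring
  calc ‖expSemigroup G t x‖ ^ 2
      = Real.exp ((2 : ℕ) * (-c * t)) * (Real.exp (2 * c * t) * ‖expSemigroup G t x‖ ^ 2) := by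
        rw [← mul_assoc, h5, one_mul]
    _ ≤ _ := mul_le_mul_of_nonneg_left h4 (Real.exp_pos _).le

/-- Analyticity estimate `‖G e^{tG}‖ ≤ C / t`, with a constant depending only on the ratio of
the boundedness and the coercivity constants of the form of `G` relative to `n`. -/
theorem norm_gen_expSemigroup_apply_le {n : H → ℝ} {lam C : ℝ} (hlam : 0 < lam) (hC : 0 ≤ C)
    (h1 : ∀ x, ⟪G x, x⟫ ≤ -lam * n x)
    (h2 : ∀ x w t, 0 ≤ t → 2 * t * ⟪G x, w⟫ ≤ 2 * lam * t ^ 2 * n w + C * n x)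
    {t : ℝ} (ht : 0 < t) (x : H) :
    ‖expSemigroup G t (G x)‖ ≤ Real.sqrt (C / (2 * lam)) / t * ‖x‖ := by
  let u : ℝ → H := fun t => expSemigroup G t x
  -- A Lyapunov function. Hypothesis `h2` with w = G u bounds 2t‖G u‖² by 2λt² n(G u) + C n(u), and
  -- coercivity at G u and at u cancels these two terms.
  let f : ℝ → ℝ := fun t => t ^ 2 * ‖G (u t)‖ ^ 2 + C / (2 * lam) * ‖u t‖ ^ 2
  have hu : ∀ t, HasDerivAt u (G (u t)) t := hasDerivAt_expSemigroup_apply G x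
  have hf : ∀ t, HasDerivAt f (2 * t * ‖G (u t)‖ ^ 2 + t ^ 2 * (2 * ⟪G (u t), G (G (u t))⟫) +
      C / (2 * lam) * (2 * ⟪u t, G (u t)⟫)) t := by
    intro t
    have h3 : HasDerivAt (fun t => G (u t)) (G (G (u t))) t :=
      G.hasFDerivAt.comp_hasDerivAt t (hu t)
    have h4 : HasDerivAt (fun t : ℝ => t ^ 2) (2 * t) t := by simpa using hasDerivAt_pow 2 t
    exact (h4.mul h3.norm_sq).add ((hu t).norm_sq.const_mul _)
  have hanti : AntitoneOn f (Ici 0) := by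
    refine antitoneOn_of_deriv_nonpos (convex_Ici 0)
      (fun t _ => (hf t).continuousAt.continuousWithinAt)
      (fun t _ => (hf t).differentiableAt.differentiableWithinAt) fun t ht => ?_
    rw [interior_Ici] at ht
    rw [(hf t).deriv]
    have h5 := h2 (u t) (G (u t)) t (le_of_lt ht)
    have h6 := h1 (G (u t))
    have h7 := h1 (u t)
    rw [real_inner_self_eq_norm_sq] at h5
    rw [real_inner_comm] at h6 h7
    have h8 : C / (2 * lam) * (2 * ⟪u t, G (u t)⟫) ≤ - (C * n (u t)) := by
      have : C / (2 * lam) * (2 * ⟪u t, G (u t)⟫) ≤ C / (2 * lam) * (2 * (-lam * n (u t))) := by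
        gcongr
      refine this.trans (le_of_eq ?_)
      field_simp
    have h9 : t ^ 2 * (2 * ⟪G (u t), G (G (u t))⟫) ≤ t ^ 2 * (2 * (-lam * n (G (u t)))) := by
      gcongr
    linarith
  have h10 := hanti (mem_Ici.2 le_rfl) (mem_Ici.2 ht.le) ht.le
  have h11 : u 0 = x := by simp [u]
  simp only [f, h11, ne_eq, OfNat.ofNat_ne_zero, not_false_eq_true, zero_pow, zero_mul,
    zero_add] at h10
  have h12 : (t * ‖G (u t)‖) ^ 2 ≤ (Real.sqrt (C / (2 * lam)) * ‖x‖) ^ 2 := by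
    rw [mul_pow, mul_pow, Real.sq_sqrt (by positivity)]
    have : 0 ≤ C / (2 * lam) * ‖u t‖ ^ 2 := by positivity
    linarith
  have h13 := (abs_le_of_sq_le_sq' h12 (by positivity)).2
  have h14 : expSemigroup G t (G x) = G (u t) := by
    have := congrArg (fun T : H →L[ℝ] H => T x) (expSemigroup_comm G t)
    exact this.symm
  rw [h14, div_mul_eq_mul_div, le_div_iff₀ ht, mul_comm]
  exact h13

end ExpBounded

/-! ### Solution operators of the form and of its transpose. -/

section Form

variable {V H : Type*} [NormedAddCommGroup V] [NormedSpace ℝ V]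
  [NormedAddCommGroup H] [InnerProductSpace ℝ H] [CompleteSpace H]

open ContinuousLinearMap (adjoint)

theorem denseRange_of_injective_adjoint {T : H →L[ℝ] H}
    (hT : Function.Injective (adjoint T)) : DenseRange T := by
  have h1 : (LinearMap.range (T : H →ₗ[ℝ] H)).topologicalClosure = ⊤ := by
    rw [Submodule.topologicalClosure_eq_top_iff]
    have := T.orthogonal_range
    rw [LinearMap.ker_eq_bot.2 hT] at this
    exact this
  exact Submodule.dense_iff_topologicalClosure_eq_top.2 h1

/-- `κ` and `κ'` are the solution operators of the problems with form `A` and its transpose. -/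
structure IsSolutionOperators (i : V →L[ℝ] H) (A : V →L[ℝ] StrongDual ℝ V)
    (κ κ' : H →L[ℝ] V) : Prop where
  left : ∀ z w, A (κ z) w = -⟪z, i w⟫
  right : ∀ w z, A w (κ' z) = -⟪i w, z⟫

omit [CompleteSpace H] in
theorem exists_isSolutionOperators [CompleteSpace V] {i : V →L[ℝ] H} (hi : IsGelfandTriple i)
    {A : V →L[ℝ] StrongDual ℝ V} {lam : ℝ} (hlam : 0 < lam)
    (hA : ∀ u, A u u ≤ -lam * ‖u‖ ^ 2) : ∃ κ κ', IsSolutionOperators i A κ κ' := by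
  have key : ∀ a : V →L[ℝ] StrongDual ℝ V, (∀ u, a u u ≤ -lam * ‖u‖ ^ 2) →
      ∃ κ : H →L[ℝ] V, ∀ z w, a (κ z) w = -⟪z, i w⟫ := by
    intro a ha
    have hsurj := surjective_of_coercive hi.reflexive a hlam ha
    have hinj : Function.Injective a := by
      rw [injective_iff_map_eq_zero]
      intro u hu
      have := ha u
      rw [hu] at this
      have h1 : ‖u‖ ^ 2 ≤ 0 := by simp at this; nlinarith
      have h2 : ‖u‖ = 0 := by nlinarith [norm_nonneg u]
      exact norm_eq_zero.1 h2
    let e := ContinuousLinearEquiv.ofBijective a (LinearMap.ker_eq_bot.2 hinj)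
      (LinearMap.range_eq_top.2 hsurj)
    refine ⟨-((e.symm : StrongDual ℝ V →L[ℝ] V) ∘L toDualOf i), fun z w => ?_⟩
    have h3 : a (e.symm (toDualOf i z)) = toDualOf i z := e.apply_symm_apply _
    simp [h3]
  obtain ⟨κ, hκ⟩ := key A hA
  obtain ⟨κ', hκ'⟩ := key A.flip fun u => by simpa using hA u
  refine ⟨κ, κ', hκ, fun w z => ?_⟩
  have := hκ' z w
  rw [real_inner_comm] at this
  simpa using this

variable {i : V →L[ℝ] H} {A : V →L[ℝ] StrongDual ℝ V} {κ κ' : H →L[ℝ] V}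
  (hκ : IsSolutionOperators i A κ κ')

include hκ

/-- Both sides are read off from A(κ y)(κ' x). Thus K* also factors through `V`, which is what lifts
the regularisation to an operator with values in `V`. -/
theorem IsSolutionOperators.adjoint_eq : adjoint (i ∘L κ) = i ∘L κ' := by
  symm
  rw [ContinuousLinearMap.eq_adjoint_iff]
  intro x y
  have h1 := hκ.right (κ y) x
  have h2 := hκ.left y (κ' x)
  simp only [ContinuousLinearMap.coe_comp, Function.comp_apply]
  rw [real_inner_comm, real_inner_comm (i (κ y)) x]
  linarith

variable {lam : ℝ} (hlam : 0 < lam) (hA : ∀ u, A u u ≤ -lam * ‖u‖ ^ 2)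

include hA

omit [CompleteSpace H] in
theorem IsSolutionOperators.inner_ge (z : H) : lam * ‖κ z‖ ^ 2 ≤ ⟪(i ∘L κ) z, z⟫ := by
  have h1 := hκ.left z (κ z)
  rw [real_inner_comm] at h1
  have := hA (κ z)
  simp only [ContinuousLinearMap.coe_comp, Function.comp_apply]
  linarith

include hlam

omit [CompleteSpace H] in
theorem IsSolutionOperators.inner_nonneg (z : H) : 0 ≤ ⟪(i ∘L κ) z, z⟫ :=
  (by positivity : 0 ≤ lam * ‖κ z‖ ^ 2).trans (hκ.inner_ge hA z)

omit hlam hA [CompleteSpace H] in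
theorem IsSolutionOperators.injective_left (hi : IsGelfandTriple i) :
    Function.Injective (i ∘L κ) := by
  rw [injective_iff_map_eq_zero]
  intro z hz
  have h1 : κ z = 0 := hi.injective (by simpa using hz)
  refine hi.dense.eq_zero_of_inner_left ℝ fun w => ?_
  have := hκ.left z w
  rw [h1] at this
  simpa using this.symm

omit hlam hA [CompleteSpace H] in
theorem IsSolutionOperators.injective_right (hi : IsGelfandTriple i) :
    Function.Injective (i ∘L κ') := by
  rw [injective_iff_map_eq_zero]
  intro z hz
  have h1 : κ' z = 0 := hi.injective (by simpa using hz)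
  refine hi.dense.eq_zero_of_inner_left ℝ fun w => ?_
  have := hκ.right w z
  rw [h1, real_inner_comm] at this
  simpa using this.symm

omit hlam hA in
theorem IsSolutionOperators.denseRange (hi : IsGelfandTriple i) : DenseRange (i ∘L κ) := by
  refine denseRange_of_injective_adjoint ?_
  rw [hκ.adjoint_eq]
  exact hκ.injective_right hi

omit hlam hA in
theorem IsSolutionOperators.denseRange_adjoint (hi : IsGelfandTriple i) :
    DenseRange (adjoint (i ∘L κ)) := by
  refine denseRange_of_injective_adjoint ?_
  rw [ContinuousLinearMap.adjoint_adjoint]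
  exact hκ.injective_left hi

end Form

/-! ### Uniform form estimates for the approximate generators. -/

section FormApprox

variable {V H : Type*} [NormedAddCommGroup V] [NormedSpace ℝ V]
  [NormedAddCommGroup H] [InnerProductSpace ℝ H] [CompleteSpace H]
  {i : V →L[ℝ] H} {A : V →L[ℝ] StrongDual ℝ V} {κ κ' : H →L[ℝ] V}

open ContinuousLinearMap (adjoint)

/-- The regularisation `regularize`, as an operator with values in `V`. -/
noncomputable def regularizeV (i : V →L[ℝ] H) (κ κ' : H →L[ℝ] V) (ε : ℝ) : H →L[ℝ] V :=
  κ' ∘L adjoint (yosida (i ∘L κ) ε)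

variable (hκ : IsSolutionOperators i A κ κ') {lam : ℝ} (hlam : 0 < lam)
  (hA : ∀ u, A u u ≤ -lam * ‖u‖ ^ 2) {ε : ℝ} (hε : 0 < ε)

include hκ hlam hA hε

theorem regularizeV_spec (x : H) :
    i (regularizeV i κ κ' ε x) = regularize (i ∘L κ) ε x := by
  have hK := hκ.inner_nonneg hlam hA
  rw [regularize_eq hK hε, regularizeV, adjoint_yosida hK hε, hκ.adjoint_eq]
  rfl

-- The defining property of κ' replaces `A` by the resolvent. Taking p to be another regularised
-- vector, the resolvent applied to the regularisation has minus the form `A`, compressed by the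
-- lift into `V`.
omit hlam hA hε in
theorem form_regularizeV (p : V) (x : H) :
    A p (regularizeV i κ κ' ε x) = -⟪yosida (i ∘L κ) ε (i p), x⟫ := by
  rw [regularizeV, ContinuousLinearMap.comp_apply, hκ.right,
    ContinuousLinearMap.adjoint_inner_right]

/-- Expand y' as K q' + ε q' with q' its resolvent; the K part becomes the form `A` evaluated at
vectors of `V`. -/
theorem inner_yosida (y y' : H) :
    ⟪yosida (i ∘L κ) ε y, y'⟫ =
      -A (κ (yosida (i ∘L κ) ε y)) (κ (yosida (i ∘L κ) ε y')) +
        ε * ⟪yosida (i ∘L κ) ε y, yosida (i ∘L κ) ε y'⟫ := by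
  have hK := hκ.inner_nonneg hlam hA
  conv_lhs => rw [← yosida_spec hK hε y']
  rw [inner_add_right, real_inner_smul_right, hκ.left, neg_neg]
  rfl

/-- The reason for the choice of `correction`. Its first summand produces the form `A` on
regularised vectors. In the second, 1 - K(K + ε)⁻¹ commutes with the resolvent and moves to the
other slot as 1 - R, which leaves a form that is nonnegative on the diagonal. -/
theorem inner_approxGen (x w : H) :
    ⟪approxGen (i ∘L κ) ε x, w⟫ =
      A (regularizeV i κ κ' ε x) (regularizeV i κ κ' ε w) -
        ⟪yosida (i ∘L κ) ε (x - regularize (i ∘L κ) ε x), w - regularize (i ∘L κ) ε w⟫ := by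
  have hK := hκ.inner_nonneg hlam hA
  set K := i ∘L κ with hKdef
  set y := x - regularize K ε x with hy
  have h1 : approxGen K ε x =
      -(yosida K ε (regularize K ε x)) - yosida K ε ((1 - K * yosida K ε) y) := by
    simp only [approxGen, correction, neg_apply, mul_apply_eq_comp, add_apply,
      map_add, neg_add_rev, sub_apply, one_apply_eq_self, ← hy]
    abel
  have h2 : yosida K ε ((1 - K * yosida K ε) y) = (1 - K * yosida K ε) (yosida K ε y) := by
    rw [mul_yosida_eq hK hε]
    simp
  have h3 : ⟪(1 - K * yosida K ε) (yosida K ε y), w⟫ =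
      ⟪yosida K ε y, w - regularize K ε w⟫ := by
    simp only [sub_apply, one_apply_eq_self, inner_sub_left, inner_sub_right, regularize,
      ContinuousLinearMap.adjoint_inner_right]
  rw [h1, inner_sub_left, h2, h3, form_regularizeV hκ, regularizeV_spec hκ hlam hA hε,
    inner_neg_left]

/-- The quadratic form of `approxGen` is coercive, uniformly in `ε`. -/
theorem approxGen_coercive (hε1 : ε ≤ 1) (x : H) :
    min lam 1 / (4 * (‖i‖ ^ 2 + 1)) * ‖x‖ ^ 2 ≤
      lam / 2 * ‖regularizeV i κ κ' ε x‖ ^ 2 +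
        ⟪yosida (i ∘L κ) ε (x - regularize (i ∘L κ) ε x), x - regularize (i ∘L κ) ε x⟫ := by
  have hK := hκ.inner_nonneg hlam hA
  set y := x - regularize (i ∘L κ) ε x with hy
  set q := yosida (i ∘L κ) ε y with hq
  set p := regularizeV i κ κ' ε x with hp
  have h1 : lam * ‖κ q‖ ^ 2 + ε * ‖q‖ ^ 2 ≤ ⟪q, y⟫ := by
    have := inner_yosida hκ hlam hA hε y y
    rw [← hq, real_inner_self_eq_norm_sq] at this
    linarith [hA (κ q)]
  have h2 : ‖y‖ ≤ ‖i‖ * ‖κ q‖ + ε * ‖q‖ := by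
    have h3 := yosida_spec hK hε y
    rw [← hq] at h3
    conv_lhs => rw [← h3]
    refine (norm_add_le _ _).trans ?_
    rw [norm_smul, Real.norm_of_nonneg hε.le]
    gcongr
    exact i.le_opNorm _
  have h4 : ‖x‖ ≤ ‖i‖ * ‖p‖ + ‖y‖ := by
    have h5 : x = i p + y := by
      rw [hp, regularizeV_spec hκ hlam hA hε, hy]; abel
    conv_lhs => rw [h5]
    refine (norm_add_le _ _).trans ?_
    gcongr
    exact i.le_opNorm _
  set l := min lam 1 with hl
  have hl0 : 0 < l := lt_min hlam one_pos
  have hl1 : l ≤ lam := min_le_left _ _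
  have hl2 : l ≤ 1 := min_le_right _ _
  set b := ‖i‖ with hb
  have hb0 : 0 ≤ b := norm_nonneg i
  have h6 : ‖x‖ ^ 2 ≤ 2 * b ^ 2 * ‖p‖ ^ 2 + 2 * ‖y‖ ^ 2 := by
    have : ‖x‖ ^ 2 ≤ (b * ‖p‖ + ‖y‖) ^ 2 := by gcongr
    nlinarith [sq_nonneg (b * ‖p‖ - ‖y‖)]
  -- Here ε ≤ 1 is used to absorb ε² into ε. Together with `h6` this yields the factor 4 of the
  -- decay rate.
  have h7 : ‖y‖ ^ 2 ≤ 2 * b ^ 2 * ‖κ q‖ ^ 2 + 2 * (ε * ‖q‖ ^ 2) := by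
    have h8 : ‖y‖ ^ 2 ≤ (b * ‖κ q‖ + ε * ‖q‖) ^ 2 := by gcongr
    have h9 : (ε * ‖q‖) ^ 2 ≤ ε * ‖q‖ ^ 2 := by
      rw [mul_pow]
      exact mul_le_mul_of_nonneg_right (by nlinarith) (sq_nonneg _)
    nlinarith [sq_nonneg (b * ‖κ q‖ - ε * ‖q‖)]
  have hq0 : 0 ≤ ε * ‖q‖ ^ 2 := by positivity
  refine le_trans ?_ (add_le_add_right h1 _)
  rw [div_mul_eq_mul_div, div_le_iff₀ (by positivity)]
  have h10 : l * ‖x‖ ^ 2 ≤ l * (2 * b ^ 2 * ‖p‖ ^ 2 + 4 * b ^ 2 * ‖κ q‖ ^ 2 +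
      4 * (ε * ‖q‖ ^ 2)) := by
    refine mul_le_mul_of_nonneg_left ?_ hl0.le
    linarith
  refine h10.trans ?_
  have e1 : l * (b ^ 2 * ‖p‖ ^ 2) ≤ lam * (b ^ 2 * ‖p‖ ^ 2) :=
    mul_le_mul_of_nonneg_right hl1 (by positivity)
  have e2 : l * (b ^ 2 * ‖κ q‖ ^ 2) ≤ lam * (b ^ 2 * ‖κ q‖ ^ 2) :=
    mul_le_mul_of_nonneg_right hl1 (by positivity)
  have e3 : l * (ε * ‖q‖ ^ 2) ≤ 1 * (ε * ‖q‖ ^ 2) :=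
    mul_le_mul_of_nonneg_right hl2 (by positivity)
  have e4 : 0 ≤ b ^ 2 * (ε * ‖q‖ ^ 2) := by positivity
  have e5 : 0 ≤ lam * ‖p‖ ^ 2 := by positivity
  have e6 : 0 ≤ lam * ‖κ q‖ ^ 2 := by positivity
  nlinarith

theorem inner_approxGen_le (hε1 : ε ≤ 1) (x : H) :
    ⟪approxGen (i ∘L κ) ε x, x⟫ ≤ -(min lam 1 / (4 * (‖i‖ ^ 2 + 1))) * ‖x‖ ^ 2 := by
  have h1 := approxGen_coercive hκ hlam hA hε hε1 x
  rw [inner_approxGen hκ hlam hA hε]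
  have h2 := hA (regularizeV i κ κ' ε x)
  have h3 : 0 ≤ lam / 2 * ‖regularizeV i κ κ' ε x‖ ^ 2 := by positivity
  linarith

/-- Uniform analyticity of the semigroups generated by `approxGen`. -/
theorem norm_expSemigroup_approxGen_le {t : ℝ} (ht : 0 < t) (x : H) :
    ‖expSemigroup (approxGen (i ∘L κ) ε) t (approxGen (i ∘L κ) ε x)‖ ≤
      max ‖A‖ 1 / (2 * min lam 1) / t * ‖x‖ := by
  set l := min lam 1 with hl
  have hl0 : 0 < l := lt_min hlam one_pos
  have hl1 : l ≤ lam := min_le_left _ _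
  have hl2 : l ≤ 1 := min_le_right _ _
  set Λ := max ‖A‖ 1 with hΛ
  have hΛ1 : ‖A‖ ≤ Λ := le_max_left _ _
  have hΛ2 : 1 ≤ Λ := le_max_right _ _
  have hΛ0 : 0 ≤ Λ := zero_le_one.trans hΛ2
  let q : H → H := fun x => yosida (i ∘L κ) ε (x - regularize (i ∘L κ) ε x)
  let p : H → V := regularizeV i κ κ' ε
  have hform : ∀ x w, ⟪approxGen (i ∘L κ) ε x, w⟫ =
      A (p x) (p w) + A (κ (q x)) (κ (q w)) - ε * ⟪q x, q w⟫ := by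
    intro x w
    rw [inner_approxGen hκ hlam hA hε, inner_yosida hκ hlam hA hε]
    simp only [p, q]
    ring
  have hsqrt : Real.sqrt (Λ ^ 2 / (2 * l) / (2 * l)) = Λ / (2 * l) := by
    rw [div_div, ← sq, ← div_pow]
    exact Real.sqrt_sq (by positivity)
  rw [← hsqrt]
  -- The reference quantity collects the three terms of the form, each coercive with constant `l`
  -- and bounded with constant `Λ`. The weight ε on ‖q x‖² keeps the ratio of these constants
  -- independent of ε.
  refine norm_gen_expSemigroup_apply_le
    (n := fun x => ‖p x‖ ^ 2 + ‖κ (q x)‖ ^ 2 + ε * ‖q x‖ ^ 2) hl0 (by positivity) ?_ ?_ ht x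
  · intro x
    rw [hform, real_inner_self_eq_norm_sq]
    have e1 : l * ‖p x‖ ^ 2 ≤ lam * ‖p x‖ ^ 2 := mul_le_mul_of_nonneg_right hl1 (by positivity)
    have e2 : l * ‖κ (q x)‖ ^ 2 ≤ lam * ‖κ (q x)‖ ^ 2 :=
      mul_le_mul_of_nonneg_right hl1 (by positivity)
    have e3 : l * (ε * ‖q x‖ ^ 2) ≤ 1 * (ε * ‖q x‖ ^ 2) :=
      mul_le_mul_of_nonneg_right hl2 (by positivity)
    linarith [hA (p x), hA (κ (q x))]
  · intro x w t ht
    rw [hform]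
    have young : ∀ a b : ℝ, 2 * t * (Λ * (a * b)) ≤
        2 * l * t ^ 2 * b ^ 2 + Λ ^ 2 / (2 * l) * a ^ 2 := by
      intro a b
      have : Λ ^ 2 / (2 * l) * a ^ 2 = (Λ * a) ^ 2 / (2 * l) := by ring
      rw [this, ← sub_le_iff_le_add', le_div_iff₀ (by positivity)]
      nlinarith [sq_nonneg (2 * l * t * b - Λ * a)]
    have hAb : ∀ a b : V, A a b ≤ Λ * (‖a‖ * ‖b‖) := by
      intro a b
      calc A a b ≤ ‖A a b‖ := Real.le_norm_self _
        _ ≤ ‖A‖ * ‖a‖ * ‖b‖ := A.le_opNorm₂ a b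
        _ ≤ Λ * ‖a‖ * ‖b‖ := by gcongr
        _ = _ := by ring
    have t1 : 2 * t * A (p x) (p w) ≤ 2 * t * (Λ * (‖p x‖ * ‖p w‖)) :=
      mul_le_mul_of_nonneg_left (hAb _ _) (by positivity)
    have t2 : 2 * t * A (κ (q x)) (κ (q w)) ≤ 2 * t * (Λ * (‖κ (q x)‖ * ‖κ (q w)‖)) :=
      mul_le_mul_of_nonneg_left (hAb _ _) (by positivity)
    have t3 : 2 * t * (-(ε * ⟪q x, q w⟫)) ≤ ε * (2 * t * (Λ * (‖q x‖ * ‖q w‖))) := by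
      have h5 : -⟪q x, q w⟫ ≤ Λ * (‖q x‖ * ‖q w‖) := by
        have := neg_le_of_abs_le (abs_real_inner_le_norm (q x) (q w))
        have h6 : 0 ≤ ‖q x‖ * ‖q w‖ := by positivity
        nlinarith
      have h7 := mul_le_mul_of_nonneg_left h5 (by positivity : 0 ≤ 2 * t * ε)
      linarith
    have y1 := young ‖p x‖ ‖p w‖
    have y2 := young ‖κ (q x)‖ ‖κ (q w)‖
    have y3 := mul_le_mul_of_nonneg_left (young ‖q x‖ ‖q w‖) hε.le
    linarith

end FormApprox

end Skeleton

namespace Skeleton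

/-! ### Strong limits of bounded families of operators. -/

section StrongLimit

variable {H : Type*} [NormedAddCommGroup H] [InnerProductSpace ℝ H] [CompleteSpace H]

/-- A bounded family of operators converging pointwise on a dense set converges strongly. -/
theorem exists_strong_limit {ι X : Type*} {l : Filter ι} [l.NeBot] {T : ι → H →L[ℝ] H} {b : ℝ}
    (hb0 : 0 ≤ b) (hb : ∀ᶠ n in l, ∀ x, ‖T n x‖ ≤ b * ‖x‖) {e : X → H} (he : DenseRange e)
    {f : X → H} (h : ∀ z, Tendsto (fun n => T n (e z)) l (𝓝 (f z))) :
    ∃ T' : H →L[ℝ] H, (∀ x, ‖T' x‖ ≤ b * ‖x‖) ∧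
      ∀ x, Tendsto (fun n => T n x) l (𝓝 (T' x)) := by
  have hlim : ∀ x, ∃ y, Tendsto (fun n => T n x) l (𝓝 y) := by
    intro x
    refine cauchy_map_iff_exists_tendsto.1 ?_
    rw [Metric.cauchy_iff]
    refine ⟨‹l.NeBot›.map _, fun ε hε => ?_⟩
    obtain ⟨z, hz⟩ := he.exists_dist_lt x (show 0 < ε / (4 * (b + 1)) by positivity)
    rw [dist_eq_norm] at hz
    have h1 : ∀ᶠ n in l, dist (T n (e z)) (f z) < ε / 4 :=
      (h z).eventually (Metric.ball_mem_nhds _ (by positivity))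
    refine ⟨(fun n => T n x) '' {n | (∀ x, ‖T n x‖ ≤ b * ‖x‖) ∧ dist (T n (e z)) (f z) < ε / 4},
      image_mem_map (hb.and h1), ?_⟩
    have key : ∀ n, (∀ x, ‖T n x‖ ≤ b * ‖x‖) → dist (T n (e z)) (f z) < ε / 4 →
        dist (T n x) (f z) < ε / 2 := by
      intro n hn hn'
      have h2 : dist (T n x) (T n (e z)) < ε / 4 := by
        rw [dist_eq_norm, ← map_sub]
        refine (hn _).trans_lt ?_
        have h3 : b * ‖x - e z‖ ≤ (b + 1) * ‖x - e z‖ := by gcongr; linarith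
        have h4 : (b + 1) * ‖x - e z‖ < (b + 1) * (ε / (4 * (b + 1))) := by gcongr
        have h5 : (b + 1) * (ε / (4 * (b + 1))) = ε / 4 := by field_simp
        linarith
      have := dist_triangle (T n x) (T n (e z)) (f z)
      linarith
    rintro _ ⟨n, hn, rfl⟩ _ ⟨m, hm, rfl⟩
    have h6 := key n hn.1 hn.2
    have h7 := key m hm.1 hm.2
    have := dist_triangle_right (T n x) (T m x) (f z)
    simp only
    linarith
  choose g hg using hlim
  let T₀ : H →ₗ[ℝ] H :=
    { toFun := g
      map_add' := fun x y => tendsto_nhds_unique (hg (x + y)) (by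
        simpa using (hg x).add (hg y))
      map_smul' := fun c x => tendsto_nhds_unique (hg (c • x)) (by
        simpa using (hg x).const_smul c) }
  have hT₀ : ∀ x, ‖T₀ x‖ ≤ b * ‖x‖ := fun x =>
    le_of_tendsto (hg x).norm (hb.mono fun n hn => hn x)
  exact ⟨T₀.mkContinuous b hT₀, hT₀, hg⟩

theorem tendsto_of_tendsto_dense {ι X : Type*} {l : Filter ι} [l.NeBot] {T : ι → H →L[ℝ] H}
    {b : ℝ} (hb0 : 0 ≤ b) (hb : ∀ᶠ n in l, ∀ x, ‖T n x‖ ≤ b * ‖x‖) {e : X → H}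
    (he : DenseRange e) {T' : H →L[ℝ] H}
    (h : ∀ z, Tendsto (fun n => T n (e z)) l (𝓝 (T' (e z)))) (x : H) :
    Tendsto (fun n => T n x) l (𝓝 (T' x)) := by
  obtain ⟨T'', -, h2⟩ := exists_strong_limit hb0 hb he h
  have h3 : (T'' : H → H) = T' := by
    refine he.equalizer T''.continuous T'.continuous (funext fun z => ?_)
    exact tendsto_nhds_unique (h2 (e z)) (h z)
  rw [← h3]
  exact h2 x

end StrongLimit

/-! ### Trotter–Kato convergence, decay and analyticity of the semigroup. -/

section Semigroup

variable {V H : Type*} [NormedAddCommGroup V] [NormedSpace ℝ V]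
  [NormedAddCommGroup H] [InnerProductSpace ℝ H] [CompleteSpace H]
  {i : V →L[ℝ] H} {A : V →L[ℝ] StrongDual ℝ V} {κ κ' : H →L[ℝ] V} {S : ℝ → H →L[ℝ] H}
  (hS : IsSemigroupOf i A S) (hκ : IsSolutionOperators i A κ κ')

include hS hκ

omit [CompleteSpace H] in
theorem tendsto_semigroup_quotient (x : H) {t : ℝ} (ht : 0 ≤ t) :
    Tendsto (fun h : ℝ => h⁻¹ • (S h (S t (i (κ x))) - S t (i (κ x)))) (𝓝[>] 0)
      (𝓝 (-S t x)) := by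
  have h1 : Tendsto (fun h : ℝ => h⁻¹ • (S h (i (κ x)) - i (κ x))) (𝓝[>] 0) (𝓝 (-x)) := by
    rw [hS.generator]
    exact ⟨κ x, rfl, fun w => by rw [hκ.left, inner_neg_left]⟩
  have h2 := ((S t).continuous.tendsto _).comp h1
  rw [map_neg] at h2
  refine h2.congr' ?_
  filter_upwards [self_mem_nhdsWithin] with h hh
  have hh : 0 ≤ h := le_of_lt hh
  have h3 : S t (S h (i (κ x))) = S h (S t (i (κ x))) := by
    have e1 := hS.add t h ht hh
    have e2 := hS.add h t hh ht
    rw [add_comm, e2] at e1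
    exact (congrArg (fun T : H →L[ℝ] H => T (i (κ x))) e1).symm
  simp only [Function.comp_apply, map_smul, map_sub, h3]

-- The orbit of K x is differentiable with derivative -S(t)x. The converse half of the description
-- of the generator puts S(t)K x in its domain, with A u = -S(t)x, and coercivity makes the solution
-- unique.
omit [CompleteSpace H] in
theorem semigroup_comm {lam : ℝ} (hlam : 0 < lam) (hA : ∀ u, A u u ≤ -lam * ‖u‖ ^ 2) (x : H)
    {t : ℝ} (ht : 0 ≤ t) : S t (i (κ x)) = i (κ (S t x)) := by
  obtain ⟨u, hu, hAu⟩ := (hS.generator _ _).1 (tendsto_semigroup_quotient hS hκ x ht)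
  have h1 : u = κ (S t x) := by
    have h2 : A (u - κ (S t x)) = 0 := by
      ext w
      rw [map_sub, sub_apply, hAu, hκ.left, inner_neg_left]
      simp
    have h3 := hA (u - κ (S t x))
    rw [h2] at h3
    have h4 : ‖u - κ (S t x)‖ ^ 2 ≤ 0 := by simp at h3; nlinarith
    have h5 : ‖u - κ (S t x)‖ = 0 := by nlinarith [norm_nonneg (u - κ (S t x))]
    exact sub_eq_zero.1 (norm_eq_zero.1 h5)
  rw [← hu, h1]

omit [CompleteSpace H] in
theorem hasDerivWithinAt_semigroup (x : H) {t : ℝ} (ht : 0 ≤ t) :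
    HasDerivWithinAt (fun t => S t (i (κ x))) (-S t x) (Ioi t) t := by
  rw [hasDerivWithinAt_iff_tendsto_slope' (by simp)]
  have h1 := tendsto_semigroup_quotient hS hκ x ht
  have h2 : Tendsto (fun s : ℝ => s - t) (𝓝[>] t) (𝓝[>] 0) := by
    refine tendsto_nhdsWithin_iff.2 ⟨?_, ?_⟩
    · have : Tendsto (fun s : ℝ => s - t) (𝓝 t) (𝓝 (t - t)) := tendsto_id.sub_const t
      rw [sub_self] at this
      exact this.mono_left nhdsWithin_le_nhds
    · filter_upwards [self_mem_nhdsWithin] with s hs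
      exact sub_pos.2 (mem_Ioi.1 hs)
  refine (h1.comp h2).congr' ?_
  filter_upwards [self_mem_nhdsWithin] with s hs
  have hs : t < s := hs
  have h3 : S s (i (κ x)) = S (s - t) (S t (i (κ x))) := by
    have := hS.add (s - t) t (by linarith) ht
    rw [sub_add_cancel] at this
    rw [this]; rfl
  simp only [Function.comp_apply, slope_def_module, h3]

/-- This identity turns the smoothing hypothesis, an integral of `S`, into a bound on orbits near
time 0; it also drives the interpolation estimate. -/
theorem semigroup_integral (x : H) {t : ℝ} (ht : 0 ≤ t) :
    ∫ s in (0 : ℝ)..t, S s x = i (κ x) - S t (i (κ x)) := by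
  have h1 : ContinuousOn (fun s => S s x) (uIcc 0 t) := by
    rw [uIcc_of_le ht]
    exact (hS.continuousOn x).mono Icc_subset_Ici_self
  have h2 : ContinuousOn (fun s => S s (i (κ x))) (uIcc 0 t) := by
    rw [uIcc_of_le ht]
    exact (hS.continuousOn _).mono Icc_subset_Ici_self
  have h3 := intervalIntegral.integral_eq_sub_of_hasDeriv_right h2
    (f' := fun s => -S s x) (fun s hs => by
      rw [min_eq_left ht] at hs
      exact hasDerivWithinAt_semigroup hS hκ x hs.1.le) h1.neg.intervalIntegrable
  rw [intervalIntegral.integral_neg, hS.zero] at h3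
  rw [← neg_neg (∫ s in (0 : ℝ)..t, S s x), h3]
  simp

/-- The decay rate of the semigroup. -/
noncomputable def decayRate (i : V →L[ℝ] H) (lam : ℝ) : ℝ := min lam 1 / (4 * (‖i‖ ^ 2 + 1))

omit hS hκ [CompleteSpace H] in
theorem decayRate_pos (i : V →L[ℝ] H) {lam : ℝ} (hlam : 0 < lam) : 0 < decayRate i lam := by
  have : 0 < min lam 1 := lt_min hlam one_pos
  rw [decayRate]; positivity

variable (hi : IsGelfandTriple i) {lam : ℝ} (hlam : 0 < lam) (hA : ∀ u, A u u ≤ -lam * ‖u‖ ^ 2)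

include hlam hA

omit hS in
theorem norm_expSemigroup_approx_le {ε : ℝ} (hε : 0 < ε) (hε1 : ε ≤ 1) {t : ℝ} (ht : 0 ≤ t)
    (x : H) : ‖expSemigroup (approxGen (i ∘L κ) ε) t x‖ ≤
      Real.exp (-decayRate i lam * t) * ‖x‖ :=
  norm_expSemigroup_apply_le (inner_approxGen_le hκ hlam hA hε hε1) ht x

omit hS in
theorem norm_expSemigroup_approx_le_one {ε : ℝ} (hε : 0 < ε) (hε1 : ε ≤ 1) {t : ℝ} (ht : 0 ≤ t)
    (x : H) : ‖expSemigroup (approxGen (i ∘L κ) ε) t x‖ ≤ ‖x‖ := by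
  refine (norm_expSemigroup_approx_le hκ hlam hA hε hε1 ht x).trans ?_
  refine mul_le_of_le_one_left (norm_nonneg _) (Real.exp_le_one_iff.2 ?_)
  have := mul_nonneg (decayRate_pos i hlam).le ht
  linarith

-- The resolvent is minus the approximate generator times P⁻¹: the analyticity estimate applies, and
-- ‖P⁻¹‖ ≤ 2 cancels the 2 in its constant.
omit hS in
theorem norm_expSemigroup_yosida_le {ε : ℝ} (hε : 0 < ε) {t : ℝ} (ht : 0 < t) (x : H) :
    ‖expSemigroup (approxGen (i ∘L κ) ε) t (yosida (i ∘L κ) ε x)‖ ≤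
      max ‖A‖ 1 / min lam 1 / t * ‖x‖ := by
  have hK := hκ.inner_nonneg hlam hA
  have hl0 : 0 < min lam 1 := lt_min hlam one_pos
  rw [yosida_eq_neg_approxGen hK hε, neg_apply, map_neg, norm_neg, mul_apply_eq_comp]
  refine (norm_expSemigroup_approxGen_le hκ hlam hA hε ht _).trans ?_
  have h1 := norm_inverse_correction_apply_le hK hε x
  have h2 : 0 ≤ max ‖A‖ 1 / (2 * min lam 1) / t := by positivity
  refine (mul_le_mul_of_nonneg_left h1 h2).trans (le_of_eq ?_)
  field_simp

omit hS in
theorem norm_expSemigroup_yosida_range_le {ε : ℝ} (hε : 0 < ε) (hε1 : ε ≤ 1) {t : ℝ}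
    (ht : 0 ≤ t) (x : H) :
    ‖expSemigroup (approxGen (i ∘L κ) ε) t (yosida (i ∘L κ) ε (i (κ x)))‖ ≤ ‖x‖ :=
  (norm_expSemigroup_approx_le_one hκ hlam hA hε hε1 ht _).trans
    (norm_yosida_apply_of_range_le (hκ.inner_nonneg hlam hA) hε x)

include hi

/-- Trotter–Kato: the approximating semigroups converge strongly. -/
theorem tendsto_expSemigroup {t : ℝ} (ht : 0 ≤ t) (x : H) :
    Tendsto (fun ε => expSemigroup (approxGen (i ∘L κ) ε) t x) (𝓝[>] 0) (𝓝 (S t x)) := by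
  have hK := hκ.inner_nonneg hlam hA
  have hd := hκ.denseRange hi
  have hd' := hκ.denseRange_adjoint hi
  set K := i ∘L κ with hKdef
  have hKS : ∀ x, ∀ s, 0 ≤ s → S s (K x) = K (S s x) := fun x s hs =>
    semigroup_comm hS hκ hlam hA x hs
  have hev : ∀ᶠ ε : ℝ in 𝓝[>] 0, 0 < ε ∧ ε ≤ 1 := by
    filter_upwards [Ioc_mem_nhdsGT (zero_lt_one' ℝ)] with ε hε using hε
  let Kε : ℝ → H →L[ℝ] H := fun ε => Ring.inverse (correction K ε) * (K + ε • 1)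
  have hKε : ∀ y, Tendsto (fun ε => Kε ε y) (𝓝[>] 0) (𝓝 (K y)) := fun y => by
    simpa [Kε] using tendsto_neg_inverse_approxGen hK hd' y
  have hKεb : ∀ ε, 0 < ε → ε ≤ 1 → ∀ y, ‖Kε ε y‖ ≤ 2 * (‖K‖ + 1) * ‖y‖ := by
    intro ε hε hε1 y
    have h1 := norm_inverse_correction_apply_le hK hε ((K + ε • 1) y)
    have h2 : ‖(K + ε • (1 : H →L[ℝ] H)) y‖ ≤ (‖K‖ + 1) * ‖y‖ := by
      simp only [add_apply, smul_apply, one_apply_eq_self]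
      refine (norm_add_le _ _).trans ?_
      rw [norm_smul, Real.norm_of_nonneg hε.le, add_mul]
      exact add_le_add (K.le_opNorm y) (mul_le_mul_of_nonneg_right hε1 (norm_nonneg _))
    calc ‖Kε ε y‖ ≤ 2 * ‖(K + ε • (1 : H →L[ℝ] H)) y‖ := h1
      _ ≤ 2 * ((‖K‖ + 1) * ‖y‖) := by gcongr
      _ = _ := by ring
  have hdiff : ∀ x, Tendsto (fun ε => Kε ε (S t (K x)) -
      expSemigroup (approxGen K ε) t (Kε ε (K x))) (𝓝[>] 0) (𝓝 0) := by
    intro x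
    -- Duhamel's formula for s ↦ exp((t-s)G) K_ε S(s) K x. Since G K_ε = -1, the unbounded behaviour
    -- of G disappears and only K - K_ε remains.
    have hinteg : ∀ ε, 0 < ε → Kε ε (S t (K x)) - expSemigroup (approxGen K ε) t (Kε ε (K x)) =
        ∫ s in (0 : ℝ)..t, expSemigroup (approxGen K ε) (t - s) (K (S s x) - Kε ε (S s x)) := by
      intro ε hε
      set G := approxGen K ε with hG
      have hGK : ∀ y, G (Kε ε y) = -y := fun y => by
        have := congrArg (fun T : H →L[ℝ] H => T y) (approxGen_mul_inverse hK hε)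
        exact this
      have hc : Continuous fun s : ℝ => expSemigroup G (t - s) :=
        (continuous_expSemigroup G).comp (continuous_const.sub continuous_id)
      have h1 : ContinuousOn (fun s => expSemigroup G (t - s) (Kε ε (S s (K x)))) (uIcc 0 t) := by
        rw [uIcc_of_le ht]
        exact hc.continuousOn.clm_apply ((Kε ε).continuous.comp_continuousOn
          ((hS.continuousOn (K x)).mono Icc_subset_Ici_self))
      have h2 : ContinuousOn (fun s => expSemigroup G (t - s) (K (S s x) - Kε ε (S s x)))
          (uIcc 0 t) := by
        rw [uIcc_of_le ht]
        have h3 := (hS.continuousOn x).mono (Icc_subset_Ici_self : Icc 0 t ⊆ Ici 0)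
        exact hc.continuousOn.clm_apply ((K.continuous.comp_continuousOn h3).sub
          ((Kε ε).continuous.comp_continuousOn h3))
      have h4 := intervalIntegral.integral_eq_sub_of_hasDeriv_right h1
        (f' := fun s => expSemigroup G (t - s) (K (S s x) - Kε ε (S s x))) (fun s hs => by
          rw [min_eq_left ht] at hs
          have e1 : HasDerivWithinAt (fun s : ℝ => expSemigroup G (t - s))
              (-(expSemigroup G (t - s) * G)) (Ioi s) s := by
            have := (hasDerivAt_expSemigroup G (t - s)).scomp s
              ((hasDerivAt_id s).const_sub t)
            simpa [Function.comp_def] using this.hasDerivWithinAt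
          have e2 : HasDerivWithinAt (fun s => Kε ε (S s (K x))) (Kε ε (-S s x)) (Ioi s) s :=
            (Kε ε).hasFDerivAt.comp_hasDerivWithinAt s
              (hasDerivWithinAt_semigroup hS hκ x hs.1.le)
          have e3 := e1.clm_apply e2
          have e4 : (-(expSemigroup G (t - s) * G)) (Kε ε (S s (K x))) +
              expSemigroup G (t - s) (Kε ε (-S s x)) =
              expSemigroup G (t - s) (K (S s x) - Kε ε (S s x)) := by
            rw [neg_apply, mul_apply_eq_comp, hGK, hKS x s hs.1.le]
            simp only [map_neg, neg_neg, map_sub]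
            abel
          rw [e4] at e3
          exact e3) h2.intervalIntegrable
      rw [h4, sub_self, sub_zero, expSemigroup_zero, hS.zero]
      rfl
    have hcont := (hS.continuousOn x).mono (Icc_subset_Ici_self : Icc 0 t ⊆ Ici 0)
    have hlim : Tendsto (fun ε => ∫ s in (0 : ℝ)..t,
        expSemigroup (approxGen K ε) (t - s) (K (S s x) - Kε ε (S s x))) (𝓝[>] 0)
        (𝓝 (∫ s in (0 : ℝ)..t, (0 : H))) := by
      refine intervalIntegral.tendsto_integral_filter_of_dominated_convergence
        (fun s => (‖K‖ + 2 * (‖K‖ + 1)) * ‖S s x‖) ?_ ?_ ?_ ?_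
      · filter_upwards with ε
        refine ContinuousOn.aestronglyMeasurable ?_ measurableSet_uIoc
        refine ContinuousOn.mono ?_ (uIoc_subset_uIcc)
        rw [uIcc_of_le ht]
        exact ((continuous_expSemigroup _).comp
          (continuous_const.sub continuous_id)).continuousOn.clm_apply
          ((K.continuous.comp_continuousOn hcont).sub
            ((Kε ε).continuous.comp_continuousOn hcont))
      · filter_upwards [hev] with ε hε
        refine Eventually.of_forall fun s hs => ?_
        rw [uIoc_of_le ht] at hs
        refine (norm_expSemigroup_approx_le_one hκ hlam hA hε.1 hε.2 (by linarith [hs.2]) _).trans ?_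
        refine (norm_sub_le _ _).trans ?_
        rw [add_mul]
        exact add_le_add (K.le_opNorm _) (hKεb ε hε.1 hε.2 _)
      · refine ContinuousOn.intervalIntegrable ?_
        rw [uIcc_of_le ht]
        exact continuousOn_const.mul hcont.norm
      · refine Eventually.of_forall fun s hs => ?_
        rw [uIoc_of_le ht] at hs
        have h5 : Tendsto (fun ε => ‖K (S s x) - Kε ε (S s x)‖) (𝓝[>] 0) (𝓝 0) := by
          have := ((tendsto_const_nhds (x := K (S s x))).sub (hKε (S s x))).norm
          simpa using this
        refine squeeze_zero_norm' ?_ h5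
        filter_upwards [hev] with ε hε
        exact norm_expSemigroup_approx_le_one hκ hlam hA hε.1 hε.2 (by linarith [hs.2]) _
    rw [intervalIntegral.integral_zero] at hlim
    refine hlim.congr' ?_
    filter_upwards [hev] with ε hε
    rw [hinteg ε hε.1]
  -- One factor K makes the orbit differentiable; the other is exchanged for K_ε to match the
  -- Duhamel formula.
  refine tendsto_of_tendsto_dense zero_le_one (e := fun z => K (K z)) ?_
    (hd.comp hd K.continuous) (fun z => ?_) x
  · filter_upwards [hev] with ε hε y
    rw [one_mul]
    exact norm_expSemigroup_approx_le_one hκ hlam hA hε.1 hε.2 ht y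
  · have h1 : Tendsto (fun ε => expSemigroup (approxGen K ε) t (K (K z) - Kε ε (K z)))
        (𝓝[>] 0) (𝓝 0) := by
      have h5 : Tendsto (fun ε => ‖K (K z) - Kε ε (K z)‖) (𝓝[>] 0) (𝓝 0) := by
        have := ((tendsto_const_nhds (x := K (K z))).sub (hKε (K z))).norm
        simpa using this
      refine squeeze_zero_norm' ?_ h5
      filter_upwards [hev] with ε hε
      exact norm_expSemigroup_approx_le_one hκ hlam hA hε.1 hε.2 ht _
    have h2 := (h1.sub (hdiff z)).add (hKε (S t (K z)))
    rw [sub_zero, zero_add, ← hKS (K z) t ht] at h2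
    refine h2.congr fun ε => ?_
    rw [map_sub]
    abel

theorem norm_semigroup_apply_le {t : ℝ} (ht : 0 ≤ t) (x : H) :
    ‖S t x‖ ≤ Real.exp (-decayRate i lam * t) * ‖x‖ := by
  refine le_of_tendsto (tendsto_expSemigroup hS hκ hi hlam hA ht x).norm ?_
  filter_upwards [Ioc_mem_nhdsGT (zero_lt_one' ℝ)] with ε hε
  exact norm_expSemigroup_approx_le hκ hlam hA hε.1 hε.2 ht x

theorem norm_semigroup_apply_le_one {t : ℝ} (ht : 0 ≤ t) (x : H) : ‖S t x‖ ≤ ‖x‖ := by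
  refine le_of_tendsto (tendsto_expSemigroup hS hκ hi hlam hA ht x).norm ?_
  filter_upwards [Ioc_mem_nhdsGT (zero_lt_one' ℝ)] with ε hε
  exact norm_expSemigroup_approx_le_one hκ hlam hA hε.1 hε.2 ht x

/-- The semigroup is analytic: there are bounded operators `E t` (namely `-A S(t)`) for `t > 0`,
which are strong limits of the corresponding operators of the approximating semigroups. -/
theorem exists_singular_operators : ∃ E : ℝ → H →L[ℝ] H, ∀ t, 0 < t →
    (∀ z, Tendsto (fun ε => expSemigroup (approxGen (i ∘L κ) ε) t (yosida (i ∘L κ) ε z))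
      (𝓝[>] 0) (𝓝 (E t z))) ∧
    (∀ z, ‖E t z‖ ≤ max ‖A‖ 1 / min lam 1 / t * ‖z‖) ∧
    ∀ z, E t (i (κ z)) = S t z := by
  have hK := hκ.inner_nonneg hlam hA
  have hd := hκ.denseRange hi
  have hl0 : 0 < min lam 1 := lt_min hlam one_pos
  have hev : ∀ᶠ ε : ℝ in 𝓝[>] 0, 0 < ε ∧ ε ≤ 1 := by
    filter_upwards [Ioc_mem_nhdsGT (zero_lt_one' ℝ)] with ε hε using hε
  have key : ∀ t : ℝ, 0 < t → ∀ z, Tendsto (fun ε =>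
      (expSemigroup (approxGen (i ∘L κ) ε) t * yosida (i ∘L κ) ε) ((i ∘L κ) z)) (𝓝[>] 0)
      (𝓝 (S t z)) := by
    intro t ht z
    have h1 : Tendsto (fun ε => expSemigroup (approxGen (i ∘L κ) ε) t
        (ε • yosida (i ∘L κ) ε z)) (𝓝[>] 0) (𝓝 0) := by
      have h5 := (tendsto_smul_yosida hK hd z).norm
      rw [norm_zero] at h5
      refine squeeze_zero_norm' ?_ h5
      filter_upwards [hev] with ε hε
      exact norm_expSemigroup_approx_le_one hκ hlam hA hε.1 hε.2 ht.le _
    have h2 := (tendsto_expSemigroup hS hκ hi hlam hA ht.le z).sub h1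
    rw [sub_zero] at h2
    refine h2.congr' ?_
    filter_upwards [hev] with ε hε
    rw [mul_apply_eq_comp, ← mul_apply_eq_comp (yosida (i ∘L κ) ε), yosida_mul_eq hK hε.1]
    simp
  have hex : ∀ t : ℝ, 0 < t → ∃ T' : H →L[ℝ] H,
      (∀ x, ‖T' x‖ ≤ max ‖A‖ 1 / min lam 1 / t * ‖x‖) ∧
      ∀ x, Tendsto (fun ε =>
        (expSemigroup (approxGen (i ∘L κ) ε) t * yosida (i ∘L κ) ε) x) (𝓝[>] 0) (𝓝 (T' x)) := by
    intro t ht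
    refine exists_strong_limit (by positivity) ?_ hd (key t ht)
    filter_upwards [hev] with ε hε x
    exact norm_expSemigroup_yosida_le hκ hlam hA hε.1 ht x
  choose! E hE using hex
  exact ⟨E, fun t ht => ⟨(hE t ht).2, (hE t ht).1, fun z =>
    tendsto_nhds_unique ((hE t ht).2 _) (key t ht z)⟩⟩

end Semigroup

end Skeleton

namespace Skeleton

/-! ### Interpolation between the analytic bound and boundedness on the range of K. -/

section Singular

variable {V H : Type*} [NormedAddCommGroup V] [NormedSpace ℝ V]
  [NormedAddCommGroup H] [InnerProductSpace ℝ H] [CompleteSpace H]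
  {i : V →L[ℝ] H} {A : V →L[ℝ] StrongDual ℝ V} {κ κ' : H →L[ℝ] V} {S : ℝ → H →L[ℝ] H}

/-- Interpolation: an operator which is of size `Γ / t` on `H` and bounded on the range of `K`
is of size `t ^ (θ - 1)` on vectors whose orbit is `θ`-Hölder at `0`. -/
theorem norm_apply_le_of_holder (hS : IsSemigroupOf i A S) (hκ : IsSolutionOperators i A κ κ')
    {lam : ℝ} (hlam : 0 < lam) (hA : ∀ u, A u u ≤ -lam * ‖u‖ ^ 2)
    {T : H →L[ℝ] H} {Γ t : ℝ} (hΓ : 0 ≤ Γ) (ht : 0 < t)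
    (hT : ∀ z, ‖T z‖ ≤ Γ / t * ‖z‖) (hTK : ∀ z, ‖T (i (κ z))‖ ≤ ‖z‖)
    {z : H} {D θ : ℝ} (hD : 0 ≤ D) (hθ : 0 < θ)
    (hz : ∀ τ, 0 < τ → τ ≤ 1 → ‖z - S τ z‖ ≤ D * τ ^ θ) :
    ‖T z‖ ≤ (Γ + 1) * D * (t ^ (θ - 1) + 1) := by
  -- Split τ z into ∫₀^τ (z - S(s)z) ds and K(z - S(τ)z). The bound Γ/t is applied to the first
  -- part, the bound on the range of K to the second. The best choice is τ = t for t ≤ 1; for larger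
  -- t take τ = 1.
  have key : ∀ τ, 0 < τ → τ ≤ 1 → ‖T z‖ ≤ Γ / t * (D * τ ^ θ) + D * τ ^ θ / τ := by
    intro τ hτ hτ1
    have h1 := semigroup_integral hS hκ z hτ.le
    have h2 : i (κ z) - S τ (i (κ z)) = i (κ (z - S τ z)) := by
      rw [semigroup_comm hS hκ hlam hA z hτ.le, map_sub, map_sub]
    rw [h2] at h1
    have hcont : ContinuousOn (fun s => S s z) (uIcc 0 τ) := by
      rw [uIcc_of_le hτ.le]
      exact (hS.continuousOn z).mono Icc_subset_Ici_self
    have h3 : ∫ s in (0 : ℝ)..τ, (z - S s z) = τ • z - i (κ (z - S τ z)) := by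
      rw [intervalIntegral.integral_sub intervalIntegrable_const hcont.intervalIntegrable, h1,
        intervalIntegral.integral_const, sub_zero]
    have h4 : ‖∫ s in (0 : ℝ)..τ, (z - S s z)‖ ≤ D * τ ^ θ * |τ - 0| := by
      refine intervalIntegral.norm_integral_le_of_norm_le_const fun s hs => ?_
      rw [uIoc_of_le hτ.le] at hs
      refine (hz s hs.1 (hs.2.trans hτ1)).trans ?_
      exact mul_le_mul_of_nonneg_left (Real.rpow_le_rpow hs.1.le hs.2 hθ.le) hD
    rw [h3, sub_zero, abs_of_pos hτ] at h4
    have h5 : τ * ‖T z‖ ≤ τ * (Γ / t * (D * τ ^ θ) + D * τ ^ θ / τ) := by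
      calc τ * ‖T z‖ = ‖T (τ • z)‖ := by rw [map_smul, norm_smul, Real.norm_of_nonneg hτ.le]
        _ = ‖T (τ • z - i (κ (z - S τ z))) + T (i (κ (z - S τ z)))‖ := by
          rw [← map_add, sub_add_cancel]
        _ ≤ ‖T (τ • z - i (κ (z - S τ z)))‖ + ‖T (i (κ (z - S τ z)))‖ := norm_add_le _ _
        _ ≤ Γ / t * (D * τ ^ θ * τ) + D * τ ^ θ := by
          refine add_le_add ((hT _).trans ?_) ((hTK _).trans (hz τ hτ hτ1))
          exact mul_le_mul_of_nonneg_left h4 (by positivity)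
        _ = _ := by field_simp
    exact le_of_mul_le_mul_left h5 hτ
  have hpow : 0 ≤ t ^ (θ - 1) := Real.rpow_nonneg ht.le _
  rcases le_or_gt t 1 with h1 | h1
  · refine (key t ht h1).trans ?_
    have h2 : t ^ θ = t ^ (θ - 1) * t := by
      rw [Real.rpow_sub_one ht.ne']; field_simp
    rw [h2]
    have h3 : Γ / t * (D * (t ^ (θ - 1) * t)) + D * (t ^ (θ - 1) * t) / t =
        (Γ + 1) * D * t ^ (θ - 1) := by field_simp
    rw [h3, mul_add]
    have : 0 ≤ (Γ + 1) * D * 1 := by positivity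
    linarith
  · refine (key 1 one_pos le_rfl).trans ?_
    rw [Real.one_rpow, mul_one, div_one]
    have h4 : Γ / t * D ≤ Γ * D := by
      refine mul_le_mul_of_nonneg_right (div_le_self hΓ h1.le) hD
    have h5 : 0 ≤ (Γ + 1) * D * t ^ (θ - 1) := by positivity
    linarith

end Singular

/-! ### Joint continuity of strongly continuous families. -/

section StrongContinuity

variable {H : Type*} [NormedAddCommGroup H] [InnerProductSpace ℝ H]

/-- Joint continuity of a strongly continuous, locally bounded family of operators. -/
theorem continuousOn_apply_of_strong {T : ℝ → H →L[ℝ] H} {D : Set ℝ}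
    (hT : ∀ x, ContinuousOn (fun t => T t x) D)
    (hb : ∀ t ∈ D, ∃ C, ∀ᶠ s in 𝓝[D] t, ∀ x, ‖T s x‖ ≤ C * ‖x‖)
    {X : Type*} [TopologicalSpace X] {a : X → ℝ} {f : X → H} {s : Set X}
    (ha : ContinuousOn a s) (hf : ContinuousOn f s) (hmaps : MapsTo a s D) :
    ContinuousOn (fun r => T (a r) (f r)) s := by
  intro r hr
  obtain ⟨C, hC⟩ := hb (a r) (hmaps hr)
  have hta : Tendsto a (𝓝[s] r) (𝓝[D] (a r)) := (ha r hr).tendsto_nhdsWithin hmaps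
  have h1 : Tendsto (fun q => T (a q) (f r)) (𝓝[s] r) (𝓝 (T (a r) (f r))) :=
    (hT (f r) (a r) (hmaps hr)).tendsto.comp hta
  have h2 : Tendsto (fun q => T (a q) (f q - f r)) (𝓝[s] r) (𝓝 0) := by
    have h3 : Tendsto (fun q => C * ‖f q - f r‖) (𝓝[s] r) (𝓝 0) := by
      have := (tendsto_iff_norm_sub_tendsto_zero.1 (hf r hr).tendsto).const_mul C
      simpa using this
    refine squeeze_zero_norm' ?_ h3
    filter_upwards [hta.eventually hC] with q hq using hq _
  have h4 := h1.add h2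
  rw [add_zero] at h4
  refine h4.congr fun q => ?_
  rw [map_sub]
  abel

end StrongContinuity

/-! ### Algebra and continuity of the singular family. -/

section SingularSemigroup

variable {V H : Type*} [NormedAddCommGroup V] [NormedSpace ℝ V]
  [NormedAddCommGroup H] [InnerProductSpace ℝ H]
  {i : V →L[ℝ] H} {A : V →L[ℝ] StrongDual ℝ V} {κ : H →L[ℝ] V} {S E : ℝ → H →L[ℝ] H}

/-- On the dense range of K this is the semigroup law; both sides are continuous. -/
theorem singular_add (hS : IsSemigroupOf i A S) (hd : DenseRange (i ∘L κ))
    (hE : ∀ t, 0 < t → ∀ z, E t (i (κ z)) = S t z) {s t : ℝ} (hs : 0 ≤ s) (ht : 0 < t) (z : H) :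
    E (s + t) z = S s (E t z) := by
  have : (E (s + t) : H → H) = S s ∘L E t := by
    refine hd.equalizer (E (s + t)).continuous (S s ∘L E t).continuous (funext fun z => ?_)
    simp only [Function.comp_apply, ContinuousLinearMap.comp_apply]
    rw [hE _ (by linarith), hE _ ht, hS.add s t hs ht.le]
    rfl
  exact congrFun this z

/-- Near t > 0 write E(s) = S(s - t/2)E(t/2), which reduces to strong continuity of `S`. -/
theorem continuousOn_singular (hS : IsSemigroupOf i A S) (hd : DenseRange (i ∘L κ))
    (hE : ∀ t, 0 < t → ∀ z, E t (i (κ z)) = S t z) (z : H) :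
    ContinuousOn (fun t => E t z) (Ioi 0) := by
  intro t ht
  have ht : 0 < t := ht
  have h1 : ContinuousAt (fun s => S (s - t / 2) (E (t / 2) z)) t := by
    have h2 : ContinuousAt (fun s => S s (E (t / 2) z)) (t - t / 2) :=
      (hS.continuousOn _).continuousAt (Ici_mem_nhds (by linarith))
    exact ContinuousAt.comp (f := fun s => s - t / 2) h2
      (continuousAt_id.sub continuousAt_const)
  refine ContinuousAt.continuousWithinAt (h1.congr ?_)
  filter_upwards [Ioi_mem_nhds (show t / 2 < t by linarith)] with s hs
  have hs : t / 2 < s := hs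
  have := singular_add hS hd hE (s := s - t / 2) (t := t / 2) (by linarith) (by linarith) z
  rw [sub_add_cancel] at this
  exact this.symm

end SingularSemigroup

end Skeleton

namespace Skeleton

/-! ### Weakly singular kernels and their Gronwall lemma. -/

section Kernel

/-- The weakly singular kernel `C ((t - r) ^ (θ - 1) + 1) + C ‖w r‖`. -/
noncomputable def volterraKernel {H : Type*} [Norm H] (C θ : ℝ) (w : ℝ → H) (t r : ℝ) : ℝ :=
  C * ((t - r) ^ (θ - 1) + 1) + C * ‖w r‖

variable {H : Type*} [NormedAddCommGroup H] {C θ : ℝ} {w : ℝ → H}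

theorem volterraKernel_nonneg (hC : 0 ≤ C) {t r : ℝ} (hr : r ≤ t) :
    0 ≤ volterraKernel C θ w t r := by
  have : 0 ≤ (t - r) ^ (θ - 1) := Real.rpow_nonneg (by linarith) _
  rw [volterraKernel]; positivity

theorem integrableOn_rpow_mul_exp (hθ : 0 < θ) {μ : ℝ} (hμ : 0 < μ) :
    IntegrableOn (fun u : ℝ => u ^ (θ - 1) * Real.exp (-(μ * u))) (Ioi 0) := by
  have := integrableOn_rpow_mul_exp_neg_mul_rpow (s := θ - 1) (p := 1) (b := μ)
    (by linarith) one_pos hμ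
  simpa using this

theorem integrableOn_exp_neg_mul {μ : ℝ} (hμ : 0 < μ) :
    IntegrableOn (fun u : ℝ => Real.exp (-(μ * u))) (Ioi 0) := by
  have := integrableOn_rpow_mul_exp one_pos hμ
  simpa using this

theorem integrableOn_kernel_weight (hθ : 0 < θ) {μ : ℝ} (hμ : 0 < μ) :
    IntegrableOn (fun u : ℝ => (u ^ (θ - 1) + 1) * Real.exp (-(μ * u))) (Ioi 0) := by
  have := (integrableOn_rpow_mul_exp hθ hμ).add (integrableOn_exp_neg_mul hμ)
  refine this.congr_fun (fun u _ => ?_) measurableSet_Ioi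
  simp only [Pi.add_apply]
  ring

/-- The closed form shows that the weighted mass of the kernel tends to 0 as μ → ∞. -/
theorem integral_kernel_weight (hθ : 0 < θ) {μ : ℝ} (hμ : 0 < μ) :
    ∫ u in Ioi (0 : ℝ), (u ^ (θ - 1) + 1) * Real.exp (-(μ * u)) =
      (1 / μ) ^ θ * Real.Gamma θ + 1 / μ := by
  have h1 := Real.integral_rpow_mul_exp_neg_mul_Ioi hθ hμ
  have h2 := Real.integral_rpow_mul_exp_neg_mul_Ioi one_pos hμ
  simp only [sub_self, Real.rpow_zero, one_mul, Real.rpow_one, Real.Gamma_one, mul_one] at h2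
  rw [← h1, ← h2, ← integral_add (integrableOn_rpow_mul_exp hθ hμ) (integrableOn_exp_neg_mul hμ)]
  refine integral_congr_ae (Eventually.of_forall fun u => ?_)
  simp only
  ring

/-- An integrable function of the elapsed time, integrated over a bounded interval. -/
theorem integrableOn_comp_sub_left {f : ℝ → ℝ} (hf : IntegrableOn f (Ioi 0))
    (hf0 : ∀ u, 0 < u → 0 ≤ f u) (s t : ℝ) :
    IntegrableOn (fun r => f (t - r)) (Ioc s t) ∧
      ∫ r in Ioc s t, f (t - r) ≤ ∫ u in Ioi (0 : ℝ), f u := by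
  rcases le_or_gt s t with hst | hst
  · have h1 : IntervalIntegrable f volume (t - t) (t - s) := by
      rw [sub_self, intervalIntegrable_iff_integrableOn_Ioc_of_le (by linarith)]
      exact hf.mono_set Ioc_subset_Ioi_self
    have h2 : IntervalIntegrable (fun r => f (t - r)) volume s t := by
      have := h1.comp_sub_left t
      simpa using this.symm
    rw [intervalIntegrable_iff_integrableOn_Ioc_of_le hst] at h2
    refine ⟨h2, ?_⟩
    rw [← intervalIntegral.integral_of_le hst, intervalIntegral.integral_comp_sub_left f t,
      sub_self, intervalIntegral.integral_of_le (by linarith)]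
    refine setIntegral_mono_set hf ?_ (Eventually.of_forall fun u hu => hu.1)
    filter_upwards [ae_restrict_mem measurableSet_Ioi] with u hu using hf0 u hu
  · rw [Ioc_eq_empty (by linarith)]
    simp only [integrableOn_empty, Measure.restrict_empty, integral_zero_measure, true_and]
    refine setIntegral_nonneg measurableSet_Ioi fun u hu => hf0 u hu

/-- An exponential weight making the kernel small. -/
theorem exists_weight (hC : 0 ≤ C) (hθ : 0 < θ) (hw : MemLp w 2 volume) :
    ∃ μ : ℝ, 0 < μ ∧ ∀ s t,
      IntegrableOn (fun r => volterraKernel C θ w t r * Real.exp (-(μ * (t - r)))) (Ioc s t) ∧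
      ∫ r in Ioc s t, volterraKernel C θ w t r * Real.exp (-(μ * (t - r))) ≤ 1 / 2 := by
  have hw2 : Integrable (fun r => ‖w r‖ ^ 2) := hw.integrable_norm_pow (by norm_num)
  set W := ∫ r, ‖w r‖ ^ 2 with hW
  have hW0 : 0 ≤ W := integral_nonneg fun r => by positivity
  -- Young's inequality splits C‖w‖e into a multiple of e and δ‖w‖². This δ keeps the second
  -- contribution below 1/8, so the first must be below 3/8 for a total of at most 1/2.
  set δ := 1 / (8 * (W + 1)) with hδ
  have hδ0 : 0 < δ := by positivity
  have hδW : δ * W ≤ 1 / 8 := by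
    rw [hδ, div_mul_eq_mul_div, div_le_div_iff₀ (by positivity) (by norm_num)]
    linarith
  have hlim : Tendsto (fun μ : ℝ => (C + C ^ 2 / (4 * δ)) *
      ((1 / μ) ^ θ * Real.Gamma θ + 1 / μ)) atTop (𝓝 0) := by
    have h1 : Tendsto (fun μ : ℝ => 1 / μ) atTop (𝓝 0) := by
      simpa using tendsto_inv_atTop_zero (𝕜 := ℝ)
    have h2 : Tendsto (fun μ : ℝ => (1 / μ) ^ θ) atTop (𝓝 0) := by
      have := h1.rpow_const (p := θ) (Or.inr hθ.le)
      rwa [Real.zero_rpow hθ.ne'] at this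
    have := ((h2.mul_const (Real.Gamma θ)).add h1).const_mul (C + C ^ 2 / (4 * δ))
    simpa using this
  obtain ⟨μ, hμ1, hμ⟩ := ((hlim.eventually (gt_mem_nhds (show (0 : ℝ) < 3 / 8 by norm_num))).and
    (eventually_gt_atTop 0)).exists
  refine ⟨μ, hμ, fun s t => ?_⟩
  obtain ⟨hi, hle⟩ := integrableOn_comp_sub_left (integrableOn_kernel_weight hθ hμ)
    (fun u hu => by
      have := Real.rpow_nonneg hu.le (θ - 1)
      positivity) s t
  rw [integral_kernel_weight hθ hμ] at hle
  have hbound : ∀ r ∈ Ioc s t, volterraKernel C θ w t r * Real.exp (-(μ * (t - r))) ≤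
      (C + C ^ 2 / (4 * δ)) * (((t - r) ^ (θ - 1) + 1) * Real.exp (-(μ * (t - r)))) +
        δ * ‖w r‖ ^ 2 := by
    intro r hr
    set e := Real.exp (-(μ * (t - r))) with he
    have he0 : 0 < e := Real.exp_pos _
    have he1 : e ≤ 1 := Real.exp_le_one_iff.2 (by
      have := mul_nonneg hμ.le (sub_nonneg.2 hr.2); linarith)
    have hp : 0 ≤ (t - r) ^ (θ - 1) := Real.rpow_nonneg (sub_nonneg.2 hr.2) _
    have h1 : C * ‖w r‖ * e ≤ C ^ 2 / (4 * δ) * e + δ * ‖w r‖ ^ 2 := by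
      have h2 : C * ‖w r‖ * e ≤ C ^ 2 / (4 * δ) * e ^ 2 + δ * ‖w r‖ ^ 2 := by
        have : C ^ 2 / (4 * δ) * e ^ 2 = (C * e) ^ 2 / (4 * δ) := by ring
        rw [this, ← sub_le_iff_le_add, le_div_iff₀ (by positivity)]
        nlinarith [sq_nonneg (C * e - 2 * δ * ‖w r‖)]
      have h3 : C ^ 2 / (4 * δ) * e ^ 2 ≤ C ^ 2 / (4 * δ) * e := by
        refine mul_le_mul_of_nonneg_left (by nlinarith) (by positivity)
      linarith
    have h4 : 0 ≤ C ^ 2 / (4 * δ) * ((t - r) ^ (θ - 1) * e) := by positivity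
    rw [volterraKernel]
    nlinarith
  have hi2 : IntegrableOn (fun r => (C + C ^ 2 / (4 * δ)) *
      (((t - r) ^ (θ - 1) + 1) * Real.exp (-(μ * (t - r)))) + δ * ‖w r‖ ^ 2) (Ioc s t) :=
    (hi.const_mul _).add (hw2.const_mul δ).integrableOn
  have hmeas : AEStronglyMeasurable
      (fun r => volterraKernel C θ w t r * Real.exp (-(μ * (t - r)))) (volume.restrict (Ioc s t)) := by
    have h1 : AEStronglyMeasurable (fun r => ‖w r‖) (volume.restrict (Ioc s t)) :=
      hw.1.norm.restrict
    have h2 : Measurable fun r : ℝ => (t - r) ^ (θ - 1) := by fun_prop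
    have h3 : Measurable fun r : ℝ => Real.exp (-(μ * (t - r))) := by fun_prop
    exact ((((h2.add_const 1).const_mul C).aestronglyMeasurable).add
      (h1.const_mul C)).mul h3.aestronglyMeasurable
  have hinteg : IntegrableOn
      (fun r => volterraKernel C θ w t r * Real.exp (-(μ * (t - r)))) (Ioc s t) := by
    refine Integrable.mono' hi2 hmeas ?_
    filter_upwards [ae_restrict_mem measurableSet_Ioc] with r hr
    rw [Real.norm_of_nonneg (mul_nonneg (volterraKernel_nonneg hC hr.2) (Real.exp_pos _).le)]
    exact hbound r hr
  refine ⟨hinteg, ?_⟩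
  calc _ ≤ ∫ r in Ioc s t, ((C + C ^ 2 / (4 * δ)) *
      (((t - r) ^ (θ - 1) + 1) * Real.exp (-(μ * (t - r)))) + δ * ‖w r‖ ^ 2) :=
        setIntegral_mono_on hinteg hi2 measurableSet_Ioc hbound
    _ = (C + C ^ 2 / (4 * δ)) * (∫ r in Ioc s t,
      (((t - r) ^ (θ - 1) + 1) * Real.exp (-(μ * (t - r))))) + δ * ∫ r in Ioc s t, ‖w r‖ ^ 2 := by
        rw [integral_add (hi.const_mul _) (hw2.const_mul δ).integrableOn, integral_const_mul,
          integral_const_mul]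
    _ ≤ (C + C ^ 2 / (4 * δ)) * ((1 / μ) ^ θ * Real.Gamma θ + 1 / μ) + δ * W := by
        have h5 : ∫ r in Ioc s t, ‖w r‖ ^ 2 ≤ W :=
          setIntegral_le_integral hw2 (Eventually.of_forall fun r => by positivity)
        gcongr
    _ ≤ 1 / 2 := by linarith

/-- The kernel itself is integrable on bounded intervals. -/
theorem integrableOn_volterraKernel (hC : 0 ≤ C) (hθ : 0 < θ) (hw : MemLp w 2 volume) (s t : ℝ) :
    IntegrableOn (volterraKernel C θ w t) (Ioc s t) := by
  obtain ⟨μ, hμ, h⟩ := exists_weight hC hθ hw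
  have h1 := (h s t).1.bdd_mul (c := Real.exp (μ * |t - s|))
    (f := fun r => Real.exp (μ * (t - r)))
    (by fun_prop) ?_
  · refine h1.congr (Eventually.of_forall fun r => ?_)
    simp only
    rw [mul_comm, mul_assoc, ← Real.exp_add]
    simp
  · filter_upwards [ae_restrict_mem measurableSet_Ioc] with r hr
    rw [Real.norm_of_nonneg (Real.exp_pos _).le, Real.exp_le_exp]
    refine mul_le_mul_of_nonneg_left ?_ hμ.le
    refine le_trans ?_ (le_abs_self _)
    linarith [hr.1]

open scoped ENNReal

/-- **Gronwall lemma** for weakly singular kernels: a bounded subsolution of the homogeneous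
Volterra inequality vanishes. -/
theorem eq_zero_of_le_volterra (hC : 0 ≤ C) (hθ : 0 < θ) (hw : MemLp w 2 volume) {s T : ℝ}
    {D : ℝ → ℝ≥0∞} {b : ℝ≥0∞} (hb : b ≠ ∞) (hDb : ∀ t ∈ Icc s T, D t ≤ b)
    (hD : ∀ t ∈ Icc s T,
      D t ≤ ∫⁻ r in Ioc s t, ENNReal.ofReal (volterraKernel C θ w t r) * D r)
    {t : ℝ} (ht : t ∈ Icc s T) : D t = 0 := by
  obtain ⟨μ, hμ, h⟩ := exists_weight hC hθ hw
  let e : ℝ → ℝ≥0∞ := fun t => ENNReal.ofReal (Real.exp (-(μ * (t - s))))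
  -- The weighted supremum satisfies m ≤ m/2 and is finite. With lower integrals no measurability of
  -- `D` is needed, which is convenient when `D` is a limsup.
  set m : ℝ≥0∞ := ⨆ t ∈ Icc s T, e t * D t with hm
  have hmb : m ≤ b := by
    refine iSup₂_le fun t ht => ?_
    have h1 : e t ≤ 1 := by
      rw [← ENNReal.ofReal_one]
      refine ENNReal.ofReal_le_ofReal (Real.exp_le_one_iff.2 ?_)
      have := mul_nonneg hμ.le (sub_nonneg.2 ht.1)
      linarith
    calc e t * D t ≤ 1 * b := mul_le_mul' h1 (hDb t ht)
      _ = b := one_mul b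
  have hm2 : m ≤ ENNReal.ofReal (1 / 2) * m := by
    refine iSup₂_le fun t ht => ?_
    calc e t * D t ≤ e t * ∫⁻ r in Ioc s t, ENNReal.ofReal (volterraKernel C θ w t r) * D r :=
          mul_le_mul' le_rfl (hD t ht)
      _ = ∫⁻ r in Ioc s t, e t * (ENNReal.ofReal (volterraKernel C θ w t r) * D r) := by
          rw [lintegral_const_mul' _ _ ENNReal.ofReal_ne_top]
      _ ≤ ∫⁻ r in Ioc s t, ENNReal.ofReal
            (volterraKernel C θ w t r * Real.exp (-(μ * (t - r)))) * m := by
          refine setLIntegral_mono' measurableSet_Ioc fun r hr => ?_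
          have h2 : e t = ENNReal.ofReal (Real.exp (-(μ * (t - r)))) * e r := by
            simp only [e]
            rw [← ENNReal.ofReal_mul (Real.exp_pos _).le, ← Real.exp_add]
            congr 2; ring
          rw [h2, ENNReal.ofReal_mul (volterraKernel_nonneg hC hr.2)]
          calc _ = ENNReal.ofReal (volterraKernel C θ w t r) *
                ENNReal.ofReal (Real.exp (-(μ * (t - r)))) * (e r * D r) := by ring
            _ ≤ _ := by
              refine mul_le_mul' le_rfl ?_
              exact le_iSup₂ (f := fun t (_ : t ∈ Icc s T) => e t * D t) r
                ⟨hr.1.le, hr.2.trans ht.2⟩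
      _ = (∫⁻ r in Ioc s t, ENNReal.ofReal
            (volterraKernel C θ w t r * Real.exp (-(μ * (t - r))))) * m := by
          rw [lintegral_mul_const' _ _ (ne_top_of_le_ne_top hb hmb)]
      _ ≤ ENNReal.ofReal (1 / 2) * m := by
          refine mul_le_mul' ?_ le_rfl
          rw [← ofReal_integral_eq_lintegral_ofReal (h s t).1]
          · exact ENNReal.ofReal_le_ofReal (h s t).2
          · filter_upwards [ae_restrict_mem measurableSet_Ioc] with r hr
            exact mul_nonneg (volterraKernel_nonneg hC hr.2) (Real.exp_pos _).le
  have hm0 : m = 0 := by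
    by_contra hne
    have hmt : m ≠ ∞ := ne_top_of_le_ne_top hb hmb
    have h3 : ENNReal.ofReal (1 / 2) * m < 1 * m := by
      refine ENNReal.mul_lt_mul_left hne hmt ?_
      rw [← ENNReal.ofReal_one]
      exact (ENNReal.ofReal_lt_ofReal_iff one_pos).2 (by norm_num)
    rw [one_mul] at h3
    exact absurd hm2 (not_le.2 h3)
  have h4 : e t * D t ≤ 0 := by
    rw [← hm0]
    exact le_iSup₂ (f := fun t (_ : t ∈ Icc s T) => e t * D t) t ht
  have h5 : e t ≠ 0 := by
    simp only [e, ne_eq, ENNReal.ofReal_eq_zero, not_le]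
    exact Real.exp_pos _
  have h6 := le_antisymm h4 bot_le
  exact (mul_eq_zero.1 h6).resolve_left h5

end Kernel

end Skeleton

namespace Skeleton

/-! ### The abstract mild equation: estimates, measurability, continuity, uniqueness. -/

section Volterra

variable {H : Type*} [NormedAddCommGroup H] [InnerProductSpace ℝ H]

/-- Coefficients of an abstract mild equation
`X(t) = U(t-s) x + ∫ₛᵗ E(t-r) ψ(X(r)) dr + ∫ₛᵗ U(t-r) b(X(r)) w(r) dr`
with a weakly singular family `E`. -/
structure VolterraData (U E : ℝ → H →L[ℝ] H) (ψ : H → H) (b : H → H →L[ℝ] H) (C θ : ℝ) :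
    Prop where
  nonneg : 0 ≤ C
  theta_pos : 0 < θ
  U_norm : ∀ t, 0 ≤ t → ∀ x, ‖U t x‖ ≤ ‖x‖
  U_cont : ∀ x, ContinuousOn (fun t => U t x) (Ici 0)
  E_norm : ∀ t, 0 < t → ∀ x, ‖E t x‖ ≤ C / t * ‖x‖
  E_cont : ∀ x, ContinuousOn (fun t => E t x) (Ioi 0)
  psi_cont : Continuous ψ
  E_lip : ∀ t, 0 < t → ∀ x y, ‖E t (ψ x - ψ y)‖ ≤ C * (t ^ (θ - 1) + 1) * ‖x - y‖
  E_zero : ∀ t, 0 < t → ‖E t (ψ 0)‖ ≤ C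
  b_lip : ∀ x y, ‖b x - b y‖ ≤ C * ‖x - y‖
  b_bdd : ∀ x, ‖b x‖ ≤ C

/-- The integrand of the mild equation. -/
noncomputable def mildIntegrand (U E : ℝ → H →L[ℝ] H) (ψ : H → H) (b : H → H →L[ℝ] H) (w : ℝ → H)
    (t r : ℝ) (x : H) : H :=
  E (t - r) (ψ x) + U (t - r) (b x (w r))

/-- `X` solves the mild equation from time `s` on, up to time `t`. -/
def SolvesAt (U E : ℝ → H →L[ℝ] H) (ψ : H → H) (b : H → H →L[ℝ] H) (w : ℝ → H)
    (s : ℝ) (x : H) (X : ℝ → H) (t : ℝ) : Prop :=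
  X t = U (t - s) x + ∫ r in Ioc s t, mildIntegrand U E ψ b w t r (X r)

variable {U E : ℝ → H →L[ℝ] H} {ψ : H → H} {b : H → H →L[ℝ] H} {C θ : ℝ} {w : ℝ → H}
  (h : VolterraData U E ψ b C θ)

namespace VolterraData

include h

theorem b_cont : Continuous b :=
  (LipschitzWith.of_dist_le_mul (K := ⟨C, h.nonneg⟩) fun x y => by
    rw [dist_eq_norm, dist_eq_norm]; exact h.b_lip x y).continuous

theorem norm_E_psi_le {t : ℝ} (ht : 0 < t) (x : H) :
    ‖E t (ψ x)‖ ≤ C * (t ^ (θ - 1) + 1) * (‖x‖ + 1) := by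
  have h1 := h.E_lip t ht x 0
  have h2 := h.E_zero t ht
  have h3 : E t (ψ x) = E t (ψ x - ψ 0) + E t (ψ 0) := by rw [map_sub]; abel
  rw [h3]
  refine (norm_add_le _ _).trans ?_
  rw [sub_zero] at h1
  have h4 : 0 ≤ C * t ^ (θ - 1) := mul_nonneg h.nonneg (Real.rpow_nonneg ht.le _)
  nlinarith

theorem norm_U_b_le {t : ℝ} (ht : 0 ≤ t) (x y : H) : ‖U t (b x y)‖ ≤ C * ‖y‖ :=
  (h.U_norm t ht _).trans ((b x).le_of_opNorm_le (h.b_bdd x) y)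

theorem norm_mildIntegrand_le {t r : ℝ} (hr : r < t) (x : H) :
    ‖mildIntegrand U E ψ b w t r x‖ ≤ volterraKernel C θ w t r * (‖x‖ + 1) := by
  refine (norm_add_le _ _).trans ?_
  have h1 := h.norm_E_psi_le (sub_pos.2 hr) x
  have h2 := h.norm_U_b_le (sub_pos.2 hr).le x (w r)
  have h3 : 0 ≤ C * ‖w r‖ * ‖x‖ := by have := h.nonneg; positivity
  rw [volterraKernel, add_mul]
  linarith

theorem norm_mildIntegrand_sub_le {t r : ℝ} (hr : r < t) (x y : H) :
    ‖mildIntegrand U E ψ b w t r x - mildIntegrand U E ψ b w t r y‖ ≤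
      volterraKernel C θ w t r * ‖x - y‖ := by
  have h1 : mildIntegrand U E ψ b w t r x - mildIntegrand U E ψ b w t r y =
      E (t - r) (ψ x - ψ y) + U (t - r) ((b x - b y) (w r)) := by
    simp only [mildIntegrand, map_sub, sub_apply]; abel
  rw [h1]
  refine (norm_add_le _ _).trans ?_
  have h2 := h.E_lip (t - r) (sub_pos.2 hr) x y
  have h3 : ‖U (t - r) ((b x - b y) (w r))‖ ≤ C * ‖x - y‖ * ‖w r‖ :=
    (h.U_norm _ (sub_pos.2 hr).le _).trans ((b x - b y).le_of_opNorm_le (h.b_lip x y) _)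
  rw [volterraKernel, add_mul]
  linarith

theorem continuousOn_U {X : Type*} [TopologicalSpace X] {a : X → ℝ} {f : X → H} {D : Set X}
    (ha : ContinuousOn a D) (hf : ContinuousOn f D) (hmaps : ∀ r ∈ D, 0 ≤ a r) :
    ContinuousOn (fun r => U (a r) (f r)) D := by
  refine continuousOn_apply_of_strong (D := Ici 0) h.U_cont (fun t _ => ⟨1, ?_⟩) ha hf hmaps
  filter_upwards [self_mem_nhdsWithin] with s hs x
  rw [one_mul]
  exact h.U_norm s hs x

theorem continuousOn_E {X : Type*} [TopologicalSpace X] {a : X → ℝ} {f : X → H} {D : Set X}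
    (ha : ContinuousOn a D) (hf : ContinuousOn f D) (hmaps : ∀ r ∈ D, 0 < a r) :
    ContinuousOn (fun r => E (a r) (f r)) D := by
  refine continuousOn_apply_of_strong (D := Ioi 0) h.E_cont (fun t ht => ⟨C / (t / 2), ?_⟩)
    ha hf hmaps
  have ht : 0 < t := ht
  filter_upwards [mem_nhdsWithin_of_mem_nhds (Ioi_mem_nhds (show t / 2 < t by linarith))]
    with s hs x
  have hs : t / 2 < s := hs
  refine (h.E_norm s (by linarith) x).trans ?_
  have := h.nonneg
  gcongr

/-- Strong continuity together with contractivity gives joint continuity of (r, y) ↦ U(t-r)y, once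
the time is clamped at 0 to make it global. -/
theorem aestronglyMeasurable_U_apply {g : ℝ → H} {t : ℝ} {D : Set ℝ} (hD : MeasurableSet D)
    (hDt : D ⊆ Iic t) (hg : AEStronglyMeasurable g (volume.restrict D)) :
    AEStronglyMeasurable (fun r => U (t - r) (g r)) (volume.restrict D) := by
  have h1 : Continuous fun p : ℝ × H => U (max (t - p.1) 0) p.2 := by
    rw [← continuousOn_univ]
    exact h.continuousOn_U (by fun_prop) (by fun_prop) fun p _ => le_max_right _ _
  have h2 := h1.comp_aestronglyMeasurable (aestronglyMeasurable_id.prodMk hg)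
  refine h2.congr ?_
  filter_upwards [ae_restrict_mem hD] with r hr
  have : r ≤ t := hDt hr
  simp only [id]
  rw [max_eq_left (by linarith)]

theorem aestronglyMeasurable_b (hw : AEStronglyMeasurable w volume) {D : Set ℝ}
    (hD : MeasurableSet D) {X : ℝ → H} (hX : ContinuousOn X D) :
    AEStronglyMeasurable (fun r => b (X r) (w r)) (volume.restrict D) := by
  have h1 : AEStronglyMeasurable (fun r => b (X r)) (volume.restrict D) :=
    (h.b_cont.comp_continuousOn hX).aestronglyMeasurable hD
  exact (ContinuousLinearMap.id ℝ (H →L[ℝ] H)).aestronglyMeasurable_comp₂ h1 hw.restrict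

theorem aestronglyMeasurable_E {D : Set ℝ} {t : ℝ} (hD : MeasurableSet D) (hDt : D ⊆ Iic t)
    {X : ℝ → H} (hX : ContinuousOn X D) :
    AEStronglyMeasurable (fun r => E (t - r) (ψ (X r))) (volume.restrict D) := by
  have h1 : ContinuousOn (fun r => E (t - r) (ψ (X r))) (D \ {t}) :=
    h.continuousOn_E (by fun_prop) (h.psi_cont.comp_continuousOn (hX.mono sdiff_subset))
      fun r hr => by
        have h2 : r ≤ t := hDt hr.1
        have h3 : r ≠ t := hr.2
        exact sub_pos.2 (lt_of_le_of_ne h2 h3)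
  have h2 := h1.aestronglyMeasurable (μ := volume) (hD.diff (measurableSet_singleton t))
  rwa [Measure.restrict_congr_set (sdiff_null_ae_eq_self (measure_singleton t))] at h2

theorem integrableOn_E {s t : ℝ} {X : ℝ → H} (hX : ContinuousOn X (Icc s t)) :
    IntegrableOn (fun r => E (t - r) (ψ (X r))) (Ioc s t) := by
  obtain ⟨B, hB⟩ := isCompact_Icc.exists_bound_of_continuousOn hX
  have hk := (integrableOn_volterraKernel h.nonneg h.theta_pos (w := (0 : ℝ → ℝ))
    MemLp.zero s t).mul_const (B + 1)
  refine Integrable.mono' hk (h.aestronglyMeasurable_E measurableSet_Ioc Ioc_subset_Iic_self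
    (hX.mono Ioc_subset_Icc_self)) ?_
  rw [← Measure.restrict_congr_set Ioo_ae_eq_Ioc]
  filter_upwards [ae_restrict_mem measurableSet_Ioo] with r hr
  refine (h.norm_E_psi_le (sub_pos.2 hr.2) (X r)).trans ?_
  have h1 := hB r ⟨hr.1.le, hr.2.le⟩
  have h2 : 0 ≤ (t - r) ^ (θ - 1) := Real.rpow_nonneg (by linarith [hr.2]) _
  have := h.nonneg
  simp only [volterraKernel, Pi.zero_apply, norm_zero, mul_zero, add_zero]
  gcongr

theorem integrableOn_b (hw : MemLp w 2 volume) {s t : ℝ} {X : ℝ → H}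
    (hX : ContinuousOn X (Icc s t)) :
    IntegrableOn (fun r => b (X r) (w r)) (Ioc s t) := by
  have h1 : IntegrableOn (fun r => C * ‖w r‖) (Ioc s t) := by
    refine Integrable.const_mul ?_ C
    exact (((hw.locallyIntegrable (by norm_num)).integrableOn_isCompact
      (isCompact_Icc (a := s) (b := t))).mono_set Ioc_subset_Icc_self).norm
  refine Integrable.mono' h1
    (h.aestronglyMeasurable_b hw.1 measurableSet_Ioc (hX.mono Ioc_subset_Icc_self)) ?_
  exact Eventually.of_forall fun r => (b (X r)).le_of_opNorm_le (h.b_bdd _) _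

theorem integrableOn_U (hw : MemLp w 2 volume) {s t : ℝ} {X : ℝ → H}
    (hX : ContinuousOn X (Icc s t)) :
    IntegrableOn (fun r => U (t - r) (b (X r) (w r))) (Ioc s t) := by
  refine Integrable.mono (h.integrableOn_b hw hX) (h.aestronglyMeasurable_U_apply
    measurableSet_Ioc Ioc_subset_Iic_self (h.integrableOn_b hw hX).1) ?_
  filter_upwards [ae_restrict_mem measurableSet_Ioc] with r hr
  exact h.U_norm _ (sub_nonneg.2 hr.2) _

theorem integrableOn_mildIntegrand (hw : MemLp w 2 volume) {s t : ℝ} {X : ℝ → H}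
    (hX : ContinuousOn X (Icc s t)) :
    IntegrableOn (fun r => mildIntegrand U E ψ b w t r (X r)) (Ioc s t) :=
  (h.integrableOn_E hX).add (h.integrableOn_U hw hX)

theorem integral_mildIntegrand (hw : MemLp w 2 volume) {s t : ℝ} {X : ℝ → H}
    (hX : ContinuousOn X (Icc s t)) :
    ∫ r in Ioc s t, mildIntegrand U E ψ b w t r (X r) =
      (∫ r in Ioc s t, E (t - r) (ψ (X r))) + ∫ r in Ioc s t, U (t - r) (b (X r) (w r)) :=
  integral_add (h.integrableOn_E hX) (h.integrableOn_U hw hX)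

/-- Dominated convergence. The integrand, extended by 0, can be discontinuous in t only at t = r, a
null set of r for each t, and ‖g‖ dominates since `U` is contractive. -/
theorem continuous_integral_U {g : ℝ → H} {s : ℝ} (hg : ∀ t, IntegrableOn g (Ioc s t)) :
    Continuous fun t => ∫ r in Ioc s t, U (t - r) (g r) := by
  have h0 : (fun t => ∫ r in Ioc s t, U (t - r) (g r)) =
      fun t => ∫ r, (Ioc s t).indicator (fun r => U (t - r) (g r)) r := by
    funext t
    rw [integral_indicator measurableSet_Ioc]
  rw [h0, continuous_iff_continuousAt]
  intro t₀
  refine continuousAt_of_dominated (bound := (Ioc s (t₀ + 1)).indicator fun r => ‖g r‖)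
    ?_ ?_ ?_ ?_
  · filter_upwards with t
    rw [aestronglyMeasurable_indicator_iff measurableSet_Ioc]
    exact h.aestronglyMeasurable_U_apply measurableSet_Ioc Ioc_subset_Iic_self (hg t).1
  · filter_upwards [Iio_mem_nhds (show t₀ < t₀ + 1 by linarith)] with t ht
    refine Eventually.of_forall fun r => ?_
    have ht : t < t₀ + 1 := ht
    by_cases hr : r ∈ Ioc s t
    · rw [indicator_of_mem hr, indicator_of_mem (show r ∈ Ioc s (t₀ + 1) from
        ⟨hr.1, by linarith [hr.2]⟩)]
      exact h.U_norm _ (sub_nonneg.2 hr.2) _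
    · rw [indicator_of_notMem hr, norm_zero]
      exact indicator_nonneg (fun _ _ => norm_nonneg _) _
  · exact IntegrableOn.integrable_indicator (hg (t₀ + 1)).norm measurableSet_Ioc
  · have : ∀ᵐ r : ℝ, r ≠ t₀ := by simp [ae_iff, measure_singleton]
    filter_upwards [this] with r hr
    by_cases hs : s < r
    · rcases lt_or_gt_of_ne hr with h1 | h1
      · have h2 : ContinuousAt (fun t => U (t - r) (g r)) t₀ := by
          have h3 : ContinuousAt (fun t => U t (g r)) (t₀ - r) :=
            (h.U_cont (g r)).continuousAt (Ici_mem_nhds (by linarith))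
          exact ContinuousAt.comp (f := fun t => t - r) h3 (by fun_prop)
        refine h2.congr ?_
        filter_upwards [Ioi_mem_nhds h1] with t ht
        rw [indicator_of_mem (show r ∈ Ioc s t from ⟨hs, le_of_lt ht⟩)]
      · refine continuousAt_const.congr (f := fun _ => (0 : H)) ?_
        filter_upwards [Iio_mem_nhds h1] with t ht
        rw [indicator_of_notMem (fun hm => absurd hm.2 (not_le.2 ht))]
    · refine continuousAt_const.congr (f := fun _ => (0 : H)) ?_
      filter_upwards with t
      rw [indicator_of_notMem (fun hm => hs hm.1)]

/-- The substitution u = t - r fixes the singularity at u = 0, so that one integrable majorant of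
order u^(θ-1) serves for all t near a given time. -/
theorem continuousOn_integral_E {X : ℝ → H} (hX : Continuous X) (s : ℝ) :
    ContinuousOn (fun t => ∫ r in Ioc s t, E (t - r) (ψ (X r))) (Ici s) := by
  have h0 : ∀ t ∈ Ici s, ∫ r in Ioc s t, E (t - r) (ψ (X r)) =
      ∫ u, (Ioc 0 (t - s)).indicator (fun u => E u (ψ (X (t - u)))) u := by
    intro t ht
    have ht : s ≤ t := ht
    rw [integral_indicator measurableSet_Ioc, ← intervalIntegral.integral_of_le ht,
      ← intervalIntegral.integral_of_le (by linarith)]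
    have := intervalIntegral.integral_comp_sub_left (a := s) (b := t)
      (fun u => E u (ψ (X (t - u)))) t
    simpa using this
  refine ContinuousOn.congr (Continuous.continuousOn ?_) h0
  rw [continuous_iff_continuousAt]
  intro t₀
  obtain ⟨B, hB⟩ := (isCompact_Icc (a := s) (b := t₀ + 1)).exists_bound_of_continuousOn
    hX.continuousOn
  refine continuousAt_of_dominated (bound := (Ioc 0 (t₀ + 1 - s)).indicator
    fun u => C * (u ^ (θ - 1) + 1) * (B + 1)) ?_ ?_ ?_ ?_
  · filter_upwards with t
    rw [aestronglyMeasurable_indicator_iff measurableSet_Ioc]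
    refine ContinuousOn.aestronglyMeasurable ?_ measurableSet_Ioc
    exact h.continuousOn_E continuousOn_id (h.psi_cont.comp
      (hX.comp (by fun_prop))).continuousOn fun r hr => hr.1
  · filter_upwards [Iio_mem_nhds (show t₀ < t₀ + 1 by linarith)] with t ht
    refine Eventually.of_forall fun u => ?_
    have ht : t < t₀ + 1 := ht
    by_cases hu : u ∈ Ioc 0 (t - s)
    · rw [indicator_of_mem hu, indicator_of_mem (show u ∈ Ioc 0 (t₀ + 1 - s) from
        ⟨hu.1, by linarith [hu.2]⟩)]
      refine (h.norm_E_psi_le hu.1 _).trans ?_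
      have h1 := hB (t - u) ⟨by linarith [hu.2], by linarith [hu.1]⟩
      have h2 : 0 ≤ u ^ (θ - 1) := Real.rpow_nonneg hu.1.le _
      have := h.nonneg
      gcongr
    · rw [indicator_of_notMem hu, norm_zero]
      by_cases hu' : u ∈ Ioc 0 (t₀ + 1 - s)
      · rw [indicator_of_mem hu']
        have h2 : 0 ≤ u ^ (θ - 1) := Real.rpow_nonneg hu'.1.le _
        have h3 : 0 ≤ B := (norm_nonneg _).trans
          (hB (t₀ + 1) ⟨by linarith [hu'.1, hu'.2], le_rfl⟩)
        have := h.nonneg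
        positivity
      · rw [indicator_of_notMem hu']
  · refine IntegrableOn.integrable_indicator ?_ measurableSet_Ioc
    refine Integrable.mul_const (Integrable.const_mul (Integrable.add ?_ ?_) C) _
    · rcases le_or_gt 0 (t₀ + 1 - s) with h1 | h1
      · have := intervalIntegral.intervalIntegrable_rpow' (a := 0) (b := t₀ + 1 - s)
          (r := θ - 1) (by linarith [h.theta_pos])
        rwa [intervalIntegrable_iff_integrableOn_Ioc_of_le h1] at this
      · rw [Ioc_eq_empty (by linarith)]
        simp
    · exact integrableOn_const (by simp)
  · have : ∀ᵐ u : ℝ, u ≠ t₀ - s := by simp [ae_iff, measure_singleton]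
    filter_upwards [this] with u hu
    by_cases hs : 0 < u
    · rcases lt_or_gt_of_ne hu with h1 | h1
      · have h2 : ContinuousAt (fun t => E u (ψ (X (t - u)))) t₀ :=
          ((E u).continuous.comp (h.psi_cont.comp (hX.comp (by fun_prop)))).continuousAt
        refine h2.congr ?_
        filter_upwards [Ioi_mem_nhds (show u + s < t₀ by linarith)] with t ht
        have ht : u + s < t := ht
        rw [indicator_of_mem (show u ∈ Ioc 0 (t - s) from ⟨hs, by linarith⟩)]
      · refine continuousAt_const.congr (f := fun _ => (0 : H)) ?_
        filter_upwards [Iio_mem_nhds (show t₀ < u + s by linarith)] with t ht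
        have ht : t < u + s := ht
        rw [indicator_of_notMem (fun hm => by linarith [hm.2])]
    · refine continuousAt_const.congr (f := fun _ => (0 : H)) ?_
      filter_upwards with t
      rw [indicator_of_notMem (fun hm => hs hm.1)]

/-- The right-hand side of the mild equation is continuous. -/
theorem continuousOn_mild (hw : MemLp w 2 volume) {X : ℝ → H} (hX : Continuous X) (s : ℝ)
    (x : H) :
    ContinuousOn (fun t => U (t - s) x + ∫ r in Ioc s t, mildIntegrand U E ψ b w t r (X r))
      (Ici s) := by
  refine ContinuousOn.add ?_ ?_
  · exact h.continuousOn_U (by fun_prop) continuousOn_const fun t ht => sub_nonneg.2 ht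
  · refine ContinuousOn.congr ((h.continuousOn_integral_E hX s).add
      (h.continuous_integral_U (g := fun r => b (X r) (w r)) (s := s) fun t =>
        h.integrableOn_b hw hX.continuousOn).continuousOn) fun t _ => ?_
    exact h.integral_mildIntegrand hw hX.continuousOn

/-- Uniqueness for the mild equation. -/
theorem eqOn_of_solvesAt (hw : MemLp w 2 volume) {s T : ℝ} {x : H} {X Z : ℝ → H}
    (hX : ContinuousOn X (Icc s T)) (hZ : ContinuousOn Z (Icc s T))
    (hXs : ∀ t ∈ Icc s T, SolvesAt U E ψ b w s x X t)
    (hZs : ∀ t ∈ Icc s T, SolvesAt U E ψ b w s x Z t) : EqOn X Z (Icc s T) := by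
  obtain ⟨B, hB⟩ := isCompact_Icc.exists_bound_of_continuousOn (hX.sub hZ)
  intro t ht
  have key := eq_zero_of_le_volterra h.nonneg h.theta_pos hw (s := s) (T := T)
    (D := fun t => ‖X t - Z t‖ₑ) (b := ENNReal.ofReal B) ENNReal.ofReal_ne_top
    (fun t ht => by
      rw [← ofReal_norm]
      exact ENNReal.ofReal_le_ofReal (hB t ht)) (fun t ht => ?_) ht
  · exact sub_eq_zero.1 (enorm_eq_zero.1 key)
  · have hsub : Icc s t ⊆ Icc s T := Icc_subset_Icc_right ht.2
    have h1 : X t - Z t = ∫ r in Ioc s t,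
        (mildIntegrand U E ψ b w t r (X r) - mildIntegrand U E ψ b w t r (Z r)) := by
      rw [integral_sub (h.integrableOn_mildIntegrand hw (hX.mono hsub))
        (h.integrableOn_mildIntegrand hw (hZ.mono hsub)), hXs t ht, hZs t ht]
      abel
    rw [h1]
    refine (enorm_integral_le_lintegral_enorm _).trans ?_
    rw [← Measure.restrict_congr_set Ioo_ae_eq_Ioc]
    refine setLIntegral_mono' measurableSet_Ioo fun r hr => ?_
    rw [← ofReal_norm, ← ofReal_norm, ← ENNReal.ofReal_mul
      (volterraKernel_nonneg h.nonneg hr.2.le)]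
    exact ENNReal.ofReal_le_ofReal (h.norm_mildIntegrand_sub_le hr.2 _ _)

end VolterraData

end Volterra

end Skeleton

namespace Skeleton

/-! ### Existence and stability for the abstract mild equation. -/

section VolterraExistence

variable {H : Type*} [NormedAddCommGroup H] [InnerProductSpace ℝ H]
  {U E : ℝ → H →L[ℝ] H} {ψ : H → H} {b : H → H →L[ℝ] H} {C θ : ℝ} {w : ℝ → H}

open scoped BoundedContinuousFunction

theorem norm_integral_le_of_weight {μ : ℝ}
    (hμ : ∀ s t,
      IntegrableOn (fun r => volterraKernel C θ w t r * Real.exp (-(μ * (t - r)))) (Ioc s t) ∧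
      ∫ r in Ioc s t, volterraKernel C θ w t r * Real.exp (-(μ * (t - r))) ≤ 1 / 2)
    {s t m : ℝ} (hm : 0 ≤ m) {f : ℝ → H}
    (hf : ∀ r ∈ Ioo s t, ‖f r‖ ≤ volterraKernel C θ w t r * (Real.exp (μ * (r - s)) * m)) :
    ‖∫ r in Ioc s t, f r‖ ≤ 1 / 2 * (Real.exp (μ * (t - s)) * m) := by
  obtain ⟨h1, h2⟩ := hμ s t
  have h3 := norm_integral_le_of_norm_le (h1.mul_const (Real.exp (μ * (t - s)) * m)) (f := f) (by
    rw [← Measure.restrict_congr_set Ioo_ae_eq_Ioc]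
    filter_upwards [ae_restrict_mem measurableSet_Ioo] with r hr
    refine (hf r hr).trans (le_of_eq ?_)
    have : Real.exp (μ * (r - s)) = Real.exp (-(μ * (t - r))) * Real.exp (μ * (t - s)) := by
      rw [← Real.exp_add]; congr 1; ring
    rw [this]
    ring)
  rw [integral_mul_const] at h3
  exact h3.trans (mul_le_mul_of_nonneg_right h2 (by positivity))

namespace VolterraData

/-- Existence for the mild equation. -/
theorem exists_solution [CompleteSpace H] (h : VolterraData U E ψ b C θ) (hw : MemLp w 2 volume)
    (s : ℝ) (x : H) :
    ∃ X : ℝ → H, Continuous X ∧ ∀ t, s ≤ t → SolvesAt U E ψ b w s x X t := by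
  obtain ⟨μ, hμ0, hμ⟩ := exists_weight h.nonneg h.theta_pos hw
  -- The fixed point is sought as exp(μ(r-s)) times a bounded continuous function. In this norm the
  -- weighted kernel has mass at most 1/2, so a single contraction covers the whole half-line.
  let P : (ℝ →ᵇ H) → ℝ → H := fun Y r => Real.exp (μ * (r - s)) • Y r
  have hP : ∀ Y, Continuous (P Y) := fun Y =>
    (by fun_prop : Continuous fun r : ℝ => Real.exp (μ * (r - s))).smul Y.continuous
  have hPn : ∀ Y r, ‖P Y r‖ ≤ Real.exp (μ * (r - s)) * ‖Y‖ := fun Y r => by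
    simp only [P]
    rw [norm_smul, Real.norm_of_nonneg (Real.exp_pos _).le]
    exact mul_le_mul_of_nonneg_left (Y.norm_coe_le_norm r) (Real.exp_pos _).le
  let Φ : (ℝ →ᵇ H) → ℝ → H := fun Y t =>
    U (t - s) x + ∫ r in Ioc s t, mildIntegrand U E ψ b w t r (P Y r)
  let Ψ : (ℝ →ᵇ H) → ℝ → H := fun Y t =>
    Real.exp (-(μ * (max t s - s))) • Φ Y (max t s)
  have hΨc : ∀ Y, Continuous (Ψ Y) := by
    intro Y
    refine Continuous.smul (by fun_prop) ?_
    exact (h.continuousOn_mild hw (hP Y) s x).comp_continuous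
      (continuous_id.max continuous_const) fun t => mem_Ici.2 (le_max_right _ _)
  have hΨn : ∀ Y t, ‖Ψ Y t‖ ≤ ‖x‖ + 1 / 2 * (‖Y‖ + 1) := by
    intro Y t
    have ht : s ≤ max t s := le_max_right _ _
    set τ := max t s with hτ
    have h1 : ‖∫ r in Ioc s τ, mildIntegrand U E ψ b w τ r (P Y r)‖ ≤
        1 / 2 * (Real.exp (μ * (τ - s)) * (‖Y‖ + 1)) := by
      refine norm_integral_le_of_weight hμ (by positivity) fun r hr => ?_
      refine (h.norm_mildIntegrand_le hr.2 _).trans ?_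
      refine mul_le_mul_of_nonneg_left ?_ (volterraKernel_nonneg h.nonneg hr.2.le)
      have h2 : 1 ≤ Real.exp (μ * (r - s)) :=
        Real.one_le_exp (mul_nonneg hμ0.le (by linarith [hr.1]))
      have := hPn Y r
      linarith
    have h3 : ‖U (τ - s) x‖ ≤ ‖x‖ := h.U_norm _ (by linarith) x
    have he : Real.exp (-(μ * (τ - s))) ≤ 1 := Real.exp_le_one_iff.2 (by
      have := mul_nonneg hμ0.le (sub_nonneg.2 ht); linarith)
    have he2 : Real.exp (-(μ * (τ - s))) * Real.exp (μ * (τ - s)) = 1 := by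
      rw [← Real.exp_add]; simp
    have he0 := Real.exp_pos (-(μ * (τ - s)))
    simp only [Ψ, Φ]
    rw [norm_smul, Real.norm_of_nonneg he0.le]
    calc _ ≤ Real.exp (-(μ * (τ - s))) *
          (‖x‖ + 1 / 2 * (Real.exp (μ * (τ - s)) * (‖Y‖ + 1))) := by
          gcongr
          exact (norm_add_le _ _).trans (add_le_add h3 h1)
      _ = Real.exp (-(μ * (τ - s))) * ‖x‖ +
          1 / 2 * ((Real.exp (-(μ * (τ - s))) * Real.exp (μ * (τ - s))) * (‖Y‖ + 1)) := by ring
      _ ≤ _ := by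
          rw [he2, one_mul]
          gcongr
          exact mul_le_of_le_one_left (norm_nonneg _) he
  let Γ : (ℝ →ᵇ H) → (ℝ →ᵇ H) := fun Y =>
    BoundedContinuousFunction.ofNormedAddCommGroup (Ψ Y) (hΨc Y) _ (hΨn Y)
  have hΓ : ContractingWith (1 / 2) Γ := by
    refine ⟨by norm_num, LipschitzWith.of_dist_le_mul fun Y Z => ?_⟩
    rw [BoundedContinuousFunction.dist_le (by positivity)]
    intro t
    have ht : s ≤ max t s := le_max_right _ _
    simp only [Γ, BoundedContinuousFunction.coe_ofNormedAddCommGroup, Ψ, Φ]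
    set τ := max t s with hτ
    rw [dist_eq_norm, ← smul_sub, add_sub_add_left_eq_sub,
      ← integral_sub (h.integrableOn_mildIntegrand hw (hP Y).continuousOn)
        (h.integrableOn_mildIntegrand hw (hP Z).continuousOn), norm_smul,
      Real.norm_of_nonneg (Real.exp_pos _).le]
    have h1 : ‖∫ r in Ioc s τ, (mildIntegrand U E ψ b w τ r (P Y r) -
        mildIntegrand U E ψ b w τ r (P Z r))‖ ≤
        1 / 2 * (Real.exp (μ * (τ - s)) * dist Y Z) := by
      refine norm_integral_le_of_weight hμ dist_nonneg fun r hr => ?_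
      refine (h.norm_mildIntegrand_sub_le hr.2 _ _).trans ?_
      refine mul_le_mul_of_nonneg_left ?_ (volterraKernel_nonneg h.nonneg hr.2.le)
      simp only [P]
      rw [← smul_sub, norm_smul, Real.norm_of_nonneg (Real.exp_pos _).le, ← dist_eq_norm]
      exact mul_le_mul_of_nonneg_left (BoundedContinuousFunction.dist_coe_le_dist r)
        (Real.exp_pos _).le
    refine (mul_le_mul_of_nonneg_left h1 (Real.exp_pos _).le).trans (le_of_eq ?_)
    have he2 : Real.exp (-(μ * (τ - s))) * Real.exp (μ * (τ - s)) = 1 := by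
      rw [← Real.exp_add]; simp
    calc _ = 1 / 2 * ((Real.exp (-(μ * (τ - s))) * Real.exp (μ * (τ - s))) * dist Y Z) := by ring
      _ = _ := by rw [he2]; push_cast; ring
  have hfix := hΓ.fixedPoint_isFixedPt
  set Y := hΓ.fixedPoint with hY
  refine ⟨P Y, hP Y, fun t ht => ?_⟩
  have h1 : Y t = Ψ Y t := by
    conv_lhs => rw [← hfix]
    rfl
  rw [SolvesAt]
  calc P Y t = Real.exp (μ * (t - s)) • Y t := rfl
    _ = Φ Y t := by
      rw [h1]
      simp only [Ψ]
      rw [max_eq_left ht, smul_smul, ← Real.exp_add]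
      simp
    _ = _ := rfl

/-- The approximating equations evaluate the nonlinearity at a regularised argument; a linear
contraction fixes 0 and preserves the constants. -/
theorem comp_contraction (h : VolterraData U E ψ b C θ) {R : H →L[ℝ] H}
    (hR : ∀ x, ‖R x‖ ≤ ‖x‖) : VolterraData U E (fun x => ψ (R x)) b C θ where
  nonneg := h.nonneg
  theta_pos := h.theta_pos
  U_norm := h.U_norm
  U_cont := h.U_cont
  E_norm := h.E_norm
  E_cont := h.E_cont
  psi_cont := h.psi_cont.comp R.continuous
  E_lip t ht x y := by
    refine (h.E_lip t ht (R x) (R y)).trans ?_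
    have h1 := Real.rpow_nonneg ht.le (θ - 1)
    have := h.nonneg
    rw [← map_sub]
    gcongr
    exact hR _
  E_zero t ht := by
    rw [map_zero]
    exact h.E_zero t ht
  b_lip := h.b_lip
  b_bdd := h.b_bdd

open scoped ENNReal in
/-- Stability of the mild equation under strong convergence of the coefficients. -/
theorem tendsto_solution (h : VolterraData U E ψ b C θ) (hw : MemLp w 2 volume)
    (hwm : StronglyMeasurable w)
    {Un En : ℕ → ℝ → H →L[ℝ] H} {R : ℕ → H →L[ℝ] H} {wn : ℕ → ℝ → H}
    (hn : ∀ n, VolterraData (Un n) (En n) ψ b C θ) (hwn : ∀ n, MemLp (wn n) 2 volume)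
    (hR : ∀ n x, ‖R n x‖ ≤ ‖x‖)
    (hUlim : ∀ t, 0 ≤ t → ∀ x, Tendsto (fun n => Un n t x) atTop (𝓝 (U t x)))
    (hElim : ∀ t, 0 < t → ∀ x, Tendsto (fun n => En n t x) atTop (𝓝 (E t x)))
    (hRlim : ∀ x, Tendsto (fun n => R n x) atTop (𝓝 x))
    (hwlim : ∀ s t, Tendsto (fun n => ∫⁻ r in Ioc s t, ‖wn n r - w r‖ₑ) atTop (𝓝 0))
    {s T B : ℝ} {x : H} {X : ℝ → H} {Xn : ℕ → ℝ → H} (hX : Continuous X)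
    (hXn : ∀ n, Continuous (Xn n))
    (hXB : ∀ t ∈ Icc s T, ‖X t‖ ≤ B) (hXnB : ∀ n, ∀ t ∈ Icc s T, ‖Xn n t‖ ≤ B)
    (hXs : ∀ t ∈ Icc s T, SolvesAt U E ψ b w s x X t)
    (hXns : ∀ n, ∀ t ∈ Icc s T, SolvesAt (Un n) (En n) (fun x => ψ (R n x)) b (wn n) s x (Xn n) t)
    {t : ℝ} (ht : t ∈ Icc s T) : Tendsto (fun n => Xn n t) atTop (𝓝 (X t)) := by
  have hC := h.nonneg
  have hB : 0 ≤ B := (norm_nonneg _).trans (hXB t ht)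
  let d : ℕ → ℝ → ℝ≥0∞ := fun n t => ‖Xn n t - X t‖ₑ
  have hdm : ∀ n, Measurable (d n) := fun n =>
    ((hXn n).sub hX).enorm.measurable
  have hdB : ∀ n, ∀ t ∈ Icc s T, d n t ≤ ENNReal.ofReal (2 * B) := by
    intro n t ht
    simp only [d]
    rw [← ofReal_norm]
    refine ENNReal.ofReal_le_ofReal ((norm_sub_le _ _).trans ?_)
    linarith [hXB t ht, hXnB n t ht]
  let k : ℝ → ℝ → ℝ≥0∞ := fun t r => ENNReal.ofReal (volterraKernel C θ w t r)
  have hkm : ∀ t, Measurable (k t) := by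
    intro t
    have h1 : Measurable fun r => ‖w r‖ := hwm.norm.measurable
    have h2 : Measurable fun r : ℝ => (t - r) ^ (θ - 1) := by fun_prop
    exact (((h2.add_const 1).const_mul C).add (h1.const_mul C)).ennreal_ofReal
  have hkint : ∀ t, ∫⁻ r in Ioc s t, k t r ≠ ∞ := by
    intro t
    exact (integrableOn_volterraKernel hC h.theta_pos hw s t).lintegral_lt_top.ne
  -- The consistency error is evaluated along the limit path only, so strong convergence of the
  -- operators and dominated convergence are enough.
  let a : ℕ → ℝ → ℝ → ℝ := fun n t r => C * ((t - r) ^ (θ - 1) + 1) * ‖R n (X r) - X r‖ +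
    ‖En n (t - r) (ψ (X r)) - E (t - r) (ψ (X r))‖ +
    ‖Un n (t - r) (b (X r) (w r)) - U (t - r) (b (X r) (w r))‖
  have hab : ∀ n, ∀ t ∈ Icc s T, ∀ r ∈ Ioo s t,
      a n t r ≤ volterraKernel C θ w t r * (4 * B + 4) := by
    intro n t ht r hr
    have hr0 : 0 < t - r := sub_pos.2 hr.2
    have h1 : ‖R n (X r) - X r‖ ≤ 2 * B := by
      refine (norm_sub_le _ _).trans ?_
      have := hXB r ⟨hr.1.le, hr.2.le.trans ht.2⟩
      linarith [hR n (X r)]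
    have hp : 0 ≤ (t - r) ^ (θ - 1) := Real.rpow_nonneg hr0.le _
    have hXr := hXB r ⟨hr.1.le, hr.2.le.trans ht.2⟩
    have h2 : ‖En n (t - r) (ψ (X r)) - E (t - r) (ψ (X r))‖ ≤
        2 * (C * ((t - r) ^ (θ - 1) + 1) * (B + 1)) := by
      refine (norm_sub_le _ _).trans ?_
      have e1 := (hn n).norm_E_psi_le hr0 (X r)
      have e2 := h.norm_E_psi_le hr0 (X r)
      have e3 : C * ((t - r) ^ (θ - 1) + 1) * (‖X r‖ + 1) ≤
        C * ((t - r) ^ (θ - 1) + 1) * (B + 1) := by gcongr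
      linarith
    have h3 : ‖Un n (t - r) (b (X r) (w r)) - U (t - r) (b (X r) (w r))‖ ≤
        2 * (C * ‖w r‖) := by
      refine (norm_sub_le _ _).trans ?_
      have e1 := (hn n).norm_U_b_le hr0.le (X r) (w r)
      have e2 := h.norm_U_b_le hr0.le (X r) (w r)
      linarith
    have h4 : C * ((t - r) ^ (θ - 1) + 1) * ‖R n (X r) - X r‖ ≤
        C * ((t - r) ^ (θ - 1) + 1) * (2 * B) := by gcongr
    have h5 : 0 ≤ C * ‖w r‖ * B := by positivity
    have h6 : 0 ≤ C * ‖w r‖ := by positivity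
    have h7 : 0 ≤ C * ((t - r) ^ (θ - 1) + 1) := by positivity
    simp only [a, volterraKernel]
    nlinarith
  have halim : ∀ t ∈ Icc s T, Tendsto (fun n => ∫⁻ r in Ioo s t, ENNReal.ofReal (a n t r))
      atTop (𝓝 0) := by
    intro t ht
    have h0 : ∫⁻ r in Ioo s t, (0 : ℝ≥0∞) = 0 := by simp
    rw [← h0]
    refine tendsto_lintegral_of_dominated_convergence'
      (fun r => k t r * ENNReal.ofReal (4 * B + 4)) ?_ ?_ ?_ ?_
    · intro n
      have hsub : Ioo s t ⊆ Ioc s t := Ioo_subset_Ioc_self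
      have hm := Measure.restrict_mono_set (volume : Measure ℝ) hsub
      have e0 : AEStronglyMeasurable (fun r => C * ((t - r) ^ (θ - 1) + 1) * ‖R n (X r) - X r‖)
          (volume.restrict (Ioo s t)) := by
        have h2 : Measurable fun r : ℝ => C * ((t - r) ^ (θ - 1) + 1) := by fun_prop
        exact h2.aestronglyMeasurable.mul
          ((((R n).continuous.comp hX).sub hX).norm).aestronglyMeasurable
      have e1 := (((hn n).integrableOn_E (s := s) (t := t) hX.continuousOn).1.sub
        (h.integrableOn_E (s := s) (t := t) hX.continuousOn).1).norm.mono_measure hm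
      have e2 := (((hn n).integrableOn_U hw (s := s) (t := t) hX.continuousOn).1.sub
        (h.integrableOn_U hw (s := s) (t := t) hX.continuousOn).1).norm.mono_measure hm
      exact ((e0.add e1).add e2).aemeasurable.ennreal_ofReal
    · intro n
      filter_upwards [ae_restrict_mem measurableSet_Ioo] with r hr
      rw [← ENNReal.ofReal_mul (volterraKernel_nonneg hC hr.2.le)]
      exact ENNReal.ofReal_le_ofReal (hab n t ht r hr)
    · rw [lintegral_mul_const' _ _ ENNReal.ofReal_ne_top]
      refine ENNReal.mul_ne_top ?_ ENNReal.ofReal_ne_top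
      exact ne_top_of_le_ne_top (hkint t) (lintegral_mono_set Ioo_subset_Ioc_self)
    · filter_upwards [ae_restrict_mem measurableSet_Ioo] with r hr
      have hr0 : 0 < t - r := sub_pos.2 hr.2
      rw [← ENNReal.ofReal_zero]
      refine ENNReal.tendsto_ofReal ?_
      have e1 := (tendsto_iff_norm_sub_tendsto_zero.1 (hRlim (X r))).const_mul
        (C * ((t - r) ^ (θ - 1) + 1))
      have e2 := tendsto_iff_norm_sub_tendsto_zero.1 (hElim (t - r) hr0 (ψ (X r)))
      have e3 := tendsto_iff_norm_sub_tendsto_zero.1 (hUlim (t - r) hr0.le (b (X r) (w r)))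
      have e4 := (e1.add e2).add e3
      simpa using e4
  let η : ℕ → ℝ → ℝ≥0∞ := fun n t => ‖Un n (t - s) x - U (t - s) x‖ₑ +
    (∫⁻ r in Ioo s t, ENNReal.ofReal (a n t r)) +
    ENNReal.ofReal C * ∫⁻ r in Ioc s t, ‖wn n r - w r‖ₑ
  have hηlim : ∀ t ∈ Icc s T, Tendsto (fun n => η n t) atTop (𝓝 0) := by
    intro t ht
    have e1 : Tendsto (fun n => ‖Un n (t - s) x - U (t - s) x‖ₑ) atTop (𝓝 0) := by
      have := ((hUlim (t - s) (sub_nonneg.2 ht.1) x).sub_const (U (t - s) x)).enorm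
      simpa using this
    have e2 := ENNReal.Tendsto.const_mul (a := ENNReal.ofReal C) (hwlim s t)
      (Or.inr ENNReal.ofReal_ne_top)
    have := (e1.add (halim t ht)).add e2
    simpa using this
  have hmain : ∀ n, ∀ t ∈ Icc s T, d n t ≤ η n t + ∫⁻ r in Ioc s t, k t r * d n r := by
    intro n t ht
    have hn' := (hn n).comp_contraction (hR n)
    have h1 : Xn n t - X t = (Un n (t - s) x - U (t - s) x) + ∫ r in Ioc s t,
        (mildIntegrand (Un n) (En n) (fun x => ψ (R n x)) b (wn n) t r (Xn n r) -
          mildIntegrand U E ψ b w t r (X r)) := by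
      rw [integral_sub (hn'.integrableOn_mildIntegrand (hwn n) (hXn n).continuousOn)
        (h.integrableOn_mildIntegrand hw hX.continuousOn), hXns n t ht, hXs t ht]
      abel
    have h2 : ∀ r ∈ Ioo s t,
        ‖mildIntegrand (Un n) (En n) (fun x => ψ (R n x)) b (wn n) t r (Xn n r) -
          mildIntegrand U E ψ b w t r (X r)‖ₑ ≤
        ENNReal.ofReal (a n t r) + ENNReal.ofReal C * ‖wn n r - w r‖ₑ + k t r * d n r := by
      intro r hr
      have hr0 : 0 < t - r := sub_pos.2 hr.2
      have hp : 0 ≤ (t - r) ^ (θ - 1) := Real.rpow_nonneg hr0.le _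
      have e0 : mildIntegrand (Un n) (En n) (fun x => ψ (R n x)) b (wn n) t r (Xn n r) -
          mildIntegrand U E ψ b w t r (X r) =
          En n (t - r) (ψ (R n (Xn n r)) - ψ (X r)) +
          (En n (t - r) (ψ (X r)) - E (t - r) (ψ (X r))) +
          (Un n (t - r) (b (Xn n r) (wn n r - w r)) +
          Un n (t - r) ((b (Xn n r) - b (X r)) (w r)) +
          (Un n (t - r) (b (X r) (w r)) - U (t - r) (b (X r) (w r)))) := by
        simp only [mildIntegrand, map_sub, sub_apply]
        abel
      have e1 : ‖En n (t - r) (ψ (R n (Xn n r)) - ψ (X r))‖ ≤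
          C * ((t - r) ^ (θ - 1) + 1) * (‖Xn n r - X r‖ + ‖R n (X r) - X r‖) := by
        refine ((hn n).E_lip (t - r) hr0 _ _).trans ?_
        gcongr
        have : R n (Xn n r) - X r = R n (Xn n r - X r) + (R n (X r) - X r) := by
          rw [map_sub]; abel
        rw [this]
        exact (norm_add_le _ _).trans (add_le_add (hR n _) le_rfl)
      have e2 := (hn n).norm_U_b_le hr0.le (Xn n r) (wn n r - w r)
      have e3 : ‖Un n (t - r) ((b (Xn n r) - b (X r)) (w r))‖ ≤
          C * ‖Xn n r - X r‖ * ‖w r‖ :=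
        ((hn n).U_norm _ hr0.le _).trans
          ((b (Xn n r) - b (X r)).le_of_opNorm_le (h.b_lip _ _) _)
      have e4 : ‖mildIntegrand (Un n) (En n) (fun x => ψ (R n x)) b (wn n) t r (Xn n r) -
          mildIntegrand U E ψ b w t r (X r)‖ ≤ a n t r + C * ‖wn n r - w r‖ +
          volterraKernel C θ w t r * ‖Xn n r - X r‖ := by
        rw [e0]
        refine (norm_add_le _ _).trans ?_
        refine (add_le_add (norm_add_le _ _) (norm_add_le _ _)).trans ?_
        have e5 := norm_add_le (Un n (t - r) (b (Xn n r) (wn n r - w r)))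
          (Un n (t - r) ((b (Xn n r) - b (X r)) (w r)))
        simp only [a, volterraKernel]
        linarith
      have ha0 : 0 ≤ a n t r := by simp only [a]; positivity
      simp only [k, d]
      rw [← ofReal_norm, ← ofReal_norm, ← ofReal_norm, ← ENNReal.ofReal_mul hC,
        ← ENNReal.ofReal_mul (volterraKernel_nonneg hC hr.2.le), ← ENNReal.ofReal_add ha0
        (by positivity), ← ENNReal.ofReal_add (by positivity)
        (mul_nonneg (volterraKernel_nonneg hC hr.2.le) (norm_nonneg _))]
      exact ENNReal.ofReal_le_ofReal e4
    simp only [d, η]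
    rw [h1]
    refine (enorm_add_le _ _).trans ?_
    rw [add_assoc, add_assoc]
    refine add_le_add le_rfl ?_
    refine (enorm_integral_le_lintegral_enorm _).trans ?_
    rw [← Measure.restrict_congr_set Ioo_ae_eq_Ioc]
    refine (setLIntegral_mono' measurableSet_Ioo h2).trans ?_
    have hmw : AEMeasurable (fun r => ENNReal.ofReal C * ‖wn n r - w r‖ₑ)
        (volume.restrict (Ioo s t)) :=
      (((hwn n).1.sub hw.1).enorm.const_mul _).restrict
    have hmk : AEMeasurable (fun r => k t r * d n r) (volume.restrict (Ioo s t)) :=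
      ((hkm t).mul (hdm n)).aemeasurable
    rw [lintegral_add_right' _ hmk, lintegral_add_right' _ hmw,
      lintegral_const_mul' _ _ ENNReal.ofReal_ne_top, add_assoc]
  -- The reverse Fatou lemma passes the limsup inside the integral, and the homogeneous Gronwall
  -- lemma then forces it to vanish.
  let Dbar : ℝ → ℝ≥0∞ := fun t => limsup (fun n => d n t) atTop
  have hfinal := eq_zero_of_le_volterra hC h.theta_pos hw (s := s) (T := T) (D := Dbar)
    (b := ENNReal.ofReal (2 * B)) ENNReal.ofReal_ne_top
    (fun t ht => limsup_le_of_le (by isBoundedDefault) (Eventually.of_forall fun n => hdB n t ht))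
    (fun t ht => ?_) ht
  · have h1 : Tendsto (fun n => d n t) atTop (𝓝 0) :=
      tendsto_of_le_liminf_of_limsup_le bot_le hfinal.le
    rw [tendsto_iff_norm_sub_tendsto_zero]
    have h2 := (ENNReal.tendsto_toReal ENNReal.zero_ne_top).comp h1
    simpa [Function.comp_def, d] using h2
  · calc Dbar t ≤ limsup (fun n => η n t + ∫⁻ r in Ioc s t, k t r * d n r) atTop :=
        limsup_le_limsup (Eventually.of_forall fun n => hmain n t ht)
      _ = limsup (fun n => ∫⁻ r in Ioc s t, k t r * d n r) atTop :=
        ENNReal.limsup_add_of_left_tendsto_zero (hηlim t ht) _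
      _ ≤ ∫⁻ r in Ioc s t, limsup (fun n => k t r * d n r) atTop := by
        refine limsup_lintegral_le (fun r => k t r * ENNReal.ofReal (2 * B))
          (fun n => (hkm t).mul (hdm n)) (fun n => ?_) ?_
        · filter_upwards [ae_restrict_mem measurableSet_Ioc] with r hr
          exact mul_le_mul' le_rfl (hdB n r ⟨hr.1.le, hr.2.trans ht.2⟩)
        · rw [lintegral_mul_const' _ _ ENNReal.ofReal_ne_top]
          exact ENNReal.mul_ne_top (hkint t) ENNReal.ofReal_ne_top
      _ = ∫⁻ r in Ioc s t, ENNReal.ofReal (volterraKernel C θ w t r) * Dbar r := by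
        refine lintegral_congr fun r => ?_
        exact ENNReal.limsup_const_mul_of_ne_top ENNReal.ofReal_ne_top

end VolterraData

end VolterraExistence

end Skeleton

namespace Skeleton

/-! ### Energy inequalities for equations with bounded generator. -/

section EnergyODE

variable {H : Type*} [NormedAddCommGroup H] [InnerProductSpace ℝ H]

/-- A mild solution with bounded generator and continuous forcing is a classical solution. -/
theorem hasDerivAt_of_mild [CompleteSpace H] {G : H →L[ℝ] H} {f X : ℝ → H} (hf : Continuous f)
    {s : ℝ} {x : H}
    (hX : ∀ t, s ≤ t → X t = expSemigroup G (t - s) x +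
      ∫ r in Ioc s t, expSemigroup G (t - r) (f r)) {t : ℝ} (ht : s < t) :
    HasDerivAt X (G (X t) + f t) t := by
  -- For a bounded generator negative times are allowed, so exp((t-s)G) can be pulled out of the
  -- integral, whose integrand no longer depends on t.
  let g : ℝ → H := fun r => expSemigroup G (s - r) (f r)
  have hg : Continuous g :=
    ((continuous_expSemigroup G).comp (by fun_prop : Continuous fun r : ℝ => s - r)).clm_apply hf
  let Z : ℝ → H := fun t => expSemigroup G (t - s) (x + ∫ r in s..t, g r)
  have hZ : ∀ t, s ≤ t → X t = Z t := by
    intro t ht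
    simp only [Z]
    rw [hX t ht, map_add, intervalIntegral.integral_of_le ht,
      ← ContinuousLinearMap.integral_comp_comm]
    · congr 1
      refine integral_congr_ae (Eventually.of_forall fun r => ?_)
      have : t - r = (t - s) + (s - r) := by ring
      simp only [g]
      rw [this, expSemigroup_add]
      rfl
    · exact (hg.integrableOn_Icc).mono_set Ioc_subset_Icc_self
  have hev : X =ᶠ[𝓝 t] Z := by
    filter_upwards [Ioi_mem_nhds ht] with r hr
    exact hZ r (le_of_lt hr)
  have h1 : HasDerivAt (fun t => expSemigroup G (t - s)) (G * expSemigroup G (t - s)) t := by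
    have := (hasDerivAt_expSemigroup' G (t - s)).comp_sub_const t s
    exact this
  have h2 : HasDerivAt (fun t => x + ∫ r in s..t, g r) (g t) t :=
    (hg.integral_hasStrictDerivAt s t).hasDerivAt.const_add x
  have h3 := (h1.clm_apply h2).congr_of_eventuallyEq hev
  convert h3 using 1
  rw [hZ t ht.le]
  simp only [Z, g, mul_apply_eq_comp]
  congr 1
  have : expSemigroup G (t - s) (expSemigroup G (s - t) (f t)) =
      (expSemigroup G (t - s) * expSemigroup G (s - t)) (f t) := rfl
  rw [this, ← expSemigroup_add]
  simp

/-- Basic energy estimate for `X' = N(X) + b(X) w`. -/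
theorem energy_le {N : H → H} {b : H → H →L[ℝ] H} {w X : ℝ → H} {n : H → ℝ} {lam c D : ℝ}
    (hc : 0 < c) (hn : Continuous n)
    (hN : ∀ x, ⟪N x, x⟫ ≤ -(lam / 2) * n x - c * ‖x‖ ^ 2) (hb : ∀ x, ‖b x‖ ≤ D)
    (hw : Continuous w) (hXc : Continuous X) {s : ℝ}
    (hX : ∀ t, s < t → HasDerivAt X (N (X t) + b (X t) (w t)) t) {t : ℝ} (ht : s ≤ t) :
    ‖X t‖ ^ 2 + lam * ∫ r in s..t, n (X r) ≤
      ‖X s‖ ^ 2 + D ^ 2 / (2 * c) * ∫ r in s..t, ‖w r‖ ^ 2 := by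
  have hD : 0 ≤ D := (norm_nonneg _).trans (hb 0)
  let f : ℝ → ℝ := fun t => ‖X t‖ ^ 2 + lam * (∫ r in s..t, n (X r)) -
    D ^ 2 / (2 * c) * ∫ r in s..t, ‖w r‖ ^ 2
  have hnX : Continuous fun r => n (X r) := hn.comp hXc
  have hw2 : Continuous fun r => ‖w r‖ ^ 2 := hw.norm.pow 2
  have hd1 : ∀ t, HasDerivAt (fun t => ∫ r in s..t, n (X r)) (n (X t)) t := fun t =>
    (hnX.integral_hasStrictDerivAt s t).hasDerivAt
  have hd2 : ∀ t, HasDerivAt (fun t => ∫ r in s..t, ‖w r‖ ^ 2) (‖w t‖ ^ 2) t := fun t =>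
    (hw2.integral_hasStrictDerivAt s t).hasDerivAt
  have hd : ∀ t, s < t → HasDerivAt f (2 * ⟪X t, N (X t) + b (X t) (w t)⟫ + lam * n (X t) -
      D ^ 2 / (2 * c) * ‖w t‖ ^ 2) t := fun t ht =>
    (((hX t ht).norm_sq).add ((hd1 t).const_mul lam)).sub ((hd2 t).const_mul _)
  have hfc : Continuous f :=
    ((hXc.norm.pow 2).add ((continuous_iff_continuousAt.2
      fun t => (hd1 t).continuousAt).const_mul lam)).sub
      ((continuous_iff_continuousAt.2 fun t => (hd2 t).continuousAt).const_mul _)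
  have hanti : AntitoneOn f (Ici s) := by
    refine antitoneOn_of_deriv_nonpos (convex_Ici s) hfc.continuousOn ?_ ?_
    · rw [interior_Ici]
      exact fun t ht => (hd t ht).differentiableAt.differentiableWithinAt
    · rw [interior_Ici]
      intro t ht
      rw [(hd t ht).deriv, inner_add_right, real_inner_comm]
      have h1 := hN (X t)
      have h2 : ⟪X t, b (X t) (w t)⟫ ≤ ‖X t‖ * (D * ‖w t‖) :=
        (real_inner_le_norm _ _).trans
          (mul_le_mul_of_nonneg_left ((b (X t)).le_of_opNorm_le (hb _) _) (norm_nonneg _))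
      have h3 : 2 * (‖X t‖ * (D * ‖w t‖)) ≤ 2 * c * ‖X t‖ ^ 2 + D ^ 2 / (2 * c) * ‖w t‖ ^ 2 := by
        have h4 : 2 * c * ‖X t‖ ^ 2 + D ^ 2 / (2 * c) * ‖w t‖ ^ 2 - 2 * (‖X t‖ * (D * ‖w t‖)) =
            (2 * c * ‖X t‖ - D * ‖w t‖) ^ 2 / (2 * c) := by field_simp; ring
        have h5 : 0 ≤ (2 * c * ‖X t‖ - D * ‖w t‖) ^ 2 / (2 * c) := by positivity
        linarith
      linarith
  have := hanti self_mem_Ici ht ht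
  simp only [f, intervalIntegral.integral_same, mul_zero, add_zero, sub_zero] at this
  linarith

/-- Contraction estimate for two solutions of `X' = N(X) + b(X) w`. -/
theorem energy_sub_le {N : H → H} {b : H → H →L[ℝ] H} {w X Z : ℝ → H} {n : H → ℝ}
    {C₀ c β ρ : ℝ} (hc : 0 < c) (hn : Continuous n)
    (hN : ∀ x z, ‖x‖ ≤ ρ → ‖z‖ ≤ ρ →
      ⟪N x - N z, x - z⟫ ≤ -c * ‖x - z‖ ^ 2 + C₀ * ‖x - z‖ ^ 2 * n x)
    (hb : ∀ x z, ‖b x - b z‖ ≤ β * ‖x - z‖)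
    (hw : Continuous w) (hXc : Continuous X) (hZc : Continuous Z) {s : ℝ}
    (hX : ∀ t, s < t → HasDerivAt X (N (X t) + b (X t) (w t)) t)
    (hZ : ∀ t, s < t → HasDerivAt Z (N (Z t) + b (Z t) (w t)) t)
    (hXρ : ∀ t, s ≤ t → ‖X t‖ ≤ ρ) (hZρ : ∀ t, s ≤ t → ‖Z t‖ ≤ ρ) {t : ℝ} (ht : s ≤ t) :
    ‖X t - Z t‖ ^ 2 ≤ ‖X s - Z s‖ ^ 2 * Real.exp (-c * (t - s) +
      (2 * C₀ * (∫ r in s..t, n (X r)) + β ^ 2 / c * ∫ r in s..t, ‖w r‖ ^ 2)) := by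
  let e : ℝ → ℝ := fun t => c * (t - s) - (2 * C₀ * (∫ r in s..t, n (X r)) +
    β ^ 2 / c * ∫ r in s..t, ‖w r‖ ^ 2)
  have hnX : Continuous fun r => n (X r) := hn.comp hXc
  have hw2 : Continuous fun r => ‖w r‖ ^ 2 := hw.norm.pow 2
  have hd1 : ∀ t, HasDerivAt (fun t => ∫ r in s..t, n (X r)) (n (X t)) t := fun t =>
    (hnX.integral_hasStrictDerivAt s t).hasDerivAt
  have hd2 : ∀ t, HasDerivAt (fun t => ∫ r in s..t, ‖w r‖ ^ 2) (‖w t‖ ^ 2) t := fun t =>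
    (hw2.integral_hasStrictDerivAt s t).hasDerivAt
  have he : ∀ t, HasDerivAt e (c - (2 * C₀ * n (X t) + β ^ 2 / c * ‖w t‖ ^ 2)) t := fun t => by
    have h1 : HasDerivAt (fun t : ℝ => c * (t - s)) c t := by
      simpa using ((hasDerivAt_id t).sub_const s).const_mul c
    exact h1.sub (((hd1 t).const_mul _).add ((hd2 t).const_mul _))
  let f : ℝ → ℝ := fun t => ‖X t - Z t‖ ^ 2 * Real.exp (e t)
  have hd : ∀ t, s < t → HasDerivAt f
      (2 * ⟪X t - Z t, N (X t) + b (X t) (w t) - (N (Z t) + b (Z t) (w t))⟫ * Real.exp (e t) +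
      ‖X t - Z t‖ ^ 2 * (Real.exp (e t) *
        (c - (2 * C₀ * n (X t) + β ^ 2 / c * ‖w t‖ ^ 2)))) t := fun t ht =>
    (((hX t ht).sub (hZ t ht)).norm_sq).mul (he t).exp
  have hec : Continuous e := continuous_iff_continuousAt.2 fun t => (he t).continuousAt
  have hfc : Continuous f := ((hXc.sub hZc).norm.pow 2).mul (Real.continuous_exp.comp hec)
  have hanti : AntitoneOn f (Ici s) := by
    refine antitoneOn_of_deriv_nonpos (convex_Ici s) hfc.continuousOn ?_ ?_
    · rw [interior_Ici]
      exact fun t ht => (hd t ht).differentiableAt.differentiableWithinAt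
    · rw [interior_Ici]
      intro t ht
      have ht' : s ≤ t := le_of_lt ht
      rw [(hd t ht).deriv]
      have h1 := hN (X t) (Z t) (hXρ t ht') (hZρ t ht')
      have h0 : N (X t) + b (X t) (w t) - (N (Z t) + b (Z t) (w t)) =
          (N (X t) - N (Z t)) + (b (X t) - b (Z t)) (w t) := by
        rw [sub_apply]; abel
      have h2 : ⟪X t - Z t, (b (X t) - b (Z t)) (w t)⟫ ≤
          ‖X t - Z t‖ * (β * ‖X t - Z t‖ * ‖w t‖) :=
        (real_inner_le_norm _ _).trans
          (mul_le_mul_of_nonneg_left ((b (X t) - b (Z t)).le_of_opNorm_le (hb _ _) _)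
            (norm_nonneg _))
      -- Of the dissipation 2c, one c pays for the control term and the other remains as the decay
      -- rate.
      have h3 : 2 * (β * ‖w t‖) ≤ c + β ^ 2 / c * ‖w t‖ ^ 2 := by
        have h4 : c + β ^ 2 / c * ‖w t‖ ^ 2 - 2 * (β * ‖w t‖) = (c - β * ‖w t‖) ^ 2 / c := by
          field_simp; ring
        have h5 : 0 ≤ (c - β * ‖w t‖) ^ 2 / c := by positivity
        linarith
      have h6 := mul_le_mul_of_nonneg_left h3 (sq_nonneg ‖X t - Z t‖)
      rw [h0, inner_add_right, real_inner_comm]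
      have h7 : 2 * (⟪N (X t) - N (Z t), X t - Z t⟫ + ⟪X t - Z t, (b (X t) - b (Z t)) (w t)⟫) +
          ‖X t - Z t‖ ^ 2 * (c - (2 * C₀ * n (X t) + β ^ 2 / c * ‖w t‖ ^ 2)) ≤ 0 := by
        linarith
      have h8 := mul_nonpos_of_nonneg_of_nonpos (Real.exp_pos (e t)).le h7
      linarith
  have h := hanti self_mem_Ici ht ht
  simp only [f, e, intervalIntegral.integral_same, mul_zero, add_zero, sub_self,
    Real.exp_zero, mul_one] at h
  have h9 : -c * (t - s) + (2 * C₀ * (∫ r in s..t, n (X r)) + β ^ 2 / c * ∫ r in s..t, ‖w r‖ ^ 2)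
      = -e t := by simp only [e]; ring
  rw [h9, Real.exp_neg, ← div_eq_mul_inv, le_div_iff₀ (Real.exp_pos _)]
  exact h

end EnergyODE

/-! ### Coercivity and monotonicity of the approximate drift. -/

section EnergyForm

variable {V H : Type*} [NormedAddCommGroup V] [NormedSpace ℝ V]
  [NormedAddCommGroup H] [InnerProductSpace ℝ H] [CompleteSpace H]
  {i : V →L[ℝ] H} {A : V →L[ℝ] StrongDual ℝ V} {κ κ' : H →L[ℝ] V}

/-- The drift of the approximating equation. -/
noncomputable def approxDrift (K : H →L[ℝ] H) (ψ : H → H) (ε : ℝ) (x : H) : H :=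
  approxGen K ε x + yosida K ε (ψ (regularize K ε x))

variable (hκ : IsSolutionOperators i A κ κ') {lam C₀ : ℝ} (hlam : 0 < lam)
  (hA : ∀ u, A u u ≤ -lam * ‖u‖ ^ 2) {ε : ℝ} (hε : 0 < ε) {F : V → H} {φ : H → H}
  (hφ : ∀ u, φ (i u) = i (κ (F u)))

include hκ hlam hA hε

/-- K and (K + ε)⁻¹ commute, and the adjoint of their product is the regularisation. So F at a
regularised vector is tested against a regularised vector of `V`, exactly as in the hypotheses. -/
theorem inner_yosida_range (z x : H) :
    ⟪yosida (i ∘L κ) ε (i (κ z)), x⟫ = ⟪z, i (regularizeV i κ κ' ε x)⟫ := by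
  have hK := hκ.inner_nonneg hlam hA
  rw [regularizeV_spec hκ hlam hA hε, regularize, ContinuousLinearMap.adjoint_inner_right,
    mul_yosida_eq hK hε, ← yosida_mul_eq hK hε]
  rfl

include hφ

/-- Truncation replaces F(u) by F(σu) with 0 < σ ≤ 1. Coercivity of A + F at σu, divided by σ,
covers σ A(u)(u) + ⟪F(σu), i u⟫; coercivity of `A` alone covers the remaining fraction 1 - σ. Half
of the resulting λ‖u‖² is spent on the decay in `H`. -/
theorem inner_approxDrift_le (hAF : ∀ u, A u u + ⟪F u, i u⟫ ≤ -lam * ‖u‖ ^ 2) (hε1 : ε ≤ 1)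
    {ρ : ℝ} (hρ : 0 < ρ) (x : H) :
    ⟪approxDrift (i ∘L κ) (fun x => φ (trunc ρ x)) ε x, x⟫ ≤
      -(lam / 2) * ‖regularizeV i κ κ' ε x‖ ^ 2 - decayRate i lam * ‖x‖ ^ 2 := by
  have h1 := approxGen_coercive hκ hlam hA hε hε1 x
  set u := regularizeV i κ κ' ε x with hu
  set σ := ρ / max ρ ‖i u‖
  have hσ0 : 0 < σ := div_max_pos hρ _
  have hσ1 : σ ≤ 1 := div_max_le_one hρ _
  have h2 : φ (trunc ρ (regularize (i ∘L κ) ε x)) = i (κ (F (σ • u))) := by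
    rw [← regularizeV_spec hκ hlam hA hε, ← hu, trunc, ← map_smul, hφ]
  rw [approxDrift, inner_add_left, inner_approxGen hκ hlam hA hε]
  simp only [h2]
  rw [inner_yosida_range hκ hlam hA hε, ← hu]
  have h3 := hAF (σ • u)
  simp only [map_smul, smul_apply, real_inner_smul_right, norm_smul, Real.norm_of_nonneg hσ0.le,
    smul_eq_mul] at h3
  have h4 : σ * A u u + ⟪F (σ • u), i u⟫ ≤ -lam * (σ * ‖u‖ ^ 2) := by
    have : σ * (σ * A u u + ⟪F (σ • u), i u⟫) ≤ σ * (-lam * (σ * ‖u‖ ^ 2)) := by linarith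
    exact le_of_mul_le_mul_left this hσ0
  have h5 := mul_le_mul_of_nonneg_left (hA u) (sub_nonneg.2 hσ1)
  rw [← decayRate] at h1
  linarith

/-- Inside the ball the truncation is inactive, since the regularisation is a contraction, and local
monotonicity applies to the lifts into `V`. -/
theorem inner_approxDrift_sub_le
    (hmon : ∀ u v : V, (A u - A v) (u - v) + ⟪F u - F v, i (u - v)⟫ ≤
      -lam * ‖u - v‖ ^ 2 + C₀ * ‖i (u - v)‖ ^ 2 * ‖u‖ ^ 2) (hC₀ : 0 ≤ C₀) (hε1 : ε ≤ 1)
    {ρ : ℝ} (hρ : 0 < ρ) {x z : H} (hx : ‖x‖ ≤ ρ) (hz : ‖z‖ ≤ ρ) :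
    ⟪approxDrift (i ∘L κ) (fun x => φ (trunc ρ x)) ε x -
      approxDrift (i ∘L κ) (fun x => φ (trunc ρ x)) ε z, x - z⟫ ≤
      -decayRate i lam * ‖x - z‖ ^ 2 +
        C₀ * ‖x - z‖ ^ 2 * ‖regularizeV i κ κ' ε x‖ ^ 2 := by
  have hK := hκ.inner_nonneg hlam hA
  have h1 := approxGen_coercive hκ hlam hA hε hε1 (x - z)
  have h2 : ∀ x : H, ‖x‖ ≤ ρ → φ (trunc ρ (regularize (i ∘L κ) ε x)) =
      i (κ (F (regularizeV i κ κ' ε x))) := by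
    intro x hx
    rw [trunc_of_norm_le hρ ((norm_regularize_apply_le hK hε x).trans hx),
      ← regularizeV_spec hκ hlam hA hε, hφ]
  have h3 := inner_approxGen hκ hlam hA hε (x - z) (x - z)
  have h4 := hmon (regularizeV i κ κ' ε x) (regularizeV i κ κ' ε z)
  rw [← map_sub A, ← map_sub (regularizeV i κ κ' ε)] at h4
  have h5 : ⟪approxDrift (i ∘L κ) (fun x => φ (trunc ρ x)) ε x -
      approxDrift (i ∘L κ) (fun x => φ (trunc ρ x)) ε z, x - z⟫ =
      ⟪approxGen (i ∘L κ) ε (x - z), x - z⟫ +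
      ⟪F (regularizeV i κ κ' ε x) - F (regularizeV i κ κ' ε z),
        i (regularizeV i κ κ' ε (x - z))⟫ := by
    simp only [approxDrift]
    rw [h2 x hx, h2 z hz, ← inner_yosida_range hκ hlam hA hε]
    simp only [map_sub, ← inner_add_left]
    congr 1
    abel
  have h6 : ‖i (regularizeV i κ κ' ε (x - z))‖ ≤ ‖x - z‖ := by
    rw [regularizeV_spec hκ hlam hA hε]
    exact norm_regularize_apply_le hK hε _
  have h7 : C₀ * ‖i (regularizeV i κ κ' ε (x - z))‖ ^ 2 * ‖regularizeV i κ κ' ε x‖ ^ 2 ≤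
      C₀ * ‖x - z‖ ^ 2 * ‖regularizeV i κ κ' ε x‖ ^ 2 := by gcongr
  rw [h5, h3]
  rw [← decayRate] at h1
  have h8 : 0 ≤ lam / 2 * ‖regularizeV i κ κ' ε (x - z)‖ ^ 2 := by positivity
  linarith

end EnergyForm

end Skeleton

namespace Skeleton

/-! ### Transfer of the hypotheses to coefficients defined on `H`. -/

section Framework

variable {V H : Type*} [NormedAddCommGroup V] [NormedSpace ℝ V]
  [NormedAddCommGroup H] [InnerProductSpace ℝ H] [CompleteSpace H]

/-- The operators and extended coefficients used to study the skeleton equation on `H`: `κ`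
inverts `-A`, `E t` extends `S t (i κ)⁻¹`, `φ` extends `i κ F` and `b` extends `B`. -/
structure Framework (i : V →L[ℝ] H) (A : V →L[ℝ] StrongDual ℝ V) (F : V → H)
    (B : V → H →L[ℝ] H) (S : ℝ → H →L[ℝ] H) (κ κ' : H →L[ℝ] V) (E : ℝ → H →L[ℝ] H)
    (φ : H → H) (b : H → H →L[ℝ] H) (lam C₀ β D : ℝ) : Prop where
  gelfand : IsGelfandTriple i
  semigroup : IsSemigroupOf i A S
  solution : IsSolutionOperators i A κ κ'
  lam_pos : 0 < lam
  C₀_nonneg : 0 ≤ C₀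
  coercive : ∀ u, A u u ≤ -lam * ‖u‖ ^ 2
  coercive_add : ∀ u, A u u + ⟪F u, i u⟫ ≤ -lam * ‖u‖ ^ 2
  monotone : ∀ u v : V, (A u - A v) (u - v) + ⟪F u - F v, i (u - v)⟫ ≤
      -lam * ‖u - v‖ ^ 2 + C₀ * ‖i (u - v)‖ ^ 2 * ‖u‖ ^ 2
  E_lim : ∀ t, 0 < t → ∀ z,
    Tendsto (fun ε => expSemigroup (approxGen (i ∘L κ) ε) t (yosida (i ∘L κ) ε z))
      (𝓝[>] 0) (𝓝 (E t z))
  E_norm : ∀ t, 0 < t → ∀ z, ‖E t z‖ ≤ max ‖A‖ 1 / min lam 1 / t * ‖z‖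
  E_range : ∀ t, 0 < t → ∀ z, E t (i (κ z)) = S t z
  phi_cont : Continuous φ
  phi_range : ∀ u, φ (i u) = i (κ (F u))
  phi_holder : ∀ ρ : ℝ, ∃ L θ : ℝ, 0 ≤ L ∧ 0 < θ ∧ ∀ x y, ‖x‖ ≤ ρ → ‖y‖ ≤ ρ → ∀ τ, 0 < τ →
    τ ≤ 1 → ‖φ x - φ y - S τ (φ x - φ y)‖ ≤ L * ‖x - y‖ * τ ^ θ
  b_range : ∀ u, b (i u) = B u
  b_lip : ∀ x y, ‖b x - b y‖ ≤ β * ‖x - y‖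
  b_bdd : ∀ x, ‖b x‖ ≤ D

theorem holder_of_smoothing {i : V →L[ℝ] H} {A : V →L[ℝ] StrongDual ℝ V} {F : V → H}
    {S : ℝ → H →L[ℝ] H} {κ κ' : H →L[ℝ] V} (hS : IsSemigroupOf i A S)
    (hκ : IsSolutionOperators i A κ κ')
    (hF : ∀ (N : ℕ) (ρ : ℝ), ∃ C α : ℝ, 0 < C ∧ -1 < α ∧ α < 0 ∧
      ∀ t₀ t : ℝ, 0 ≤ t₀ → t₀ < t → t ≤ N → ∀ u v : V, ‖i u‖ ≤ ρ → ‖i v‖ ≤ ρ →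
        ‖∫ s in t₀..t, S s (F u - F v)‖ ^ 2 ≤ C * ∫ s in t₀..t, s ^ α * ‖i (u - v)‖ ^ 2)
    (ρ : ℝ) : ∃ L θ : ℝ, 0 ≤ L ∧ 0 < θ ∧ ∀ u v, ‖i u‖ ≤ ρ → ‖i v‖ ≤ ρ → ∀ τ, 0 < τ → τ ≤ 1 →
      ‖i (κ (F u)) - i (κ (F v)) - S τ (i (κ (F u)) - i (κ (F v)))‖ ≤
        L * ‖i u - i v‖ * τ ^ θ := by
  obtain ⟨C, α, hC, hα, -, h⟩ := hF 1 ρ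
  have hα1 : 0 < α + 1 := by linarith
  -- The hypothesis bounds the squared norm by C τ^(α+1)/(α+1) times ‖i u - i v‖², so constant and
  -- exponent come from a square root; α > -1 makes the exponent positive.
  refine ⟨√(C / (α + 1)), (α + 1) / 2, Real.sqrt_nonneg _, by linarith, ?_⟩
  intro u v hu hv τ hτ hτ1
  have h1 := h 0 τ le_rfl hτ (by simpa using hτ1) u v hu hv
  rw [semigroup_integral hS hκ _ hτ.le, intervalIntegral.integral_mul_const,
    integral_rpow (Or.inl hα), Real.zero_rpow hα1.ne', sub_zero, map_sub, map_sub, map_sub] at h1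
  refine le_of_sq_le_sq ?_ (by positivity)
  rw [map_sub (S τ)]
  refine h1.trans (le_of_eq ?_)
  have h2 : (τ ^ ((α + 1) / 2)) ^ 2 = τ ^ (α + 1) := by
    rw [← Real.rpow_natCast, ← Real.rpow_mul hτ.le]
    congr 1
    push_cast
    ring
  rw [mul_pow, mul_pow, h2, Real.sq_sqrt (by positivity), ← map_sub i]
  ring

/-- By exponential decay S(1) is a strict contraction, so 1 - S(1) is bounded below. The Hölder
bound at τ = 1 thereby becomes a local Lipschitz bound for K F. -/
theorem lipschitz_of_holder {i : V →L[ℝ] H} {A : V →L[ℝ] StrongDual ℝ V}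
    {S : ℝ → H →L[ℝ] H} {κ κ' : H →L[ℝ] V} (hi : IsGelfandTriple i) (hS : IsSemigroupOf i A S)
    (hκ : IsSolutionOperators i A κ κ') {lam : ℝ} (hlam : 0 < lam)
    (hA : ∀ u, A u u ≤ -lam * ‖u‖ ^ 2) {z : H} {a : ℝ} (h : ‖z - S 1 z‖ ≤ a) :
    ‖z‖ ≤ (1 - Real.exp (-decayRate i lam))⁻¹ * a := by
  have h1 := norm_semigroup_apply_le hS hκ hi hlam hA zero_le_one z
  have h2 : Real.exp (-decayRate i lam) < 1 := Real.exp_lt_one_iff.2 (by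
    have := decayRate_pos i hlam; linarith)
  rw [mul_one] at h1
  have h3 : ‖z‖ ≤ ‖z - S 1 z‖ + ‖S 1 z‖ := by
    simpa using norm_add_le (z - S 1 z) (S 1 z)
  rw [inv_mul_eq_div, le_div_iff₀ (by linarith)]
  linarith

theorem exists_framework [CompleteSpace V] {i : V →L[ℝ] H} (hi : IsGelfandTriple i)
    {A : V →L[ℝ] StrongDual ℝ V} {F : V → H} {B : V → H →L[ℝ] H} {S : ℝ → H →L[ℝ] H}
    (hS : IsSemigroupOf i A S) (hyp : Hypotheses i A F B S) :
    ∃ κ κ' E φ b lam C₀ β D, Framework i A F B S κ κ' E φ b lam C₀ β D := by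
  obtain ⟨lam, C₀, hlam, hC₀, hmon, hAF, hA⟩ := hyp.monotone_coercive
  obtain ⟨β, D, hβ, hD, hBl, hBb⟩ := hyp.lipschitz_bounded
  obtain ⟨κ, κ', hκ⟩ := exists_isSolutionOperators hi hlam hA
  obtain ⟨E, hE⟩ := exists_singular_operators hS hκ hi hlam hA
  have hhol := holder_of_smoothing hS hκ hyp.smoothing
  obtain ⟨φ, hφc, hφ⟩ := exists_extension_of_locally_lipschitz hi.dense
    (f := fun u => i (κ (F u))) (fun ρ => by
      obtain ⟨L, θ, hL, hθ, h⟩ := hhol ρ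
      refine ⟨(1 - Real.exp (-decayRate i lam))⁻¹ * L, fun u w hu hw => ?_⟩
      have := lipschitz_of_holder hi hS hκ hlam hA (h u w hu hw 1 one_pos le_rfl)
      rw [Real.one_rpow, mul_one, ← mul_assoc] at this
      exact this)
  obtain ⟨b, hbc, hb⟩ := exists_extension_of_locally_lipschitz hi.dense (f := B) (fun ρ =>
    ⟨β, fun u w _ _ => by rw [← map_sub]; exact hBl u w⟩)
  refine ⟨κ, κ', E, φ, b, lam, C₀, β, D, hi, hS, hκ, hlam, hC₀.le, hA, hAF, hmon,
    fun t ht => (hE t ht).1, fun t ht => (hE t ht).2.1, fun t ht => (hE t ht).2.2, hφc, hφ,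
    ?_, hb, ?_, ?_⟩
  · intro ρ
    -- Approximants in `V` of a vector of norm ρ may leave the ball of radius ρ; radius ρ + 1 leaves
    -- room.
    obtain ⟨L, θ, hL, hθ, h⟩ := hhol (ρ + 1)
    refine ⟨L, θ, hL, hθ, fun x y hx hy τ hτ hτ1 => ?_⟩
    have happrox : ∀ x : H, ‖x‖ ≤ ρ → ∃ u : ℕ → V, Tendsto (fun n => i (u n)) atTop (𝓝 x) ∧
        ∀ᶠ n in atTop, ‖i (u n)‖ ≤ ρ + 1 := by
      intro x hx
      obtain ⟨y, hy, hlim⟩ := mem_closure_iff_seq_limit.1 (hi.dense x)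
      choose u hu using hy
      have hlim' : Tendsto (fun n => i (u n)) atTop (𝓝 x) := by simpa only [hu] using hlim
      refine ⟨u, hlim', ?_⟩
      filter_upwards [hlim'.norm.eventually (gt_mem_nhds (show ‖x‖ < ρ + 1 by linarith))]
        with n hn using hn.le
    obtain ⟨u, hu, hub⟩ := happrox x hx
    obtain ⟨v, hv, hvb⟩ := happrox y hy
    have h1 : Tendsto (fun n => φ (i (u n)) - φ (i (v n))) atTop (𝓝 (φ x - φ y)) :=
      ((hφc.tendsto x).comp hu).sub ((hφc.tendsto y).comp hv)
    have h2 := (h1.sub (((S τ).continuous.tendsto _).comp h1)).norm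
    refine le_of_tendsto_of_tendsto h2 (((hu.sub hv).norm.const_mul L).mul_const (τ ^ θ)) ?_
    filter_upwards [hub, hvb] with n hn1 hn2
    simp only [Function.comp_apply, hφ]
    exact h (u n) (v n) hn1 hn2 τ hτ hτ1
  · intro x y
    refine hi.dense.induction_on₂ (p := fun x y => ‖b x - b y‖ ≤ β * ‖x - y‖) ?_ ?_ x y
    · exact isClosed_le (by fun_prop) (by fun_prop)
    · intro u w
      rw [hb, hb, ← map_sub]
      exact hBl u w
  · intro x
    refine hi.dense.induction_on (p := fun x => ‖b x‖ ≤ D) x ?_ ?_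
    · exact isClosed_le (by fun_prop) (by fun_prop)
    · intro u
      rw [hb]
      exact hBb u

namespace Framework

variable {i : V →L[ℝ] H} {A : V →L[ℝ] StrongDual ℝ V} {F : V → H} {B : V → H →L[ℝ] H}
  {S : ℝ → H →L[ℝ] H} {κ κ' : H →L[ℝ] V} {E : ℝ → H →L[ℝ] H} {φ : H → H}
  {b : H → H →L[ℝ] H} {lam C₀ β D : ℝ} (h : Framework i A F B S κ κ' E φ b lam C₀ β D)

include h

theorem D_nonneg : 0 ≤ D := (norm_nonneg _).trans (h.b_bdd 0)

theorem inner_nonneg (z : H) : 0 ≤ ⟪(i ∘L κ) z, z⟫ := h.solution.inner_nonneg h.lam_pos h.coercive z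

theorem phi_zero : φ 0 = i (κ (F 0)) := by rw [← h.phi_range, map_zero]

/-- The truncated equation and its approximations satisfy the assumptions of the abstract
theory, uniformly. -/
theorem exists_volterraData {ρ : ℝ} (hρ : 0 < ρ) : ∃ C θ,
    VolterraData S E (fun x => φ (trunc ρ x)) b C θ ∧
    ∀ ε, 0 < ε → ε ≤ 1 → VolterraData (expSemigroup (approxGen (i ∘L κ) ε))
      (fun t => expSemigroup (approxGen (i ∘L κ) ε) t ∘L yosida (i ∘L κ) ε)
      (fun x => φ (trunc ρ x)) b C θ := by
  obtain ⟨L, θ, hL, hθ, hhol⟩ := h.phi_holder ρ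
  have hl0 : 0 < min lam 1 := lt_min h.lam_pos one_pos
  set Γ := max ‖A‖ 1 / min lam 1 with hΓdef
  have hΓ : 0 ≤ Γ := by positivity
  have hD := h.D_nonneg
  have hd := h.solution.denseRange h.gelfand
  set C := Γ + (Γ + 1) * (2 * L) + ‖F 0‖ + |β| + D with hCdef
  have hC1 : 0 ≤ (Γ + 1) * (2 * L) := by positivity
  have hC2 := abs_nonneg β
  have hC3 := norm_nonneg (F 0)
  have hcont : Continuous fun x : H => φ (trunc ρ x) := by
    refine h.phi_cont.comp ?_
    exact (LipschitzWith.of_dist_le_mul (K := 2) fun x y => by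
      rw [dist_eq_norm, dist_eq_norm]; exact norm_trunc_sub_le hρ x y).continuous
  -- Only bounds shared by the semigroup and all its approximants enter, so `C` and `θ` do not
  -- depend on ε.
  have key : ∀ (U E' : ℝ → H →L[ℝ] H), (∀ t, 0 ≤ t → ∀ x, ‖U t x‖ ≤ ‖x‖) →
      (∀ x, ContinuousOn (fun t => U t x) (Ici 0)) →
      (∀ t, 0 < t → ∀ x, ‖E' t x‖ ≤ Γ / t * ‖x‖) →
      (∀ t, 0 < t → ∀ x, ‖E' t (i (κ x))‖ ≤ ‖x‖) →
      (∀ x, ContinuousOn (fun t => E' t x) (Ioi 0)) →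
      VolterraData U E' (fun x => φ (trunc ρ x)) b C θ := by
    intro U E' h1 h2 h3 h4 h5
    refine ⟨by positivity, hθ, h1, h2, ?_, h5, hcont, ?_, ?_, ?_, ?_⟩
    · intro t ht x
      refine (h3 t ht x).trans ?_
      gcongr
      linarith
    · intro t ht x y
      have h6 := norm_apply_le_of_holder h.semigroup h.solution h.lam_pos h.coercive hΓ ht
        (h3 t ht) (h4 t ht) (D := L * ‖trunc ρ x - trunc ρ y‖) (by positivity) hθ
        (hhol (trunc ρ x) (trunc ρ y) (norm_trunc_le hρ x) (norm_trunc_le hρ y))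
      have h7 := norm_trunc_sub_le hρ x y
      have h8 : 0 ≤ t ^ (θ - 1) := Real.rpow_nonneg ht.le _
      calc ‖E' t (φ (trunc ρ x) - φ (trunc ρ y))‖ ≤ _ := h6
        _ ≤ (Γ + 1) * (L * (2 * ‖x - y‖)) * (t ^ (θ - 1) + 1) := by gcongr
        _ = (Γ + 1) * (2 * L) * (t ^ (θ - 1) + 1) * ‖x - y‖ := by ring
        _ ≤ C * (t ^ (θ - 1) + 1) * ‖x - y‖ := by gcongr; linarith
    · intro t ht
      have : trunc ρ (0 : H) = 0 := smul_zero _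
      rw [this, h.phi_zero]
      refine (h4 t ht _).trans ?_
      linarith
    · intro x y
      refine (h.b_lip x y).trans ?_
      gcongr
      linarith [le_abs_self β]
    · intro x
      refine (h.b_bdd x).trans ?_
      linarith
  refine ⟨C, θ, key S E ?_ h.semigroup.continuousOn h.E_norm ?_ ?_, fun ε hε hε1 => key _ _ ?_ ?_ ?_
    ?_ ?_⟩
  · exact fun t ht x => norm_semigroup_apply_le_one h.semigroup h.solution h.gelfand h.lam_pos
      h.coercive ht x
  · intro t ht x
    rw [h.E_range t ht]
    exact norm_semigroup_apply_le_one h.semigroup h.solution h.gelfand h.lam_pos h.coercive ht.le x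
  · exact continuousOn_singular h.semigroup hd h.E_range
  · exact fun t ht x => norm_expSemigroup_approx_le_one h.solution h.lam_pos h.coercive hε hε1 ht x
  · exact fun x => ((continuous_expSemigroup _).clm_apply continuous_const).continuousOn
  · exact fun t ht x => norm_expSemigroup_yosida_le h.solution h.lam_pos h.coercive hε ht x
  · exact fun t ht x => norm_expSemigroup_yosida_range_le h.solution h.lam_pos h.coercive hε hε1
      ht.le x
  · exact fun x => ((continuous_expSemigroup _).clm_apply continuous_const).continuousOn

end Framework

end Framework

end Skeleton

namespace Skeleton

/-! ### Approximation of the control by continuous ones. -/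

section Controls

variable {H : Type*} [NormedAddCommGroup H]

/-- `wn` are continuous controls of energy at most `W` approximating the control `w`. -/
structure ControlApprox (w : ℝ → H) (wn : ℕ → ℝ → H) (W : ℝ) : Prop where
  memLp : MemLp w 2 volume
  measurable : StronglyMeasurable w
  continuous : ∀ n, Continuous (wn n)
  memLp_approx : ∀ n, MemLp (wn n) 2 volume
  energy : ∀ n s t, s ≤ t → ∫ r in s..t, ‖wn n r‖ ^ 2 ≤ W
  lim : ∀ s t, Tendsto (fun n => ∫⁻ r in Ioc s t, ‖wn n r - w r‖ₑ) atTop (𝓝 0)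

theorem ControlApprox.nonneg {w : ℝ → H} {wn : ℕ → ℝ → H} {W : ℝ} (hw : ControlApprox w wn W) :
    0 ≤ W := by
  have := hw.energy 0 0 0 le_rfl
  rwa [intervalIntegral.integral_same] at this

theorem integral_norm_sq_le_of_eLpNorm_le {f : ℝ → H} (hf : MemLp f 2 volume) {a : ENNReal}
    (ha : eLpNorm f 2 volume ≤ a) (hat : a ≠ ⊤) {s t : ℝ} (hst : s ≤ t) :
    ∫ r in s..t, ‖f r‖ ^ 2 ≤ a.toReal ^ 2 := by
  have hinteg : Integrable (fun r => ‖f r‖ ^ 2) := hf.integrable_norm_pow (p := 2) (by norm_num)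
  rw [intervalIntegral.integral_of_le hst]
  refine (setIntegral_le_integral hinteg (Eventually.of_forall fun r => sq_nonneg _)).trans ?_
  have h1 : eLpNorm f 2 volume ^ (2 : ℝ) = ∫⁻ r, ‖f r‖ₑ ^ (2 : ℝ) := by
    have := eLpNorm_nnreal_pow_eq_lintegral (f := f) (μ := volume) (p := 2) (by norm_num)
    simpa using this
  rw [integral_eq_lintegral_of_nonneg_ae (Eventually.of_forall fun r => sq_nonneg _) hinteg.1,
    ← ENNReal.toReal_pow]
  refine ENNReal.toReal_mono (ENNReal.pow_ne_top hat) ?_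
  calc ∫⁻ r, ENNReal.ofReal (‖f r‖ ^ 2) = ∫⁻ r, ‖f r‖ₑ ^ (2 : ℝ) := by
        refine lintegral_congr fun r => ?_
        rw [ENNReal.ofReal_pow (norm_nonneg _), ofReal_norm]
        norm_num
    _ = eLpNorm f 2 volume ^ 2 := by rw [← h1]; norm_num
    _ ≤ a ^ 2 := by gcongr

/-- Continuous compactly supported functions are dense in L²; an error of at most 1/(n+1) ≤ 1 bounds
all energies by (‖w‖ + 1)², and Hölder on bounded intervals gives convergence in L¹. Continuity is
what makes the approximate mild solutions differentiable. -/
theorem exists_controlApprox [NormedSpace ℝ H] {w : ℝ → H} (hw : MemLp w 2 volume) (hm : StronglyMeasurable w) :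
    ∃ wn W, ControlApprox w wn W := by
  have hε : ∀ n : ℕ, ((n : ENNReal) + 1)⁻¹ ≠ 0 := fun n =>
    ENNReal.inv_ne_zero.2 (by simp)
  choose g _ hg hgc hgm using fun n : ℕ =>
    hw.exists_hasCompactSupport_eLpNorm_sub_le (by norm_num) (hε n)
  have hε1 : ∀ n : ℕ, ((n : ENNReal) + 1)⁻¹ ≤ 1 := fun n => by
    rw [ENNReal.inv_le_one]; simp
  refine ⟨g, (eLpNorm w 2 volume + 1).toReal ^ 2, hw, hm, hgc, hgm, ?_, ?_⟩
  · intro n s t hst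
    refine integral_norm_sq_le_of_eLpNorm_le (hgm n) ?_
      (ENNReal.add_ne_top.2 ⟨hw.eLpNorm_ne_top, by simp⟩) hst
    have h1 : g n = w - (w - g n) := by simp
    rw [h1]
    exact (eLpNorm_sub_le hw.1 (hw.1.sub (hgm n).1) (by norm_num)).trans
      (add_le_add le_rfl ((hg n).trans (hε1 n)))
  · intro s t
    have h0 : Tendsto (fun n : ℕ => ((n : ENNReal) + 1)⁻¹ *
        (volume.restrict (Ioc s t)) univ ^ (1 / (1 : ENNReal).toReal - 1 / (2 : ENNReal).toReal))
        atTop (𝓝 0) := by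
      have h1 : Tendsto (fun n : ℕ => ((n : ENNReal) + 1)⁻¹) atTop (𝓝 0) := by
        have := (tendsto_add_atTop_iff_nat 1).2 ENNReal.tendsto_inv_nat_nhds_zero
        simpa using this
      have := ENNReal.Tendsto.mul_const h1 (b := (volume.restrict (Ioc s t)) univ ^
        (1 / (1 : ENNReal).toReal - 1 / (2 : ENNReal).toReal)) (Or.inr ?_)
      · simpa using this
      · refine ENNReal.rpow_ne_top_of_nonneg (by norm_num) ?_
        simp
    refine tendsto_of_tendsto_of_tendsto_of_le_of_le tendsto_const_nhds h0
      (fun n => zero_le) fun n => ?_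
    have h2 := eLpNorm_le_eLpNorm_mul_rpow_measure_univ (μ := volume.restrict (Ioc s t))
      (p := 1) (q := 2) (f := g n - w) (by norm_num) ((hgm n).1.sub hw.1).restrict
    rw [eLpNorm_one_eq_lintegral_enorm] at h2
    refine h2.trans ?_
    gcongr
    refine (eLpNorm_restrict_le _ _ _ _).trans ?_
    rw [eLpNorm_sub_comm]
    exact hg n

end Controls

namespace Framework

variable {V H : Type*} [NormedAddCommGroup V] [NormedSpace ℝ V]
  [NormedAddCommGroup H] [InnerProductSpace ℝ H] [CompleteSpace H]
  {i : V →L[ℝ] H} {A : V →L[ℝ] StrongDual ℝ V} {F : V → H} {B : V → H →L[ℝ] H}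
  {S : ℝ → H →L[ℝ] H} {κ κ' : H →L[ℝ] V} {E : ℝ → H →L[ℝ] H} {φ : H → H}
  {b : H → H →L[ℝ] H} {lam C₀ β D : ℝ} (h : Framework i A F B S κ κ' E φ b lam C₀ β D)

/-! ### Energy estimates for the approximating equations. -/

section Approximation

variable {ε ρ s : ℝ} (hε : 0 < ε) (hε1 : ε ≤ 1) (hρ : 0 < ρ) {w X Z : ℝ → H} {x z : H}
  (hw : Continuous w) (hXc : Continuous X)
  (hX : ∀ t, s ≤ t → SolvesAt (expSemigroup (approxGen (i ∘L κ) ε))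
    (fun t => expSemigroup (approxGen (i ∘L κ) ε) t ∘L yosida (i ∘L κ) ε)
    (fun x => φ (trunc ρ (regularize (i ∘L κ) ε x))) b w s x X t)
  (hZc : Continuous Z)
  (hZ : ∀ t, s ≤ t → SolvesAt (expSemigroup (approxGen (i ∘L κ) ε))
    (fun t => expSemigroup (approxGen (i ∘L κ) ε) t ∘L yosida (i ∘L κ) ε)
    (fun x => φ (trunc ρ (regularize (i ∘L κ) ε x))) b w s z Z t)

include h hε hε1 hρ hw hXc hX

theorem hasDerivAt_approx {t : ℝ} (ht : s < t) :
    HasDerivAt X (approxDrift (i ∘L κ) (fun x => φ (trunc ρ x)) ε (X t) + b (X t) (w t)) t := by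
  obtain ⟨C, θ, -, h2⟩ := h.exists_volterraData hρ
  have hd := h2 ε hε hε1
  have hf : Continuous fun r => yosida (i ∘L κ) ε (φ (trunc ρ (regularize (i ∘L κ) ε (X r)))) +
      b (X r) (w r) :=
    ((yosida (i ∘L κ) ε).continuous.comp (hd.psi_cont.comp
      ((regularize (i ∘L κ) ε).continuous.comp hXc))).add ((hd.b_cont.comp hXc).clm_apply hw)
  have := hasDerivAt_of_mild (G := approxGen (i ∘L κ) ε) (X := X) hf (s := s) (x := x) (fun t ht => by
    rw [hX t ht]
    congr 1
    refine integral_congr_ae (Eventually.of_forall fun r => ?_)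
    simp only [mildIntegrand, map_add]
    rfl) ht
  rw [approxDrift, add_assoc]
  exact this

omit hε hε1 hρ hw hXc h in
theorem approx_initial : X s = x := by
  have := hX s le_rfl
  simpa [SolvesAt] using this

theorem approx_energy {t : ℝ} (ht : s ≤ t) :
    ‖X t‖ ^ 2 + lam * ∫ r in s..t, ‖regularizeV i κ κ' ε (X r)‖ ^ 2 ≤
      ‖x‖ ^ 2 + D ^ 2 / (2 * decayRate i lam) * ∫ r in s..t, ‖w r‖ ^ 2 := by
  have h1 := energy_le (n := fun x => ‖regularizeV i κ κ' ε x‖ ^ 2) (decayRate_pos i h.lam_pos)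
    (by fun_prop) (inner_approxDrift_le h.solution h.lam_pos h.coercive hε h.phi_range
    h.coercive_add hε1 hρ) h.b_bdd hw hXc
    (fun t ht => h.hasDerivAt_approx hε hε1 hρ hw hXc hX ht) ht
  rwa [approx_initial hX] at h1

include hZc hZ

theorem approx_energy_sub {t : ℝ} (ht : s ≤ t)
    (hXρ : ∀ t, s ≤ t → ‖X t‖ ≤ ρ) (hZρ : ∀ t, s ≤ t → ‖Z t‖ ≤ ρ) :
    ‖X t - Z t‖ ^ 2 ≤ ‖x - z‖ ^ 2 * Real.exp (-decayRate i lam * (t - s) +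
      (2 * C₀ * (∫ r in s..t, ‖regularizeV i κ κ' ε (X r)‖ ^ 2) +
        β ^ 2 / decayRate i lam * ∫ r in s..t, ‖w r‖ ^ 2)) := by
  have h1 := energy_sub_le (n := fun x => ‖regularizeV i κ κ' ε x‖ ^ 2)
    (decayRate_pos i h.lam_pos) (by fun_prop)
    (fun x z hx hz => inner_approxDrift_sub_le h.solution h.lam_pos h.coercive hε h.phi_range
      h.monotone h.C₀_nonneg hε1 hρ hx hz) h.b_lip hw hXc hZc
    (fun t ht => h.hasDerivAt_approx hε hε1 hρ hw hXc hX ht)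
    (fun t ht => h.hasDerivAt_approx hε hε1 hρ hw hZc hZ ht) hXρ hZρ ht
  rwa [approx_initial hX, approx_initial hZ] at h1

end Approximation

end Framework

end Skeleton

namespace Skeleton

theorem tendsto_inv_nat_nhdsGT : Tendsto (fun n : ℕ => 1 / ((n : ℝ) + 1)) atTop (𝓝[>] 0) :=
  tendsto_nhdsWithin_iff.2 ⟨tendsto_one_div_add_atTop_nhds_zero_nat,
    Eventually.of_forall fun _ => mem_Ioi.2 Nat.one_div_pos_of_nat⟩

theorem inv_nat_le_one (n : ℕ) : 1 / ((n : ℝ) + 1) ≤ 1 := by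
  rw [div_le_one (by positivity)]
  linarith [(Nat.cast_nonneg n : (0 : ℝ) ≤ n)]

/-! ### Passage to the limit in the truncated equation. -/

namespace Framework

variable {V H : Type*} [NormedAddCommGroup V] [NormedSpace ℝ V]
  [NormedAddCommGroup H] [InnerProductSpace ℝ H] [CompleteSpace H]
  {i : V →L[ℝ] H} {A : V →L[ℝ] StrongDual ℝ V} {F : V → H} {B : V → H →L[ℝ] H}
  {S : ℝ → H →L[ℝ] H} {κ κ' : H →L[ℝ] V} {E : ℝ → H →L[ℝ] H} {φ : H → H}
  {b : H → H →L[ℝ] H} {lam C₀ β D : ℝ} (h : Framework i A F B S κ κ' E φ b lam C₀ β D)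
  {w : ℝ → H} {wn : ℕ → ℝ → H} {W : ℝ} (hw : ControlApprox w wn W)
  {ρ s : ℝ} (hρ : 0 < ρ) {x z : H} {X Z : ℝ → H}

include h hw

omit hw in
theorem energyConst_nonneg : 0 ≤ D ^ 2 / (2 * decayRate i lam) := by
  have := decayRate_pos i h.lam_pos
  positivity

include hρ

/-- Solutions of the truncated equation are limits of solutions of the approximating
equations. -/
theorem exists_approx (hXc : Continuous X)
    (hX : ∀ t, s ≤ t → SolvesAt S E (fun x => φ (trunc ρ x)) b w s x X t) :
    ∃ Xn : ℕ → ℝ → H, (∀ n, Continuous (Xn n)) ∧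
      (∀ n : ℕ, ∀ t, s ≤ t → SolvesAt (expSemigroup (approxGen (i ∘L κ) (1 / ((n : ℝ) + 1))))
        (fun t => expSemigroup (approxGen (i ∘L κ) (1 / ((n : ℝ) + 1))) t ∘L
          yosida (i ∘L κ) (1 / ((n : ℝ) + 1)))
        (fun x => φ (trunc ρ (regularize (i ∘L κ) (1 / ((n : ℝ) + 1)) x))) b (wn n) s x (Xn n) t) ∧
      (∀ (n : ℕ) t, s ≤ t → ‖Xn n t‖ ^ 2 +
        lam * ∫ r in s..t, ‖regularizeV i κ κ' (1 / ((n : ℝ) + 1)) (Xn n r)‖ ^ 2 ≤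
        ‖x‖ ^ 2 + D ^ 2 / (2 * decayRate i lam) * W) ∧
      ∀ t, s ≤ t → Tendsto (fun n => Xn n t) atTop (𝓝 (X t)) := by
  obtain ⟨C, θ, h1, h2⟩ := h.exists_volterraData hρ
  have hK := h.inner_nonneg
  have hε : ∀ n : ℕ, 0 < 1 / ((n : ℝ) + 1) := fun n => Nat.one_div_pos_of_nat
  have hdat := fun n : ℕ => h2 _ (hε n) (inv_nat_le_one n)
  have hR := fun (n : ℕ) => norm_regularize_apply_le hK (hε n)
  choose Xn hXnc hXn using fun n : ℕ =>
    ((hdat n).comp_contraction (hR n)).exists_solution (hw.memLp_approx n) s x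
  have hen : ∀ (n : ℕ) t, s ≤ t → ‖Xn n t‖ ^ 2 +
        lam * ∫ r in s..t, ‖regularizeV i κ κ' (1 / ((n : ℝ) + 1)) (Xn n r)‖ ^ 2 ≤
        ‖x‖ ^ 2 + D ^ 2 / (2 * decayRate i lam) * W := by
    intro n t ht
    have h3 := h.approx_energy (hε n) (inv_nat_le_one n) hρ (hw.continuous n) (hXnc n) (hXn n) ht
    have h4 := mul_le_mul_of_nonneg_left (hw.energy n s t ht) h.energyConst_nonneg
    linarith
  refine ⟨Xn, hXnc, hXn, hen, fun t ht => ?_⟩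
  obtain ⟨M, hM⟩ := isCompact_Icc.exists_bound_of_continuousOn (s := Icc s t) hXc.continuousOn
  have hbd : ∀ n, ∀ r ∈ Icc s t, ‖Xn n r‖ ≤
      √(‖x‖ ^ 2 + D ^ 2 / (2 * decayRate i lam) * W) := by
    intro n r hr
    refine Real.le_sqrt_of_sq_le ?_
    have h3 := hen n r hr.1
    have h4 : 0 ≤ ∫ r in s..r, ‖regularizeV i κ κ' (1 / ((n : ℝ) + 1)) (Xn n r)‖ ^ 2 :=
      intervalIntegral.integral_nonneg hr.1 fun _ _ => sq_nonneg _
    have h5 := mul_nonneg h.lam_pos.le h4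
    linarith
  refine h1.tendsto_solution hw.memLp hw.measurable hdat hw.memLp_approx hR
    (fun t ht x => (tendsto_expSemigroup h.semigroup h.solution h.gelfand h.lam_pos h.coercive ht
      x).comp tendsto_inv_nat_nhdsGT)
    (fun t ht x => (h.E_lim t ht x).comp tendsto_inv_nat_nhdsGT)
    (fun x => (tendsto_regularize hK (h.solution.denseRange_adjoint h.gelfand) x).comp
      tendsto_inv_nat_nhdsGT) hw.lim hXc hXnc
    (B := max M (√(‖x‖ ^ 2 + D ^ 2 / (2 * decayRate i lam) * W)))
    (fun r hr => (hM r hr).trans (le_max_left _ _))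
    (fun n r hr => (hbd n r hr).trans (le_max_right _ _))
    (fun r hr => hX r hr.1) (fun n r hr => hXn n r hr.1) (right_mem_Icc.2 ht)

theorem truncated_norm_sq_le (hXc : Continuous X)
    (hX : ∀ t, s ≤ t → SolvesAt S E (fun x => φ (trunc ρ x)) b w s x X t) {t : ℝ} (ht : s ≤ t) :
    ‖X t‖ ^ 2 ≤ ‖x‖ ^ 2 + D ^ 2 / (2 * decayRate i lam) * W := by
  obtain ⟨Xn, -, -, hen, hlim⟩ := h.exists_approx hw hρ hXc hX
  refine le_of_tendsto ((hlim t ht).norm.pow 2) (Eventually.of_forall fun n => ?_)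
  have h3 := hen n t ht
  have h4 : 0 ≤ ∫ r in s..t, ‖regularizeV i κ κ' (1 / ((n : ℝ) + 1)) (Xn n r)‖ ^ 2 :=
    intervalIntegral.integral_nonneg ht fun _ _ => sq_nonneg _
  have h5 := mul_nonneg h.lam_pos.le h4
  linarith

/-- Solutions of the truncated equation take values in `V` at almost every time. -/
theorem truncated_mem_range (hXc : Continuous X)
    (hX : ∀ t, s ≤ t → SolvesAt S E (fun x => φ (trunc ρ x)) b w s x X t) (T : ℝ) :
    ∀ᵐ r ∂(volume.restrict (Ioc s T)), X r ∈ range i := by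
  rcases lt_or_ge T s with hT | hT
  · rw [Ioc_eq_empty (by linarith)]
    simp
  obtain ⟨Xn, hXnc, -, hen, hlim⟩ := h.exists_approx hw hρ hXc hX
  have hK := h.inner_nonneg
  have hε : ∀ n : ℕ, 0 < 1 / ((n : ℝ) + 1) := fun n => Nat.one_div_pos_of_nat
  let g : ℕ → ℝ → ENNReal := fun n r =>
    ENNReal.ofReal (‖regularizeV i κ κ' (1 / ((n : ℝ) + 1)) (Xn n r)‖ ^ 2)
  have hgc : ∀ n : ℕ,
      Continuous fun r => ‖regularizeV i κ κ' (1 / ((n : ℝ) + 1)) (Xn n r)‖ ^ 2 := fun n =>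
    (((regularizeV i κ κ' (1 / ((n : ℝ) + 1))).continuous.comp (hXnc n)).norm).pow 2
  have hgm : ∀ n, Measurable (g n) := fun n => (hgc n).measurable.ennreal_ofReal
  set M := (‖x‖ ^ 2 + D ^ 2 / (2 * decayRate i lam) * W) / lam with hM
  have hgi : ∀ n, ∫⁻ r in Ioc s T, g n r ≤ ENNReal.ofReal M := by
    intro n
    rw [← ofReal_integral_eq_lintegral_ofReal
      ((hgc n).integrableOn_Icc.mono_set Ioc_subset_Icc_self)
      (Eventually.of_forall fun _ => sq_nonneg _)]
    refine ENNReal.ofReal_le_ofReal ?_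
    have h3 := hen n T hT
    rw [← intervalIntegral.integral_of_le hT, hM, le_div_iff₀ h.lam_pos, mul_comm]
    linarith [sq_nonneg ‖Xn n T‖]
  -- Fatou with the energy bound: at almost every time the regularised approximants are bounded in
  -- `V` along a subsequence, while their images converge to X(r) in `H`.
  have hfatou : ∫⁻ r in Ioc s T, liminf (fun n => g n r) atTop ≠ ⊤ := by
    refine ne_top_of_le_ne_top ENNReal.ofReal_ne_top (b := ENNReal.ofReal M) ?_
    refine (lintegral_liminf_le hgm).trans ?_
    refine (liminf_le_liminf (Eventually.of_forall hgi)).trans ?_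
    simp
  have hae := ae_lt_top (Measurable.liminf hgm) hfatou
  filter_upwards [hae, ae_restrict_mem measurableSet_Ioc] with r hr hrT
  obtain ⟨M', hM'1, hM'2⟩ := exists_between hr
  have hfreq := frequently_lt_of_liminf_lt (by isBoundedDefault) hM'1
  refine mem_range_of_frequently_bounded h.gelfand
    (u := fun n => regularizeV i κ κ' (1 / ((n : ℝ) + 1)) (Xn n r)) (b := √M'.toReal) ?_
    (hfreq.mono fun n hn => ?_)
  · have e1 := (tendsto_regularize hK (h.solution.denseRange_adjoint h.gelfand) (X r)).comp
      tendsto_inv_nat_nhdsGT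
    have e2 : Tendsto (fun n : ℕ => regularize (i ∘L κ) (1 / ((n : ℝ) + 1)) (Xn n r - X r)) atTop
        (𝓝 0) := by
      refine squeeze_zero_norm (fun n => norm_regularize_apply_le hK (hε n) _) ?_
      exact tendsto_iff_norm_sub_tendsto_zero.1 (hlim r hrT.1.le)
    have e3 := e2.add e1
    rw [zero_add] at e3
    refine e3.congr fun n => ?_
    rw [regularizeV_spec h.solution h.lam_pos h.coercive (hε n)]
    simp [Function.comp_apply]
  · refine Real.le_sqrt_of_sq_le ?_
    rw [← ENNReal.toReal_ofReal (sq_nonneg _)]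
    exact ENNReal.toReal_mono hM'2.ne hn.le

/-- The energy bound controls ∫‖p X‖² over every interval by ρ²/λ, so the destabilising terms add a
constant to the exponent that does not grow with t - s. -/
theorem truncated_sub_le (hXc : Continuous X)
    (hX : ∀ t, s ≤ t → SolvesAt S E (fun x => φ (trunc ρ x)) b w s x X t) (hZc : Continuous Z)
    (hZ : ∀ t, s ≤ t → SolvesAt S E (fun x => φ (trunc ρ x)) b w s z Z t)
    (hx : ‖x‖ ^ 2 + D ^ 2 / (2 * decayRate i lam) * W ≤ ρ ^ 2)
    (hz : ‖z‖ ^ 2 + D ^ 2 / (2 * decayRate i lam) * W ≤ ρ ^ 2) {t : ℝ} (ht : s ≤ t) :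
    ‖X t - Z t‖ ^ 2 ≤ ‖x - z‖ ^ 2 * Real.exp (-decayRate i lam * (t - s) +
      (2 * C₀ * (ρ ^ 2 / lam) + β ^ 2 / decayRate i lam * W)) := by
  obtain ⟨Xn, hXnc, hXn, hXen, hXlim⟩ := h.exists_approx hw hρ hXc hX
  obtain ⟨Zn, hZnc, hZn, hZen, hZlim⟩ := h.exists_approx hw hρ hZc hZ
  have hε : ∀ n : ℕ, 0 < 1 / ((n : ℝ) + 1) := fun n => Nat.one_div_pos_of_nat
  have hc := decayRate_pos i h.lam_pos
  have hbd : ∀ (Xn : ℕ → ℝ → H) (x : H),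
      (∀ (n : ℕ) t, s ≤ t → ‖Xn n t‖ ^ 2 +
        lam * ∫ r in s..t, ‖regularizeV i κ κ' (1 / ((n : ℝ) + 1)) (Xn n r)‖ ^ 2 ≤
        ‖x‖ ^ 2 + D ^ 2 / (2 * decayRate i lam) * W) →
      ‖x‖ ^ 2 + D ^ 2 / (2 * decayRate i lam) * W ≤ ρ ^ 2 → ∀ n t, s ≤ t → ‖Xn n t‖ ≤ ρ := by
    intro Xn x hen hx n t ht
    refine le_of_sq_le_sq ?_ hρ.le
    have h3 := hen n t ht
    have h4 : 0 ≤ ∫ r in s..t, ‖regularizeV i κ κ' (1 / ((n : ℝ) + 1)) (Xn n r)‖ ^ 2 :=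
      intervalIntegral.integral_nonneg ht fun _ _ => sq_nonneg _
    have h5 := mul_nonneg h.lam_pos.le h4
    linarith
  refine le_of_tendsto (((hXlim t ht).sub (hZlim t ht)).norm.pow 2)
    (Eventually.of_forall fun n => ?_)
  refine (h.approx_energy_sub (hε n) (inv_nat_le_one n) hρ (hw.continuous n) (hXnc n) (hXn n)
    (hZnc n) (hZn n) ht (hbd Xn x hXen hx n) (hbd Zn z hZen hz n)).trans ?_
  have h1 : ∫ r in s..t, ‖regularizeV i κ κ' (1 / ((n : ℝ) + 1)) (Xn n r)‖ ^ 2 ≤ ρ ^ 2 / lam := by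
    rw [le_div_iff₀ h.lam_pos, mul_comm]
    have := hXen n t ht
    linarith [sq_nonneg ‖Xn n t‖]
  have h2 := hw.energy n s t ht
  have h3 := h.C₀_nonneg
  gcongr

end Framework

end Skeleton

namespace Skeleton

/-- Continuous solutions on `[s, ∞)` of the mild equation in `H`. -/
def IsForward {H : Type*} [NormedAddCommGroup H] [InnerProductSpace ℝ H]
    (S E : ℝ → H →L[ℝ] H) (φ : H → H) (b : H → H →L[ℝ] H) (w : ℝ → H) (s : ℝ) (x : H)
    (X : ℝ → H) : Prop :=
  ContinuousOn X (Ici s) ∧ ∀ t, s ≤ t → SolvesAt S E φ b w s x X t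

theorem SolvesAt.congr {H : Type*} [NormedAddCommGroup H] [InnerProductSpace ℝ H]
    {U E : ℝ → H →L[ℝ] H} {ψ ψ' : H → H} {b : H → H →L[ℝ] H} {w : ℝ → H} {s t : ℝ} {x : H}
    {X Z : ℝ → H} (hX : SolvesAt U E ψ b w s x X t) (hXZ : EqOn X Z (Icc s t)) (hst : s ≤ t)
    (hψ : ∀ r ∈ Icc s t, ψ (X r) = ψ' (X r)) : SolvesAt U E ψ' b w s x Z t := by
  rw [SolvesAt, ← hXZ (right_mem_Icc.2 hst), hX]
  congr 1
  refine setIntegral_congr_fun measurableSet_Ioc fun r hr => ?_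
  have hr' := Ioc_subset_Icc_self hr
  simp only [mildIntegrand]
  rw [hψ r hr', hXZ hr']

theorem exists_radius {H : Type*} [NormedAddCommGroup H] {X : ℝ → H} {s t : ℝ}
    (hX : ContinuousOn X (Icc s t)) :
    ∃ ρ, 0 < ρ ∧ ∀ r ∈ Icc s t, ‖X r‖ ≤ ρ := by
  obtain ⟨M, hM⟩ := isCompact_Icc.exists_bound_of_continuousOn hX
  exact ⟨max M 1, by positivity, fun r hr => (hM r hr).trans (le_max_left _ _)⟩

/-! ### Forward solutions of the equation without truncation. -/

namespace Framework

variable {V H : Type*} [NormedAddCommGroup V] [NormedSpace ℝ V]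
  [NormedAddCommGroup H] [InnerProductSpace ℝ H] [CompleteSpace H]
  {i : V →L[ℝ] H} {A : V →L[ℝ] StrongDual ℝ V} {F : V → H} {B : V → H →L[ℝ] H}
  {S : ℝ → H →L[ℝ] H} {κ κ' : H →L[ℝ] V} {E : ℝ → H →L[ℝ] H} {φ : H → H}
  {b : H → H →L[ℝ] H} {lam C₀ β D : ℝ} (h : Framework i A F B S κ κ' E φ b lam C₀ β D)
  {w : ℝ → H} {wn : ℕ → ℝ → H} {W : ℝ} (hw : ControlApprox w wn W)
  {ρ s t : ℝ} {x z : H} {X Z : ℝ → H}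

include h

theorem integrableOn_E (hX : ContinuousOn X (Icc s t)) :
    IntegrableOn (fun r => E (t - r) (φ (X r))) (Ioc s t) := by
  obtain ⟨ρ, hρ, hXρ⟩ := exists_radius hX
  obtain ⟨C, θ, h1, -⟩ := h.exists_volterraData hρ
  refine (h1.integrableOn_E hX).congr_fun (fun r hr => ?_) measurableSet_Ioc
  simp only [trunc_of_norm_le hρ (hXρ r (Ioc_subset_Icc_self hr))]

theorem integrableOn_S (hw : MemLp w 2 volume) (hX : ContinuousOn X (Icc s t)) :
    IntegrableOn (fun r => S (t - r) (b (X r) (w r))) (Ioc s t) := by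
  obtain ⟨C, θ, h1, -⟩ := h.exists_volterraData one_pos
  exact h1.integrableOn_U hw hX

theorem integral_mildIntegrand (hw : MemLp w 2 volume) (hX : ContinuousOn X (Icc s t)) :
    ∫ r in Ioc s t, mildIntegrand S E φ b w t r (X r) =
      (∫ r in Ioc s t, E (t - r) (φ (X r))) + ∫ r in Ioc s t, S (t - r) (b (X r) (w r)) :=
  integral_add (h.integrableOn_E hX) (h.integrableOn_S hw hX)

theorem semigroup_mildIntegrand {r t' : ℝ} (hr : r < t) (ht : t ≤ t') :
    S (t' - t) (mildIntegrand S E φ b w t r x) = mildIntegrand S E φ b w t' r x := by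
  have h0 : 0 ≤ t' - t := sub_nonneg.2 ht
  have h1 := singular_add h.semigroup (h.solution.denseRange h.gelfand) h.E_range h0
    (sub_pos.2 hr) (φ x)
  have h2 := h.semigroup.add (t' - t) (t - r) h0 (sub_pos.2 hr).le
  have h3 : t' - t + (t - r) = t' - r := by ring
  rw [h3] at h1 h2
  rw [mildIntegrand, mildIntegrand, map_add, ← h1, h2]
  rfl

theorem forward_initial (hX : IsForward S E φ b w s x X) : X s = x := by
  have := hX.2 s le_rfl
  rw [SolvesAt] at this
  rw [this, sub_self, h.semigroup.zero]
  simp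

theorem forward_unique (hw : MemLp w 2 volume) (hX : IsForward S E φ b w s x X)
    (hZ : IsForward S E φ b w s x Z) : EqOn X Z (Ici s) := by
  intro T hT
  obtain ⟨ρ₁, hρ₁, hX1⟩ := exists_radius (hX.1.mono (Icc_subset_Ici_self : Icc s T ⊆ Ici s))
  obtain ⟨ρ₂, hρ₂, hZ1⟩ := exists_radius (hZ.1.mono (Icc_subset_Ici_self : Icc s T ⊆ Ici s))
  have hρ : 0 < max ρ₁ ρ₂ := lt_max_of_lt_left hρ₁
  obtain ⟨C, θ, h1, -⟩ := h.exists_volterraData hρ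
  refine h1.eqOn_of_solvesAt hw (x := x) (hX.1.mono Icc_subset_Ici_self)
    (hZ.1.mono Icc_subset_Ici_self) (fun t ht => ?_) (fun t ht => ?_) (right_mem_Icc.2 hT)
  · refine (hX.2 t ht.1).congr (eqOn_refl _ _) ht.1 fun r hr => ?_
    rw [trunc_of_norm_le hρ ((hX1 r ⟨hr.1, hr.2.trans ht.2⟩).trans (le_max_left _ _))]
  · refine (hZ.2 t ht.1).congr (eqOn_refl _ _) ht.1 fun r hr => ?_
    rw [trunc_of_norm_le hρ ((hZ1 r ⟨hr.1, hr.2.trans ht.2⟩).trans (le_max_right _ _))]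

include hw

/-- The energy bound does not involve the truncation radius; for ρ this large the solution stays in
the ball where truncation is inactive. -/
theorem exists_forward_truncated (hρ : 0 < ρ)
    (hx : ‖x‖ ^ 2 + D ^ 2 / (2 * decayRate i lam) * W ≤ ρ ^ 2) (s : ℝ) :
    ∃ X, Continuous X ∧ IsForward S E φ b w s x X ∧
      ∀ t, s ≤ t → SolvesAt S E (fun x => φ (trunc ρ x)) b w s x X t := by
  obtain ⟨C, θ, h1, -⟩ := h.exists_volterraData hρ
  obtain ⟨X, hXc, hX⟩ := h1.exists_solution hw.memLp s x
  refine ⟨X, hXc, ⟨hXc.continuousOn, fun t ht => ?_⟩, hX⟩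
  refine (hX t ht).congr (eqOn_refl _ _) ht fun r hr => ?_
  rw [trunc_of_norm_le hρ]
  exact le_of_sq_le_sq ((h.truncated_norm_sq_le hw hρ hXc hX hr.1).trans hx) hρ.le

theorem exists_forward (s : ℝ) (x : H) : ∃ X, Continuous X ∧ IsForward S E φ b w s x X := by
  have hc := h.energyConst_nonneg
  have hW := hw.nonneg
  obtain ⟨X, h1, h2, -⟩ := h.exists_forward_truncated hw (x := x)
    (ρ := √(‖x‖ ^ 2 + D ^ 2 / (2 * decayRate i lam) * W + 1)) (by positivity)
    (by rw [Real.sq_sqrt (by positivity)]; linarith) s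
  exact ⟨X, h1, h2⟩

theorem forward_truncated (hX : IsForward S E φ b w s x X) (hρ : 0 < ρ)
    (hx : ‖x‖ ^ 2 + D ^ 2 / (2 * decayRate i lam) * W ≤ ρ ^ 2) :
    ∃ X', EqOn X X' (Ici s) ∧ Continuous X' ∧
      ∀ t, s ≤ t → SolvesAt S E (fun x => φ (trunc ρ x)) b w s x X' t := by
  obtain ⟨X', h1, h2, h3⟩ := h.exists_forward_truncated hw hρ hx s
  exact ⟨X', h.forward_unique hw.memLp hX h2, h1, h3⟩

theorem forward_sub_le (hX : IsForward S E φ b w s x X) (hZ : IsForward S E φ b w s z Z)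
    (hρ : 0 < ρ) (hx : ‖x‖ ^ 2 + D ^ 2 / (2 * decayRate i lam) * W ≤ ρ ^ 2)
    (hz : ‖z‖ ^ 2 + D ^ 2 / (2 * decayRate i lam) * W ≤ ρ ^ 2) (ht : s ≤ t) :
    ‖X t - Z t‖ ^ 2 ≤ ‖x - z‖ ^ 2 * Real.exp (-decayRate i lam * (t - s) +
      (2 * C₀ * (ρ ^ 2 / lam) + β ^ 2 / decayRate i lam * W)) := by
  obtain ⟨X', hX1, hX2, hX3⟩ := h.forward_truncated hw hX hρ hx
  obtain ⟨Z', hZ1, hZ2, hZ3⟩ := h.forward_truncated hw hZ hρ hz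
  rw [hX1 ht, hZ1 ht]
  exact h.truncated_sub_le hw hρ hX2 hX3 hZ2 hZ3 hx hz ht

theorem forward_norm_sq_le (hX : IsForward S E φ b w s x X) (ht : s ≤ t) :
    ‖X t‖ ^ 2 ≤ ‖x‖ ^ 2 + D ^ 2 / (2 * decayRate i lam) * W := by
  have hc := h.energyConst_nonneg
  have hW := hw.nonneg
  have hρ : 0 < √(‖x‖ ^ 2 + D ^ 2 / (2 * decayRate i lam) * W + 1) := by positivity
  obtain ⟨X', hX1, hX2, hX3⟩ := h.forward_truncated hw hX hρ
    (by rw [Real.sq_sqrt (by positivity)]; linarith)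
  rw [hX1 ht]
  exact h.truncated_norm_sq_le hw hρ hX2 hX3 ht

/-- By uniqueness the solution coincides with a truncated one, and a countable union of bounded
intervals covers the half-line up to its endpoint. -/
theorem forward_mem_range (hX : IsForward S E φ b w s x X) :
    ∀ᵐ r ∂(volume.restrict (Ici s)), X r ∈ range i := by
  have hc := h.energyConst_nonneg
  have hW := hw.nonneg
  have hρ : 0 < √(‖x‖ ^ 2 + D ^ 2 / (2 * decayRate i lam) * W + 1) := by positivity
  obtain ⟨X', hX1, hX2, hX3⟩ := h.forward_truncated hw hX hρ
    (by rw [Real.sq_sqrt (by positivity)]; linarith)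
  have h1 : ∀ᵐ r ∂(volume.restrict (⋃ n : ℕ, Ioc s n)), X' r ∈ range i := by
    rw [ae_restrict_iUnion_iff]
    exact fun n => h.truncated_mem_range hw hρ hX2 hX3 n
  have h2 : ⋃ n : ℕ, Ioc s (n : ℝ) = Ioi s := by
    ext r
    simp only [mem_iUnion, mem_Ioc, mem_Ioi]
    exact ⟨fun ⟨n, hn⟩ => hn.1, fun hr => (exists_nat_ge r).imp fun n hn => ⟨hr, hn⟩⟩
  rw [h2, Measure.restrict_congr_set Ioi_ae_eq_Ici] at h1
  filter_upwards [h1, ae_restrict_mem measurableSet_Ici] with r hr hrs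
  rwa [hX1 hrs]

/-- A forward solution may be restarted at any later time. -/
theorem forward_restart (hX : IsForward S E φ b w s x X) {s' : ℝ} (hs : s ≤ s') :
    IsForward S E φ b w s' (X s') X := by
  refine ⟨hX.1.mono (Ici_subset_Ici.2 hs), fun t ht => ?_⟩
  have hst := hs.trans ht
  have hc : ∀ {a c}, s ≤ a → ContinuousOn X (Icc a c) := fun ha =>
    hX.1.mono fun r hr => ha.trans hr.1
  rw [SolvesAt, hX.2 t hst, hX.2 s' hs, map_add, ← ContinuousLinearMap.integral_comp_comm]
  · have h1 : S (t - s') (S (s' - s) x) = S (t - s) x := by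
      have := h.semigroup.add (t - s') (s' - s) (sub_nonneg.2 ht) (sub_nonneg.2 hs)
      rw [sub_add_sub_cancel] at this
      rw [this]
      rfl
    have h2 : ∫ r in Ioc s s', S (t - s') (mildIntegrand S E φ b w s' r (X r)) =
        ∫ r in Ioc s s', mildIntegrand S E φ b w t r (X r) := by
      rw [integral_Ioc_eq_integral_Ioo, integral_Ioc_eq_integral_Ioo]
      exact setIntegral_congr_fun measurableSet_Ioo fun r hr =>
        h.semigroup_mildIntegrand hr.2 ht
    have h3 : IntegrableOn (fun r => mildIntegrand S E φ b w t r (X r)) (Ioc s t) :=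
      (h.integrableOn_E (hc le_rfl)).add (h.integrableOn_S hw.memLp (hc le_rfl))
    rw [h1, h2, ← Ioc_union_Ioc_eq_Ioc hs ht, setIntegral_union (Ioc_disjoint_Ioc_of_le le_rfl)
      measurableSet_Ioc (h3.mono_set (Ioc_subset_Ioc_right ht))
      (h3.mono_set (Ioc_subset_Ioc_left hs)), add_assoc]
  · exact (h.integrableOn_E (hc le_rfl)).add (h.integrableOn_S hw.memLp (hc le_rfl))

end Framework

end Skeleton

namespace Skeleton

theorem IsForward.congr {H : Type*} [NormedAddCommGroup H] [InnerProductSpace ℝ H]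
    {S E : ℝ → H →L[ℝ] H} {φ : H → H} {b : H → H →L[ℝ] H} {w : ℝ → H} {s : ℝ} {x : H}
    {X Z : ℝ → H} (hX : IsForward S E φ b w s x X) (hXZ : EqOn X Z (Ici s)) :
    IsForward S E φ b w s x Z :=
  ⟨hX.1.congr hXZ.symm, fun t ht => (hX.2 t ht).congr (hXZ.mono Icc_subset_Ici_self) ht
    fun _ _ => rfl⟩

theorem exists_lift_of_ae_mem_range {α V H : Type*} [MeasurableSpace α] [Nonempty V] {i : V → H}
    {X : α → H} {μ : Measure α} (hX : ∀ᵐ r ∂μ, X r ∈ range i) :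
    ∃ Y : α → V, ∀ᵐ r ∂μ, i (Y r) = X r := by
  refine ⟨fun r => Function.invFun i (X r), ?_⟩
  filter_upwards [hX] with r hr using Function.invFun_eq hr

/-! ### Equivalence with mild solutions and with the backward equation. -/

namespace Framework

variable {V H : Type*} [NormedAddCommGroup V] [NormedSpace ℝ V]
  [NormedAddCommGroup H] [InnerProductSpace ℝ H] [CompleteSpace H]
  {i : V →L[ℝ] H} {A : V →L[ℝ] StrongDual ℝ V} {F : V → H} {B : V → H →L[ℝ] H}
  {S : ℝ → H →L[ℝ] H} {κ κ' : H →L[ℝ] V} {E : ℝ → H →L[ℝ] H} {φ : H → H}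
  {b : H → H →L[ℝ] H} {lam C₀ β D : ℝ} (h : Framework i A F B S κ κ' E φ b lam C₀ β D)
  {w : ℝ → H} {wn : ℕ → ℝ → H} {W : ℝ} (hw : ControlApprox w wn W)
  {ρ s t : ℝ} {x z : H} {X Z : ℝ → H}

include h

/-- S(t-r)F = E(t-r)K F for r < t; the singular time r = t is a null set. -/
theorem drift_ae_eq {I : Set ℝ} (hI : MeasurableSet I) (hIt : I ⊆ Iic t) {Y : ℝ → V}
    (hY : ∀ᵐ r ∂(volume.restrict I), i (Y r) = X r) :
    (fun r => S (t - r) (F (Y r))) =ᵐ[volume.restrict I] fun r => E (t - r) (φ (X r)) := by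
  have h1 : ∀ᵐ r ∂(volume.restrict I), r ≠ t :=
    ae_restrict_of_ae (compl_mem_ae_iff.2 (measure_singleton t))
  filter_upwards [hY, h1, ae_restrict_mem hI] with r hr hrt hrI
  have h2 : r ≤ t := hIt hrI
  rw [← hr, h.phi_range, h.E_range _ (sub_pos.2 (lt_of_le_of_ne h2 hrt))]

theorem control_ae_eq {I : Set ℝ} {Y : ℝ → V}
    (hY : ∀ᵐ r ∂(volume.restrict I), i (Y r) = X r) :
    (fun r => S (t - r) (B (Y r) (w r))) =ᵐ[volume.restrict I]
      fun r => S (t - r) (b (X r) (w r)) := by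
  filter_upwards [hY] with r hr
  rw [← hr, h.b_range]

include hw

/-- Mild solutions of the skeleton equation are the forward solutions. -/
theorem isMildSolution_iff :
    IsMildSolution i F B S w s x X ↔ IsForward S E φ b w s x X := by
  constructor
  · rintro ⟨hXc, Y, hY, hX⟩
    refine ⟨hXc, fun t ht => ?_⟩
    have hY' : ∀ᵐ r ∂(volume.restrict (Ioc s t)), i (Y r) = X r :=
      ae_restrict_of_ae_restrict_of_subset (fun r hr => hr.1.le) hY
    rw [SolvesAt, h.integral_mildIntegrand hw.memLp (hXc.mono Icc_subset_Ici_self),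
      (hX t ht).2.2, integral_congr_ae (h.drift_ae_eq measurableSet_Ioc Ioc_subset_Iic_self hY'),
      integral_congr_ae (h.control_ae_eq hY'), add_assoc]
  · intro hX
    obtain ⟨Y, hY⟩ := exists_lift_of_ae_mem_range (h.forward_mem_range hw hX)
    refine ⟨hX.1, Y, hY, fun t ht => ?_⟩
    have hY' : ∀ᵐ r ∂(volume.restrict (Ioc s t)), i (Y r) = X r :=
      ae_restrict_of_ae_restrict_of_subset (fun r hr => hr.1.le) hY
    have hXc : ContinuousOn X (Icc s t) := hX.1.mono Icc_subset_Ici_self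
    have h1 := h.drift_ae_eq measurableSet_Ioc Ioc_subset_Iic_self hY'
    have h2 := h.control_ae_eq (w := w) (t := t) hY'
    refine ⟨(h.integrableOn_E hXc).congr h1.symm, (h.integrableOn_S hw.memLp hXc).congr h2.symm,
      ?_⟩
    rw [integral_congr_ae h1, integral_congr_ae h2, add_assoc,
      ← h.integral_mildIntegrand hw.memLp hXc]
    exact hX.2 t ht

-- Near t the singularity is integrable. Before t - 1 the factorisation E(t-r) = S(t-1-r)E(1) brings
-- in the exponential decay of `S`.
omit hw in
theorem integrableOn_E_Iic (hXc : Continuous X) {M : ℝ} (hM : ∀ r, ‖X r‖ ≤ M) (t : ℝ) :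
    IntegrableOn (fun r => E (t - r) (φ (X r))) (Iic t) := by
  have hM0 : 0 ≤ M := (norm_nonneg _).trans (hM 0)
  have hρ : 0 < M + 1 := by linarith
  have hc := decayRate_pos i h.lam_pos
  obtain ⟨C, θ, h1, -⟩ := h.exists_volterraData hρ
  have htr : ∀ r, trunc (M + 1) (X r) = X r := fun r =>
    trunc_of_norm_le hρ ((hM r).trans (by linarith))
  have h2 : Iic t = Iic (t - 1) ∪ Ioc (t - 1) t := (Iic_union_Ioc_eq_Iic (by linarith)).symm
  rw [h2]
  refine IntegrableOn.union ?_ (h.integrableOn_E hXc.continuousOn)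
  have hg := ((integrableOn_exp_mul_Iic hc (t - 1)).const_mul
    (Real.exp (-decayRate i lam * (t - 1)) * (C * (1 ^ (θ - 1) + 1) * (M + 1))))
  refine Integrable.mono' hg ?_ ?_
  · have := h1.aestronglyMeasurable_E (t := t) (D := Iic (t - 1)) measurableSet_Iic
      (Iic_subset_Iic.2 (by linarith)) hXc.continuousOn
    simpa only [htr] using this
  · filter_upwards [ae_restrict_mem measurableSet_Iic] with r hr
    have hr : r ≤ t - 1 := hr
    have h3 := singular_add h.semigroup (h.solution.denseRange h.gelfand) h.E_range
      (s := t - 1 - r) (sub_nonneg.2 hr) one_pos (φ (X r))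
    have h4 : t - 1 - r + 1 = t - r := by ring
    rw [h4] at h3
    have h5 := h1.norm_E_psi_le one_pos (X r)
    simp only [htr] at h5
    rw [h3]
    refine (norm_semigroup_apply_le h.semigroup h.solution h.gelfand h.lam_pos h.coercive
      (sub_nonneg.2 hr) _).trans ?_
    have h6 : Real.exp (-decayRate i lam * (t - 1 - r)) =
        Real.exp (-decayRate i lam * (t - 1)) * Real.exp (decayRate i lam * r) := by
      rw [← Real.exp_add]; congr 1; ring
    have h7 : ‖E 1 (φ (X r))‖ ≤ C * (1 ^ (θ - 1) + 1) * (M + 1) := by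
      refine h5.trans ?_
      have := h1.nonneg
      have h8 : (0 : ℝ) ≤ 1 ^ (θ - 1) := Real.rpow_nonneg zero_le_one _
      gcongr
      exact hM r
    calc _ ≤ Real.exp (-decayRate i lam * (t - 1 - r)) * (C * (1 ^ (θ - 1) + 1) * (M + 1)) := by
          gcongr
      _ = _ := by rw [h6]; ring

theorem integrableOn_S_Iic (hXc : Continuous X) (t : ℝ) :
    IntegrableOn (fun r => S (t - r) (b (X r) (w r))) (Iic t) := by
  have hc := decayRate_pos i h.lam_pos
  have hD := h.D_nonneg
  obtain ⟨C, θ, h1, -⟩ := h.exists_volterraData one_pos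
  have hw2 : Integrable (fun r => ‖w r‖ ^ 2) := hw.memLp.integrable_norm_pow (p := 2) (by norm_num)
  have hg := ((integrableOn_exp_mul_Iic (show 0 < 2 * decayRate i lam by linarith) t).const_mul
    (D / 2 * Real.exp (-(2 * decayRate i lam * t)))).add (hw2.integrableOn.const_mul (D / 2))
  refine Integrable.mono' hg ?_ ?_
  · exact h1.aestronglyMeasurable_U_apply measurableSet_Iic Subset.rfl
      (h1.aestronglyMeasurable_b hw.memLp.1 measurableSet_Iic hXc.continuousOn)
  · filter_upwards [ae_restrict_mem measurableSet_Iic] with r hr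
    have hr : r ≤ t := hr
    refine (norm_semigroup_apply_le h.semigroup h.solution h.gelfand h.lam_pos h.coercive
      (sub_nonneg.2 hr) _).trans ?_
    have h2 : ‖b (X r) (w r)‖ ≤ D * ‖w r‖ := (b (X r)).le_of_opNorm_le (h.b_bdd _) _
    set e := Real.exp (-decayRate i lam * (t - r)) with he
    have h3 : Real.exp (-(2 * decayRate i lam * t)) * Real.exp (2 * decayRate i lam * r) =
        e ^ 2 := by
      rw [he, ← Real.exp_add, ← Real.exp_nat_mul]; congr 1; push_cast; ring
    have h4 : e * ‖b (X r) (w r)‖ ≤ e * (D * ‖w r‖) :=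
      mul_le_mul_of_nonneg_left h2 (Real.exp_pos _).le
    simp only [Pi.add_apply]
    rw [mul_assoc, h3]
    have h5 := mul_nonneg hD (sq_nonneg (e - ‖w r‖))
    linarith

/-- Let s → -∞ in the forward equation: S(t-s)X(s) vanishes by decay and boundedness, and the
integrals converge. -/
theorem backward_of_forward (hXc : Continuous X) {M : ℝ} (hM : ∀ r, ‖X r‖ ≤ M)
    (hX : ∀ s, IsForward S E φ b w s (X s) X) : IsBackwardSolution i F B S w X := by
  have hc := decayRate_pos i h.lam_pos
  have hae : ∀ᵐ r, X r ∈ range i := by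
    have h1 : ∀ᵐ r ∂(volume.restrict (⋃ n : ℕ, Ici (-(n : ℝ)))), X r ∈ range i := by
      rw [ae_restrict_iUnion_iff]
      exact fun n => h.forward_mem_range hw (hX _)
    have h2 : ⋃ n : ℕ, Ici (-(n : ℝ)) = univ := by
      ext r
      simp only [mem_iUnion, mem_Ici, mem_univ, iff_true]
      exact (exists_nat_ge (-r)).imp fun n hn => by linarith
    rwa [h2, Measure.restrict_univ] at h1
  obtain ⟨Y, hY⟩ := exists_lift_of_ae_mem_range hae
  refine ⟨hXc, Y, hY, fun t => ?_⟩
  have h1 := h.drift_ae_eq (t := t) measurableSet_Iic Subset.rfl (ae_restrict_of_ae hY)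
  have h2 := h.control_ae_eq (w := w) (t := t) (I := Iic t) (ae_restrict_of_ae hY)
  have hE := h.integrableOn_E_Iic hXc hM t
  have hS := h.integrableOn_S_Iic hw hXc t
  refine ⟨hE.congr h1.symm, hS.congr h2.symm, ?_⟩
  rw [integral_congr_ae h1, integral_congr_ae h2, ← integral_add hE hS]
  have hlim := intervalIntegral_tendsto_integral_Iic t (hE.add hS) (tendsto_id (x := atBot))
  have hlim0 : Tendsto (fun s => S (t - s) (X s)) atBot (𝓝 0) := by
    have hexp : Tendsto (fun s => Real.exp (-decayRate i lam * (t - s)) * M) atBot (𝓝 0) := by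
      have h3 : Tendsto (fun s : ℝ => -decayRate i lam * (t - s)) atBot atBot := by
        refine Tendsto.const_mul_atTop_of_neg (by linarith) ?_
        exact tendsto_atTop_add_const_left _ _ tendsto_neg_atBot_atTop
      simpa using (Real.tendsto_exp_atBot.comp h3).mul_const M
    refine squeeze_zero_norm' ?_ hexp
    filter_upwards [eventually_le_atBot t] with s hs
    refine (norm_semigroup_apply_le h.semigroup h.solution h.gelfand h.lam_pos h.coercive
      (sub_nonneg.2 hs) _).trans ?_
    exact mul_le_mul_of_nonneg_left (hM s) (Real.exp_pos _).le
  have hsum := hlim0.add hlim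
  rw [zero_add] at hsum
  refine tendsto_nhds_unique (tendsto_const_nhds.congr' ?_) hsum
  filter_upwards [eventually_le_atBot t] with s hs
  rw [id, intervalIntegral.integral_of_le hs]
  exact (hX s).2 t hs

-- Split the integral at s. The part before s is S(t-s) applied to the backward formula for X(s).
omit hw in
theorem forward_of_backward (hX : IsBackwardSolution i F B S w X) (s : ℝ) :
    IsForward S E φ b w s (X s) X := by
  obtain ⟨hXc, Y, hY, hX⟩ := hX
  have key : ∀ t, IntegrableOn (fun r => mildIntegrand S E φ b w t r (X r)) (Iic t) ∧
      X t = ∫ r in Iic t, mildIntegrand S E φ b w t r (X r) := by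
    intro t
    obtain ⟨hE, hS, hXt⟩ := hX t
    have h1 := h.drift_ae_eq (t := t) measurableSet_Iic Subset.rfl (ae_restrict_of_ae hY)
    have h2 := h.control_ae_eq (w := w) (t := t) (I := Iic t) (ae_restrict_of_ae hY)
    have hE' := hE.congr h1
    have hS' := hS.congr h2
    refine ⟨hE'.add hS', ?_⟩
    rw [hXt, integral_congr_ae h1, integral_congr_ae h2]
    exact (integral_add hE' hS').symm
  refine ⟨hXc.continuousOn, fun t ht => ?_⟩
  have h1 : S (t - s) (X s) = ∫ r in Iic s, mildIntegrand S E φ b w t r (X r) := by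
    rw [(key s).2, ← ContinuousLinearMap.integral_comp_comm _ (key s).1,
      integral_Iic_eq_integral_Iio, integral_Iic_eq_integral_Iio]
    exact setIntegral_congr_fun measurableSet_Iio fun r hr => h.semigroup_mildIntegrand hr ht
  rw [SolvesAt, h1, (key t).2, ← setIntegral_union (Iic_disjoint_Ioc le_rfl) measurableSet_Ioc
    ((key t).1.mono_set (Iic_subset_Iic.2 ht)) ((key t).1.mono_set Ioc_subset_Iic_self),
    Iic_union_Ioc_eq_Iic ht]

end Framework

end Skeleton

namespace Skeleton

section Inclusion

variable {H : Type*} [NormedAddCommGroup H] [InnerProductSpace ℝ H] [CompleteSpace H]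

/-- The inclusion of `H₀` in `H` as a bounded operator. -/
noncomputable def H0.toHL (R : H →L[ℝ] H) : H0 R →L[ℝ] H :=
  (H0.toH R).mkContinuous ‖R‖ fun u => by
    rw [← H0.apply_pinv]
    exact R.le_opNorm _

theorem exists_controlApprox_of_Lp (R : H →L[ℝ] H) (v : Lp (H0 R) 2 (volume : Measure ℝ)) :
    ∃ wn W, ControlApprox (fun r => H0.toH R (v r)) wn W :=
  exists_controlApprox ((H0.toHL R).comp_memLp' (Lp.memLp v))
    ((H0.toHL R).continuous.comp_stronglyMeasurable (Lp.stronglyMeasurable v))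

end Inclusion

theorem tendsto_decay_nat {c : ℝ} (hc : 0 < c) (a M : ℝ) :
    Tendsto (fun n : ℕ => M * Real.exp (a - c * n)) atTop (𝓝 0) := by
  have h1 : Tendsto (fun n : ℕ => a - c * (n : ℝ)) atTop atBot := by
    refine tendsto_atBot_add_const_left _ a (tendsto_neg_atTop_atBot.comp ?_)
    exact tendsto_natCast_atTop_atTop.const_mul_atTop hc
  simpa using (Real.tendsto_exp_atBot.comp h1).const_mul M

/-! ### Contraction and the limit of solutions started at -n. -/

namespace Framework

variable {V H : Type*} [NormedAddCommGroup V] [NormedSpace ℝ V]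
  [NormedAddCommGroup H] [InnerProductSpace ℝ H] [CompleteSpace H]
  {i : V →L[ℝ] H} {A : V →L[ℝ] StrongDual ℝ V} {F : V → H} {B : V → H →L[ℝ] H}
  {S : ℝ → H →L[ℝ] H} {κ κ' : H →L[ℝ] V} {E : ℝ → H →L[ℝ] H} {φ : H → H}
  {b : H → H →L[ℝ] H} {lam C₀ β D : ℝ} (h : Framework i A F B S κ κ' E φ b lam C₀ β D)
  {w : ℝ → H} {wn : ℕ → ℝ → H} {W : ℝ} (hw : ControlApprox w wn W)

include h hw

/-- Solutions in the same bounded set contract, uniformly in the initial time. -/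
theorem exists_contraction (m : ℝ) : ∃ a : ℝ, 0 ≤ a ∧ ∀ (s t : ℝ) (x z : H) (X Z : ℝ → H),
    IsForward S E φ b w s x X → IsForward S E φ b w s z Z → ‖x‖ ^ 2 ≤ m → ‖z‖ ^ 2 ≤ m → s ≤ t →
    ‖X t - Z t‖ ^ 2 ≤ ‖x - z‖ ^ 2 * Real.exp (a - decayRate i lam * (t - s)) := by
  have hc := decayRate_pos i h.lam_pos
  have hc1 := h.energyConst_nonneg
  have hW := hw.nonneg
  have hl := h.lam_pos
  have hC := h.C₀_nonneg
  have hρ2 : 0 < |m| + D ^ 2 / (2 * decayRate i lam) * W + 1 := by positivity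
  have hρ := Real.sqrt_pos.2 hρ2
  refine ⟨2 * C₀ * (√(|m| + D ^ 2 / (2 * decayRate i lam) * W + 1) ^ 2 / lam) +
    β ^ 2 / decayRate i lam * W, by positivity, fun s t x z X Z hX hZ hx hz ht => ?_⟩
  have hm := le_abs_self m
  refine (h.forward_sub_le hw hX hZ hρ (by rw [Real.sq_sqrt hρ2.le]; linarith)
    (by rw [Real.sq_sqrt hρ2.le]; linarith) ht).trans (le_of_eq ?_)
  congr 2
  ring

/-- The solutions started from `0` at time `-n`. -/
theorem exists_started : ∃ Xn : ℕ → ℝ → H,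
    (∀ n : ℕ, IsForward S E φ b w (-n) 0 (Xn n) ∧ ∀ t ≤ -(n : ℝ), Xn n t = 0) ∧
    (∀ (n : ℕ) (Z : ℝ → H), IsStartedAt i F B S w n Z ↔ Z = Xn n) ∧
    ∀ n t, ‖Xn n t‖ ^ 2 ≤ D ^ 2 / (2 * decayRate i lam) * W := by
  choose Y hYc hY using fun n : ℕ => h.exists_forward hw (-(n : ℝ)) 0
  let Xn : ℕ → ℝ → H := fun n t => if t ≤ -n then 0 else Y n t
  have hXY : ∀ n : ℕ, EqOn (Y n) (Xn n) (Ici (-(n : ℝ))) := by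
    intro n t ht
    simp only [Xn]
    split_ifs with h1
    · rw [le_antisymm h1 ht]
      exact h.forward_initial (hY n)
    · rfl
  have hXf : ∀ n : ℕ, IsForward S E φ b w (-n) 0 (Xn n) := fun n => (hY n).congr (hXY n)
  have hX0 : ∀ n : ℕ, ∀ t ≤ -(n : ℝ), Xn n t = 0 := fun n t ht => if_pos ht
  refine ⟨Xn, fun n => ⟨hXf n, hX0 n⟩, fun n Z => ⟨fun hZ => ?_, ?_⟩, fun n t => ?_⟩
  · funext t
    rcases le_total t (-(n : ℝ)) with ht | ht
    · rw [hZ.2 t ht, hX0 n t ht]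
    · exact h.forward_unique hw.memLp ((h.isMildSolution_iff hw).1 hZ.1) (hXf n) ht
  · rintro rfl
    exact ⟨(h.isMildSolution_iff hw).2 (hXf n), hX0 n⟩
  · rcases le_total t (-(n : ℝ)) with ht | ht
    · rw [hX0 n t ht]
      have := mul_nonneg h.energyConst_nonneg hw.nonneg
      simpa using this
    · simpa using h.forward_norm_sq_le hw (hXf n) ht

/-- Well-posedness of the backward equation, and its approximation by the solutions started
from `0` at time `-n`. -/
theorem backward_wellPosed : ∃ X : ℝ → H,
    (IsBackwardSolution i F B S w X ∧ BddAbove (range fun t => ‖X t‖ ^ 2)) ∧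
    (∀ Z : ℝ → H, IsBackwardSolution i F B S w Z → BddAbove (range fun t => ‖Z t‖ ^ 2) → Z = X) ∧
    ∃ Xn : ℕ → ℝ → H,
      (∀ (n : ℕ) (Z : ℝ → H), IsStartedAt i F B S w n Z ↔ Z = Xn n) ∧
      ∀ N : ℕ, TendstoUniformlyOn Xn X atTop (Icc (-(N : ℝ)) N) := by
  obtain ⟨Xn, hXn, hiff, hbd⟩ := h.exists_started hw
  have hc := decayRate_pos i h.lam_pos
  set c := decayRate i lam
  set m := D ^ 2 / (2 * c) * W
  have hm : 0 ≤ m := mul_nonneg h.energyConst_nonneg hw.nonneg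
  obtain ⟨a, ha, hcontr⟩ := h.exists_contraction hw m
  have hdiff : ∀ (x z : H) (m : ℝ), ‖x‖ ^ 2 ≤ m → ‖z‖ ^ 2 ≤ m → ‖x - z‖ ^ 2 ≤ 4 * m := by
    intro x z m hx hz
    have h1 : ‖x - z‖ ^ 2 ≤ (‖x‖ + ‖z‖) ^ 2 := by gcongr; exact norm_sub_le x z
    nlinarith [sq_nonneg (‖x‖ - ‖z‖)]
  have hfw : ∀ (n : ℕ) (s : ℝ), -(n : ℝ) ≤ s → IsForward S E φ b w s (Xn n s) (Xn n) :=
    fun n s hs => h.forward_restart hw (hXn n).1 hs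
  -- After -n both paths are forward solutions and contract. Before -n the exponent is nonnegative,
  -- thanks to a ≥ 0, and the trivial bound 4m suffices, so one rate holds for all t.
  have hcauchy : ∀ (t : ℝ) (n k : ℕ), n ≤ k →
      ‖Xn n t - Xn k t‖ ^ 2 ≤ 4 * m * Real.exp (a - c * t - c * n) := by
    intro t n k hnk
    rcases le_total (-(n : ℝ)) t with ht | ht
    · have hkn : -(k : ℝ) ≤ -n := neg_le_neg (Nat.cast_le.2 hnk)
      refine (hcontr (-n) t _ _ _ _ (hfw n (-n) le_rfl) (hfw k (-n) hkn) (hbd _ _) (hbd _ _)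
        ht).trans ?_
      have h1 : a - c * (t - -n) = a - c * t - c * n := by ring
      rw [h1]
      exact mul_le_mul_of_nonneg_right (hdiff _ _ _ (hbd _ _) (hbd _ _)) (Real.exp_pos _).le
    · refine (hdiff _ _ _ (hbd n t) (hbd k t)).trans ?_
      refine le_mul_of_one_le_right (by positivity) (Real.one_le_exp ?_)
      have := mul_le_mul_of_nonneg_left ht hc.le
      linarith
  have hlim : ∀ t, ∃ y, Tendsto (fun n => Xn n t) atTop (𝓝 y) := by
    intro t
    refine cauchySeq_tendsto_of_complete (cauchySeq_of_le_tendsto_0'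
      (fun n : ℕ => √(4 * m * Real.exp (a - c * t - c * n))) (fun n k hnk => ?_) ?_)
    · rw [dist_eq_norm]
      exact Real.le_sqrt_of_sq_le (hcauchy t n k hnk)
    · have := (tendsto_decay_nat hc (a - c * t) (4 * m)).sqrt
      simpa using this
  choose X hX using hlim
  have hrate : ∀ (t : ℝ) (n : ℕ), ‖Xn n t - X t‖ ^ 2 ≤ 4 * m * Real.exp (a - c * t - c * n) := by
    intro t n
    refine le_of_tendsto (((hX t).const_sub (Xn n t)).norm.pow 2) ?_
    filter_upwards [eventually_ge_atTop n] with k hk using hcauchy t n k hk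
  have hXb : ∀ t, ‖X t‖ ^ 2 ≤ m := fun t =>
    le_of_tendsto ((hX t).norm.pow 2) (Eventually.of_forall fun n => hbd n t)
  -- Compare with the solution Z started at s from X(s): since Xn(s) → X(s), contraction gives Xn →
  -- Z after s, so Z = X there and no limit under the integral is needed.
  have hXfw : ∀ s, IsForward S E φ b w s (X s) X := by
    intro s
    obtain ⟨Z, -, hZ⟩ := h.exists_forward hw s (X s)
    refine hZ.congr fun t ht => ?_
    have h0 : Tendsto (fun n => ‖Xn n s - X s‖ ^ 2 * Real.exp (a - c * (t - s))) atTop (𝓝 0) := by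
      have := ((tendsto_iff_norm_sub_tendsto_zero.1 (hX s)).pow 2).mul_const
        (Real.exp (a - c * (t - s)))
      simpa using this
    have h1 : Tendsto (fun n => ‖Xn n t - Z t‖ ^ 2) atTop (𝓝 0) := by
      refine squeeze_zero' (Eventually.of_forall fun n => sq_nonneg _) ?_ h0
      obtain ⟨n₀, hn₀⟩ := exists_nat_ge (-s)
      filter_upwards [eventually_ge_atTop n₀] with n hn
      have : (n₀ : ℝ) ≤ n := Nat.cast_le.2 hn
      exact hcontr s t _ _ _ _ (hfw n s (by linarith)) hZ (hbd _ _) (hXb s) ht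
    have h2 := (((hX t).sub_const (Z t)).norm.pow 2)
    have h3 := tendsto_nhds_unique h2 h1
    exact (sub_eq_zero.1 (norm_eq_zero.1 (pow_eq_zero_iff two_ne_zero |>.1 h3))).symm
  have hXc : Continuous X := continuous_iff_continuousAt.2 fun t =>
    (hXfw (t - 1)).1.continuousAt (Ici_mem_nhds (by linarith))
  refine ⟨X, ⟨h.backward_of_forward hw hXc (M := √m)
    (fun r => Real.le_sqrt_of_sq_le (hXb r)) hXfw, ⟨m, ?_⟩⟩, ?_, Xn, hiff, ?_⟩
  · rintro _ ⟨t, rfl⟩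
    exact hXb t
  · rintro Z hZ ⟨m', hm'⟩
    have hZb : ∀ t, ‖Z t‖ ^ 2 ≤ max m m' := fun t => (hm' ⟨t, rfl⟩).trans (le_max_right _ _)
    have hXb' : ∀ t, ‖X t‖ ^ 2 ≤ max m m' := fun t => (hXb t).trans (le_max_left _ _)
    obtain ⟨a', -, hcontr'⟩ := h.exists_contraction hw (max m m')
    funext t
    have h1 : ∀ n : ℕ, ‖Z t - X t‖ ^ 2 ≤ 4 * max m m' * Real.exp (a' - c * n) := by
      intro n
      -- Contraction is started at t - n, where the distance is bounded uniformly in n; letting n →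
      -- ∞ forces equality at t.
      have h2 := hcontr' (t - n) t _ _ _ _ (h.forward_of_backward hZ _) (hXfw _) (hZb _) (hXb' _)
        (by linarith [(Nat.cast_nonneg n : (0 : ℝ) ≤ n)])
      rw [sub_sub_cancel] at h2
      exact h2.trans (mul_le_mul_of_nonneg_right (hdiff _ _ _ (hZb _) (hXb' _))
        (Real.exp_pos _).le)
    have h3 := ge_of_tendsto' (tendsto_decay_nat hc a' (4 * max m m')) h1
    exact sub_eq_zero.1 (norm_eq_zero.1
      (pow_eq_zero_iff two_ne_zero |>.1 (le_antisymm h3 (sq_nonneg _))))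
  · intro N
    rw [Metric.tendstoUniformlyOn_iff]
    intro ε hε
    have h1 := (tendsto_decay_nat hc (a + c * N) (4 * m)).eventually
      (gt_mem_nhds (show 0 < ε ^ 2 by positivity))
    filter_upwards [h1] with n hn t ht
    rw [dist_comm, dist_eq_norm]
    refine lt_of_pow_lt_pow_left₀ 2 hε.le (lt_of_le_of_lt ((hrate t n).trans ?_) hn)
    have h2 := mul_le_mul_of_nonneg_left ht.1 hc.le
    gcongr
    linarith

end Framework

end Skeleton

theorem theorem3p1
    {V H : Type*} [NormedAddCommGroup V] [NormedSpace ℝ V] [CompleteSpace V]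
    [NormedAddCommGroup H] [InnerProductSpace ℝ H] [CompleteSpace H]
    [TopologicalSpace.SeparableSpace H]
    (i : V →L[ℝ] H) (hi : Skeleton.IsGelfandTriple i)
    (Q R : H →L[ℝ] H) (hQ : Skeleton.IsTraceClassCovariance Q) (hR : Skeleton.IsPosSqrt R Q)
    (A : V →L[ℝ] StrongDual ℝ V) (F : V → H) (B : V → H →L[ℝ] H)
    (S : ℝ → H →L[ℝ] H) (hS : Skeleton.IsSemigroupOf i A S)
    (hyp : Skeleton.Hypotheses i A F B S)
    (M : ℝ) (hM : 0 < M)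
    (v : Lp (Skeleton.H0 R) 2 (volume : Measure ℝ)) (hv : v ∈ Skeleton.controls R M) :
    ∃ X : ℝ → H,
      (Skeleton.IsBackwardSolution i F B S (fun r => Skeleton.H0.toH R (v r)) X ∧
        BddAbove (range fun t => ‖X t‖ ^ 2)) ∧
      (∀ Z : ℝ → H,
        Skeleton.IsBackwardSolution i F B S (fun r => Skeleton.H0.toH R (v r)) Z →
        BddAbove (range fun t => ‖Z t‖ ^ 2) → Z = X) ∧
      ∃ Xn : ℕ → ℝ → H,
        (∀ (n : ℕ) (Z : ℝ → H),
          Skeleton.IsStartedAt i F B S (fun r => Skeleton.H0.toH R (v r)) n Z ↔ Z = Xn n) ∧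
        ∀ N : ℕ, TendstoUniformlyOn Xn X atTop (Icc (-(N : ℝ)) N) := by
  obtain ⟨κ, κ', E, φ, b, lam, C₀, β, D, h⟩ := Skeleton.exists_framework hi hS hyp
  obtain ⟨wn, W, hw⟩ := Skeleton.exists_controlApprox_of_Lp R v
  exact h.backward_wellPosed hw
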